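/- Fix a wavenumber $\kappa>0$ with wavelength $\lambda=2\pi/\kappa$, an incidence angle $\theta\in(-\pi/2,\pi/2)$, and a cavity $D_\epsilon=(0,\epsilon)\times(-d,0)$ of width $\epsilon>0$ and depth $d>0$, with aperture $\Gamma_\epsilon^+=(0,\epsilon)\times\{0\}$ and bottom $\Gamma_\epsilon^-=(0,\epsilon)\times\{-d\}$, below the plane $\Gamma_0=\{x_2=0\}$. Let $\phi_0=1/\sqrt\epsilon$, $u^{\rm inc}(x)=e^{i\kappa(x_1\sin\theta-x_2\cos\theta)}$, $u^{\rm ref}(x)=e^{i\kappa(x_1\sin\theta+x_2\cos\theta)}$, and for a function $v$ put $v_0^+=\int_0^\epsilon v(x_1,0)\phi_0\,dx_1$ (values taken from above) and $v_0^-=\int_0^\epsilon v(x_1,-d)\phi_0\,dx_1$. A function $v_\epsilon$ is a solution of the approximate PEC-PMC cavity problem if it is $C^2$ in $\mathbb R^2_+=\{x_2>0\}$, continuous up to $\Gamma_0$, has square-integrable gradient on bounded parts of $\mathbb R^2_+$, and satisfies $$\Delta v_\epsilon+\kappa^2v_\epsilon=0\ \text{ in }\mathbb R^2_+,\qquad \partial_{x_2}v_\epsilon=0\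 \text{ on }\Gamma_0\setminus\overline{\Gamma_\epsilon^+},\qquad \partial_{x_2}v_\epsilon=i\kappa\,\frac{e^{2i\kappa d}+1}{e^{2i\kappa d}-1}\,v_{\epsilon,0}^+\,\phi_0\ \text{ on }\Gamma_\epsilon^+$$ (boundary values of $\partial_{x_2}v_\epsilon$ being limits from $\mathbb R^2_+$), together with the Sommerfeld condition $\sqrt r(\partial_r v^{\rm sc}-i\kappa v^{\rm sc})\to0$ as $r=|x|\to\infty$, uniformly in direction in $\mathbb R^2_+$, for $v^{\rm sc}=v_\epsilon-u^{\rm inc}-u^{\rm ref}$; moreover $v_\epsilon=0$ on $\Gamma_\epsilon^-$, and in $D_\epsilon$ $$v_\epsilon(x)=\bigl(\tilde\alpha_0^+e^{-i\kappa x_2}+\tilde\alpha_0^-e^{i\kappa(x_2+d)}\bigr)\phi_0,\qquad \tilde\alpha_0^+=\frac{e^{i\kappa d}v_{\epsilon,0}^{-}-v_{\epsilon,0}^{+}}{e^{2i\kappa d}-1},\qquad \tilde\alpha_0^-=\frac{e^{i\kappa d}v_{\epsilon,0}^{+}-v_{\epsilon,0}^{-}}{e^{2i\kappa d}-1}.$$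 Theorem. There are constants $\delta,C_3,C_4>0$, independent of $\lambda,\epsilon,d$ (and of $\theta$), such that whenever $\epsilon\le\delta d$ and $d\le\delta\lambda$, every solution $v_\epsilon$ of the approximate problem satisfies $$\|v_\epsilon\|_{L^2(D_\epsilon)}\le C_4\sqrt{\epsilon d},$$ and, if in addition $\epsilon\ln(\lambda/d)\le d$, also $$C_3\sqrt{\epsilon d}\le\|v_\epsilon\|_{L^2(D_\epsilon)}.$$ -/

import Mathlib

open Real MeasureTheory Filter Topology
open scoped Laplacian

noncomputable section

namespace Cavity

/-- The plane `ℝ²` with its Euclidean norm; `x 0` and `x 1` are the coordinates `x₁` and `x₂`. -/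
abbrev Plane : Type := EuclideanSpace ℝ (Fin 2)

/-- The open upper half-plane `x₂ > 0`. -/
def upperHalf : Set Plane := {x | 0 < x 1}

/-- The closed upper half-plane `x₂ ≥ 0`. -/
def closedUpperHalf : Set Plane := {x | 0 ≤ x 1}

/-- The rectangular cavity `(0, ε) × (-d, 0)`. -/
def cavity (ε d : ℝ) : Set Plane := {x | 0 < x 0 ∧ x 0 < ε ∧ -d < x 1 ∧ x 1 < 0}

/-- The bottom side `(0, ε) × {-d}` of the cavity. -/
def bottom (ε d : ℝ) : Set Plane := {x | 0 < x 0 ∧ x 0 < ε ∧ x 1 = -d}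

/-- The wavelength `λ = 2π / κ`. -/
def wavelength (κ : ℝ) : ℝ := 2 * π / κ

/-- The incident plane wave `exp (i κ x · (sin θ, -cos θ))`. -/
def uInc (κ θ : ℝ) (x : Plane) : ℂ :=
  Complex.exp (Complex.I * (κ * (x 0 * sin θ - x 1 * cos θ) : ℝ))

/-- The reflected plane wave `exp (i κ x · (sin θ, cos θ))`. -/
def uRef (κ θ : ℝ) (x : Plane) : ℂ :=
  Complex.exp (Complex.I * (κ * (x 0 * sin θ + x 1 * cos θ) : ℝ))

/-- The lowest waveguide mode `φ₀ = 1 / √ε` on `(0, ε)`. -/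
def phi0 (ε : ℝ) (_x₁ : ℝ) : ℂ := ((1 / √ε : ℝ) : ℂ)

/-- The coefficient `∫₀^ε v(x₁, h) φ₀(x₁) dx₁` of the lowest mode at height `h`
(`h = 0` is the aperture, `h = -d` the bottom). The mode is real-valued. -/
def modeCoeff (ε : ℝ) (v : Plane → ℂ) (h : ℝ) : ℂ :=
  ∫ x₁ in (0 : ℝ)..ε, v !₂[x₁, h] * phi0 ε x₁

/-- The one-mode Dirichlet-to-Neumann map
`B₀[v] = i κ (e^{2iκd} + 1) / (e^{2iκd} - 1) v₀⁺ φ₀` on the aperture. -/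
def dtn0 (κ ε d : ℝ) (v : Plane → ℂ) (x₁ : ℝ) : ℂ :=
  Complex.I * κ * ((Complex.exp (2 * Complex.I * κ * d) + 1) /
    (Complex.exp (2 * Complex.I * κ * d) - 1)) * modeCoeff ε v 0 * phi0 ε x₁

/-- The amplitude `(e^{iκd} v₀⁻ - v₀⁺) / (e^{2iκd} - 1)`, where `vp = v₀⁺` and `vm = v₀⁻`. -/
def alphaPlus (κ d : ℝ) (vp vm : ℂ) : ℂ :=
  (Complex.exp (Complex.I * κ * d) * vm - vp) / (Complex.exp (2 * Complex.I * κ * d) - 1)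

/-- The amplitude `(e^{iκd} v₀⁺ - v₀⁻) / (e^{2iκd} - 1)`, where `vp = v₀⁺` and `vm = v₀⁻`. -/
def alphaMinus (κ d : ℝ) (vp vm : ℂ) : ℂ :=
  (Complex.exp (Complex.I * κ * d) * vp - vm) / (Complex.exp (2 * Complex.I * κ * d) - 1)

/-- The scattered field `v - (uInc + uRef)`. -/
def scattered (κ θ : ℝ) (v : Plane → ℂ) (x : Plane) : ℂ :=
  v x - (uInc κ θ x + uRef κ θ x)

/-- The Sommerfeld radiation condition `√r (∂ᵣ u - i κ u) → 0` as `r = |x| → ∞`,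
uniformly over the directions of the upper half-plane. -/
def Radiating (κ : ℝ) (u : Plane → ℂ) : Prop :=
  Tendsto
    (fun x : Plane => (√‖x‖ : ℂ) * (fderiv ℝ u x (‖x‖⁻¹ • x) - Complex.I * κ * u x))
    (Bornology.cobounded Plane ⊓ 𝓟 upperHalf) (𝓝 0)

/-- `v` is a solution of the approximate PEC-PMC cavity problem with wavenumber `κ`, angle of
incidence `θ`, cavity width `ε` and cavity depth `d`. On `x₂ = 0` the values of `v` are the traces
from above. -/
structure IsApproxSolution (κ θ ε d : ℝ) (v : Plane → ℂ) : Prop where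
  contDiffOn : ContDiffOn ℝ 2 v upperHalf
  continuousOn : ContinuousOn v closedUpperHalf
  /-- Finite energy in bounded parts of the half-plane, including near the aperture's ends. -/
  finiteEnergy : ∀ R : ℝ, MemLp (fderiv ℝ v) 2 (volume.restrict (upperHalf ∩ Metric.ball 0 R))
  helmholtz : ∀ x ∈ upperHalf, Δ v x + (κ : ℂ) ^ 2 * v x = 0
  /-- `∂₂ v = 0` on the conducting plane outside the aperture. -/
  neumann : ∀ a : ℝ, (a < 0 ∨ ε < a) →
    Tendsto (fun x : Plane => fderiv ℝ v x !₂[0, 1]) (𝓝[upperHalf] !₂[a, 0]) (𝓝 0)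
  /-- `∂₂ v = B₀[v]` on the aperture. -/
  aperture : ∀ a : ℝ, 0 < a → a < ε →
    Tendsto (fun x : Plane => fderiv ℝ v x !₂[0, 1]) (𝓝[upperHalf] !₂[a, 0])
      (𝓝 (dtn0 κ ε d v a))
  radiating : Radiating κ (scattered κ θ v)
  bottom_eq_zero : ∀ x ∈ bottom ε d, v x = 0
  cavity_eq : ∀ x ∈ cavity ε d,
    v x = (alphaPlus κ d (modeCoeff ε v 0) (modeCoeff ε v (-d)) *
          Complex.exp (-Complex.I * κ * x 1)
        + alphaMinus κ d (modeCoeff ε v 0) (modeCoeff ε v (-d)) *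
          Complex.exp (Complex.I * κ * (x 1 + d))) * phi0 ε (x 0)

end Cavity

end

/-! The problem reduces to one scalar equation for S = ∫₀^ε v(x₁,0) dx₁. In the cavity, v = 0 on the
bottom makes the two exponentials combine into (S/ε) sin(κ(x₂+d)) / sin(κd) up to the sign
conventions of the amplitudes (`norm_cavity`). Since κd is small, the sine ratio is at most 1, and
at least 1/2 in the upper half of the cavity. Hence ‖v‖ is comparable to (|S|/ε)√(εd), and |S|/ε
must be bounded from above and below.

Above the plane, the scattered field has Neumann datum c = κ cot(κd) S/ε on the aperture and 0
elsewhere. Let h = (πi/2) H₀⁽¹⁾. Green's identity against h(κ|x-z|), with the source z brought to a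
boundary point (y,0), gives π vˢᶜ(y,0) + c ∫₀^ε h(κ|t-y|) dt = 0 (`trace_representation`). On the
plane the incident and reflected waves add up to w(t) = 2 exp(iκt sin θ), so averaging over y yields
S (1 + mJ) = ∫ w, with m = κ cot(κd)/(πε) and J = ∬ h(κ|t-y|) dt dy (`aperture_equation`).

Upper bound: Re h ≥ 0 on (0, π/4], so |1 + mJ| ≥ 1 and |S| ≤ 2ε. Lower bound: |h(r)| ≤ C + log(1/r)
near 0 and mε ≤ 1/d give m|J| ≤ (ε/d)(C + 2 + log(1/(κε))). The logarithm is at most log(λ/d) +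
log(d/ε); the first term is controlled by the extra hypothesis, the second because s log(1/s) is
bounded. Since |∫ w| ≥ ε, |S| is at least a constant multiple of ε.

Three points need care. All facts on h are read off a Laplace integral. At the ends of the aperture
only continuity of the field is used: Green's identity is obtained from a stream function on
contours slightly above the plane, and the flux around each end is shown to vanish by averaging over
radii and integrating by parts in the radius. At infinity no decay is assumed: the radiation
condition, integrated along rays, gives growth o(√r), which suffices because the source satisfies
that condition with error O(r^(-3/2)). -/

noncomputable section

namespace Cavity

/-! ### The outgoing radial solution of the Helmholtz equation -/

/-- The density `(t (t - 2i))^(-1/2)` in the Laplace representation of the Hankel function. -/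
def hankelDensity (t : ℝ) : ℂ := ((t : ℂ) * (t - 2 * Complex.I)) ^ (-(1 / 2) : ℂ)

/-- The `n`-th derivative of `(π i / 2) H₀⁽¹⁾(r)`, as a Laplace integral. -/
def hankel (n : ℕ) (r : ℝ) : ℂ :=
  ∫ t in Set.Ioi (0 : ℝ),
    (Complex.I - t) ^ n * Complex.exp (r * (Complex.I - t)) * hankelDensity t

theorem base_mem_slitPlane {t : ℝ} (ht : 0 < t) :
    ((t : ℂ) * (t - 2 * Complex.I)) ∈ Complex.slitPlane := by
  left
  simp
  positivity

theorem hankelDensity_sq {t : ℝ} (ht : 0 < t) :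
    hankelDensity t ^ 2 = ((t : ℂ) * (t - 2 * Complex.I))⁻¹ := by
  have h0 := Complex.slitPlane_ne_zero (base_mem_slitPlane ht)
  rw [hankelDensity, ← Complex.cpow_nat_mul, ← Complex.cpow_neg_one]
  congr 1
  norm_num

theorem norm_sub_two_I (t : ℝ) : ‖(t : ℂ) - 2 * Complex.I‖ ^ 2 = t ^ 2 + 4 := by
  rw [← Complex.normSq_eq_norm_sq, Complex.normSq_apply]
  simp
  ring

theorem norm_hankelDensity_sq {t : ℝ} (ht : 0 < t) :
    ‖hankelDensity t‖ ^ 2 = (t * ‖(t : ℂ) - 2 * Complex.I‖)⁻¹ := by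
  rw [← norm_pow, hankelDensity_sq ht, norm_inv, norm_mul, Complex.norm_of_nonneg ht.le]

theorem norm_hankelDensity_le {t : ℝ} (ht : 0 < t) :
    ‖hankelDensity t‖ ≤ t ^ (-(1 / 2) : ℝ) := by
  have h1 : ‖hankelDensity t‖ ^ 2 ≤ (t ^ (-(1 / 2) : ℝ)) ^ 2 := by
    rw [norm_hankelDensity_sq ht, ← rpow_natCast, ← rpow_mul ht.le]
    norm_num
    rw [rpow_neg_one]
    have : 1 ≤ ‖(t : ℂ) - 2 * Complex.I‖ := by
      nlinarith [norm_sub_two_I t, norm_nonneg ((t : ℂ) - 2 * Complex.I), sq_nonneg t]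
    have h2 : ‖(t : ℂ) - 2 * Complex.I‖⁻¹ ≤ 1 := inv_le_one_of_one_le₀ this
    have h3 : 0 < t⁻¹ := inv_pos.2 ht
    nlinarith
  exact le_of_sq_le_sq h1 (by positivity)

/-- The principal argument lies in (-π, π]; the power -1/2 brings it into [-π/2, π/2). -/
theorem hankelDensity_re_nonneg (t : ℝ) : 0 ≤ (hankelDensity t).re := by
  by_cases h0 : ((t : ℂ) * (t - 2 * Complex.I)) = 0
  · rw [hankelDensity, h0, Complex.zero_cpow (by norm_num)]; simp
  rw [hankelDensity, Complex.cpow_def_of_ne_zero h0, Complex.exp_re]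
  refine mul_nonneg (Real.exp_pos _).le (Real.cos_nonneg_of_neg_pi_div_two_le_of_le ?_ ?_)
  all_goals
    have e : (Complex.log ((t : ℂ) * (t - 2 * Complex.I)) * (-(1 / 2))).im =
        -(1 / 2) * Complex.arg ((t : ℂ) * (t - 2 * Complex.I)) := by
      have : (-(1 / 2) : ℂ) = ((-(1 / 2) : ℝ) : ℂ) := by push_cast; ring
      rw [this, Complex.im_mul_ofReal, Complex.log_im]; ring
    rw [e]
    have := Complex.arg_le_pi ((t : ℂ) * (t - 2 * Complex.I))
    have := Complex.neg_pi_lt_arg ((t : ℂ) * (t - 2 * Complex.I))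
    linarith

/-- The square of the density is 1/(t(t-2i)), whose real part re² - im² is nonnegative. -/
theorem abs_hankelDensity_im_le {t : ℝ} (ht : 0 < t) :
    |(hankelDensity t).im| ≤ (hankelDensity t).re := by
  apply abs_le_of_sq_le_sq _ (hankelDensity_re_nonneg t)
  have h := congrArg Complex.re (hankelDensity_sq ht)
  have h2 : 0 ≤ (((t : ℂ) * (t - 2 * Complex.I))⁻¹).re := by
    rw [Complex.inv_re]
    apply div_nonneg _ (Complex.normSq_nonneg _)
    simp
    positivity
  rw [← h, sq, Complex.mul_re] at h2
  linarith

theorem continuousAt_hankelDensity {t : ℝ} (ht : 0 < t) : ContinuousAt hankelDensity t := by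
  unfold hankelDensity
  refine ContinuousAt.cpow (by fun_prop) (by fun_prop) (base_mem_slitPlane ht)

/-- Writing ρ for the density, (tρ-1)(tρ+1) = 2i/(t-2i), and |tρ+1| ≥ 1 because Re ρ ≥ 0. The decay
for large t governs h' near the origin. -/
theorem norm_mul_hankelDensity_sub_one_le {t : ℝ} (ht : 0 < t) :
    ‖t * hankelDensity t - 1‖ ≤ t ^ (-(1 / 2) : ℝ) := by
  have h0 := Complex.slitPlane_ne_zero (base_mem_slitPlane ht)
  have ht' : (t : ℂ) ≠ 0 := by exact_mod_cast ht.ne'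
  have h1 : (t : ℂ) - 2 * Complex.I ≠ 0 := (mul_ne_zero_iff.1 h0).2
  have key : (t * hankelDensity t - 1) * (t * hankelDensity t + 1) =
      2 * Complex.I / (t - 2 * Complex.I) := by
    have : (t * hankelDensity t - 1) * (t * hankelDensity t + 1) =
      t ^ 2 * hankelDensity t ^ 2 - 1 := by ring
    rw [this, hankelDensity_sq ht]
    field_simp
    ring
  have h2 : 1 ≤ ‖t * hankelDensity t + 1‖ := by
    refine le_trans ?_ (Complex.re_le_norm _)
    simp only [Complex.add_re, Complex.re_ofReal_mul, Complex.one_re]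
    nlinarith [mul_nonneg ht.le (hankelDensity_re_nonneg t)]
  have h3 := congrArg norm key
  rw [norm_mul, norm_div] at h3
  have h4 : ‖t * hankelDensity t - 1‖ ≤ 2 / ‖(t : ℂ) - 2 * Complex.I‖ := by
    have : ‖2 * Complex.I‖ = 2 := by simp
    rw [← this, ← h3]
    nlinarith [norm_nonneg (t * hankelDensity t - 1)]
  refine h4.trans ?_
  have h5 : (0 : ℝ) < ‖(t : ℂ) - 2 * Complex.I‖ := norm_pos_iff.2 h1
  have h6 : (2 / ‖(t : ℂ) - 2 * Complex.I‖) ^ 2 ≤ (t ^ (-(1 / 2) : ℝ)) ^ 2 := by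
    rw [← rpow_natCast (t ^ (-(1 / 2) : ℝ)), ← rpow_mul ht.le]
    norm_num
    rw [rpow_neg_one, div_pow, norm_sub_two_I, ← one_div, div_le_div_iff₀ (by positivity) ht]
    nlinarith [sq_nonneg (t - 2)]
  exact le_of_sq_le_sq h6 (by positivity)

theorem integrableOn_rpow_mul_exp {s r : ℝ} (hs : -1 < s) (hr : 0 < r) :
    IntegrableOn (fun t : ℝ => t ^ s * exp (-(r * t))) (Set.Ioi 0) := by
  have := integrableOn_rpow_mul_exp_neg_mul_rpow (p := 1) hs one_pos hr
  simpa using this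

/-- Half of the exponential absorbs the polynomial: 1 + t ≤ s⁻¹ exp(st) for 0 < s ≤ 1, and s is
chosen so that ns ≤ r/2. -/
theorem one_add_pow_mul_exp_le {n : ℕ} {r t : ℝ} (hr : 0 < r) (ht : 0 < t) :
    (1 + t) ^ n * exp (-(r * t)) ≤ ((min 1 (r / (2 * (n + 1))))⁻¹) ^ n * exp (-(r / 2 * t)) := by
  set s := min 1 (r / (2 * (n + 1))) with hs
  have hs0 : 0 < s := lt_min one_pos (by positivity)
  have h1 : 1 + t ≤ s⁻¹ * exp (s * t) := by
    have h2 : s ≤ 1 := min_le_left _ _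
    have h3 := Real.add_one_le_exp (s * t)
    rw [← div_eq_inv_mul, le_div_iff₀ hs0]
    nlinarith
  have h4 : (1 + t) ^ n ≤ (s⁻¹) ^ n * exp (n * (s * t)) := by
    calc (1 + t) ^ n ≤ (s⁻¹ * exp (s * t)) ^ n := by gcongr
      _ = _ := by rw [mul_pow, Real.exp_nat_mul]
  have h5 : n * s ≤ r / 2 := by
    have : s ≤ r / (2 * (n + 1)) := min_le_right _ _
    rw [le_div_iff₀ (by positivity)] at this
    nlinarith
  calc (1 + t) ^ n * exp (-(r * t)) ≤ (s⁻¹) ^ n * exp (n * (s * t)) * exp (-(r * t)) := by gcongr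
    _ = (s⁻¹) ^ n * exp (n * (s * t) + -(r * t)) := by rw [mul_assoc, ← Real.exp_add]
    _ ≤ _ := by
      gcongr
      nlinarith

theorem norm_hankelIntegrand_le {n : ℕ} {r t : ℝ} (ht : 0 < t) :
    ‖(Complex.I - t) ^ n * Complex.exp (r * (Complex.I - t)) * hankelDensity t‖ ≤
      (1 + t) ^ n * exp (-(r * t)) * t ^ (-(1 / 2) : ℝ) := by
  rw [norm_mul, norm_mul, norm_pow, Complex.norm_exp]
  have h1 : ‖Complex.I - t‖ ≤ 1 + t := by
    refine (norm_sub_le _ _).trans ?_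
    simp [abs_of_pos ht]
  have h2 : ((r : ℂ) * (Complex.I - t)).re = -(r * t) := by simp
  rw [h2]
  gcongr
  exact norm_hankelDensity_le ht

theorem continuousOn_hankelIntegrand (n : ℕ) (r : ℝ) :
    ContinuousOn (fun t : ℝ =>
      (Complex.I - t) ^ n * Complex.exp (r * (Complex.I - t)) * hankelDensity t) (Set.Ioi 0) := by
  intro t ht
  apply ContinuousAt.continuousWithinAt
  exact ContinuousAt.mul (by fun_prop) (continuousAt_hankelDensity ht)

theorem integrableOn_hankelIntegrand (n : ℕ) {r : ℝ} (hr : 0 < r) :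
    IntegrableOn (fun t : ℝ =>
      (Complex.I - t) ^ n * Complex.exp (r * (Complex.I - t)) * hankelDensity t) (Set.Ioi 0) := by
  have hi := (integrableOn_rpow_mul_exp (s := -(1 / 2)) (by norm_num) (half_pos hr)).const_mul
    (((min 1 (r / (2 * (n + 1))))⁻¹) ^ n)
  refine Integrable.mono' hi
    ((continuousOn_hankelIntegrand n r).aestronglyMeasurable measurableSet_Ioi) ?_
  refine (ae_restrict_iff' measurableSet_Ioi).2 (Eventually.of_forall fun t ht => ?_)
  have ht : 0 < t := ht
  refine (norm_hankelIntegrand_le ht).trans ?_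
  have := mul_le_mul_of_nonneg_right (one_add_pow_mul_exp_le (n := n) hr ht)
    (rpow_nonneg ht.le (-(1 / 2)))
  linarith

theorem hasDerivAt_hankel (n : ℕ) {r : ℝ} (hr : 0 < r) :
    HasDerivAt (hankel n) (hankel (n + 1) r) r := by
  have hr2 : 0 < r / 2 := half_pos hr
  -- On the neighbourhood x > r/2 the differentiated integrand is dominated by its bound at r/2;
  -- absorbing the polynomial halves the rate once more.
  have hi := (integrableOn_rpow_mul_exp (s := -(1 / 2)) (by norm_num) (half_pos hr2)).const_mul
    (((min 1 (r / 2 / (2 * ((n + 1 : ℕ) + 1))))⁻¹) ^ (n + 1))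
  refine (hasDerivAt_integral_of_dominated_loc_of_deriv_le (Ioi_mem_nhds (half_lt_self hr))
    (Eventually.of_forall fun x =>
      (continuousOn_hankelIntegrand n x).aestronglyMeasurable measurableSet_Ioi)
    (integrableOn_hankelIntegrand n hr)
    ((continuousOn_hankelIntegrand (n + 1) r).aestronglyMeasurable measurableSet_Ioi)
    (F' := fun r t => (Complex.I - t) ^ (n + 1) * Complex.exp (r * (Complex.I - t)) *
      hankelDensity t) ?_ hi ?_).2
  · refine (ae_restrict_iff' measurableSet_Ioi).2 (Eventually.of_forall fun t ht x hx => ?_)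
    have ht : 0 < t := ht
    have hx : r / 2 < x := hx
    refine (norm_hankelIntegrand_le ht).trans ?_
    have h1 := mul_le_mul_of_nonneg_right (one_add_pow_mul_exp_le (n := n + 1) hr2 ht)
      (rpow_nonneg ht.le (-(1 / 2)))
    have h2 : (1 + t) ^ (n + 1) * exp (-(x * t)) * t ^ (-(1 / 2) : ℝ) ≤
      (1 + t) ^ (n + 1) * exp (-(r / 2 * t)) * t ^ (-(1 / 2) : ℝ) := by gcongr
    linarith
  · refine Eventually.of_forall fun t x _ => ?_
    have h1 : HasDerivAt (fun x : ℝ => Complex.exp (x * (Complex.I - t)))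
        (Complex.exp (x * (Complex.I - t)) * (Complex.I - t)) x := by
      have := ((Complex.ofRealCLM.hasDerivAt (x := x)).mul_const (Complex.I - (t : ℂ))).cexp
      simpa using this
    have := (h1.const_mul ((Complex.I - (t : ℂ)) ^ n)).mul_const (hankelDensity t)
    exact this.congr_deriv (by ring)

/-- Bessel's equation. Under the integral sign its left side is minus the t-derivative of
exp(r(i-t)) √(t(t-2i)), which vanishes at t = 0 and decays at infinity. -/
theorem hankel_bessel {r : ℝ} (hr : 0 < r) :
    r * (hankel 2 r + hankel 0 r) + hankel 1 r = 0 := by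
  set S : ℝ → ℂ := fun t => ((t : ℂ) * (t - 2 * Complex.I)) ^ (1 / 2 : ℂ)
  have hSh : ∀ t : ℝ, 0 < t → S t = (t : ℂ) * (t - 2 * Complex.I) * hankelDensity t := by
    intro t ht
    have h0 := Complex.slitPlane_ne_zero (base_mem_slitPlane ht)
    have h1 := Complex.cpow_add (-(1 / 2)) 1 h0
    rw [Complex.cpow_one] at h1
    simp only [S, hankelDensity]
    refine Eq.trans ?_ (h1.trans (mul_comm _ _))
    norm_num
  have hSd : ∀ t : ℝ, 0 < t → HasDerivAt S ((t - Complex.I) * hankelDensity t) t := by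
    intro t ht
    have hq : HasDerivAt (fun z : ℂ => z * (z - 2 * Complex.I)) (2 * t - 2 * Complex.I) (t : ℂ) := by
      have := (hasDerivAt_id (t : ℂ)).mul ((hasDerivAt_id (t : ℂ)).sub_const (2 * Complex.I))
      exact this.congr_deriv (by simp only [id, one_mul, mul_one]; ring)
    have := (hq.cpow_const (c := (1 / 2 : ℂ)) (base_mem_slitPlane ht)).comp_ofReal
    refine this.congr_deriv ?_
    rw [hankelDensity]
    norm_num
    ring
  have hS0 : S 0 = 0 := by simp [S]
  have hF : ∀ t : ℝ, 0 < t → HasDerivAt (fun t : ℝ => Complex.exp (r * (Complex.I - t)) * S t)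
      (-(r * ((Complex.I - t) ^ 2 * Complex.exp (r * (Complex.I - t)) * hankelDensity t +
        (Complex.I - t) ^ 0 * Complex.exp (r * (Complex.I - t)) * hankelDensity t) +
        (Complex.I - t) ^ 1 * Complex.exp (r * (Complex.I - t)) * hankelDensity t)) t := by
    intro t ht
    have h1 : HasDerivAt (fun t : ℝ => Complex.exp (r * (Complex.I - t)))
        (Complex.exp (r * (Complex.I - t)) * (-r)) t := by
      have := (((Complex.ofRealCLM.hasDerivAt (x := t)).const_sub Complex.I).const_mul (r : ℂ)).cexp
      simpa using this
    have := h1.mul (hSd t ht)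
    refine this.congr_deriv ?_
    rw [hSh t ht]
    ring_nf
    rw [Complex.I_sq]
    ring
  have hSn : ∀ t : ℝ, 0 < t → ‖S t‖ ≤ (1 + t) * 2 * t ^ (1 / 2 : ℝ) := by
    intro t ht
    rw [hSh t ht, norm_mul, norm_mul, Complex.norm_of_nonneg ht.le]
    have h1 : ‖(t : ℂ) - 2 * Complex.I‖ ≤ (1 + t) * 2 := by
      refine (norm_sub_le _ _).trans ?_
      simp [abs_of_pos ht]; linarith
    calc t * ‖(t : ℂ) - 2 * Complex.I‖ * ‖hankelDensity t‖
        ≤ t * ((1 + t) * 2) * t ^ (-(1 / 2) : ℝ) := by gcongr; exact norm_hankelDensity_le ht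
      _ = (1 + t) * 2 * (t ^ (1 : ℝ) * t ^ (-(1 / 2) : ℝ)) := by rw [rpow_one]; ring
      _ = _ := by rw [← rpow_add ht]; norm_num
  have hint := integrableOn_hankelIntegrand
  have key := integral_Ioi_of_hasDerivAt_of_tendsto (m := 0)
    (f := fun t : ℝ => Complex.exp (r * (Complex.I - t)) * S t) ?_ (fun t ht => hF t ht)
    ((((hint 2 hr).add (hint 0 hr)).const_mul (r : ℂ)).add (hint 1 hr)).neg ?_
  · rw [integral_neg, integral_add, integral_const_mul, integral_add] at key
    · simp only [hS0, mul_zero, sub_zero, neg_eq_zero] at key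
      exact key
    · exact hint 2 hr
    · exact hint 0 hr
    · exact ((hint 2 hr).add (hint 0 hr)).const_mul (r : ℂ)
    · exact hint 1 hr
  · have : ContinuousWithinAt S (Set.Ici 0) 0 := by
      rw [ContinuousWithinAt, hS0]
      rw [tendsto_zero_iff_norm_tendsto_zero]
      have hlim : Tendsto (fun t : ℝ => (1 + t) * 2 * t ^ (1 / 2 : ℝ)) (𝓝[≥] 0) (𝓝 0) := by
        have : ContinuousAt (fun t : ℝ => (1 + t) * 2 * t ^ (1 / 2 : ℝ)) 0 := by
          apply ContinuousAt.mul (by fun_prop)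
          exact Real.continuousAt_rpow_const _ _ (Or.inr (by norm_num))
        have h := this.tendsto.mono_left (nhdsWithin_le_nhds (s := Set.Ici 0))
        simpa [Real.zero_rpow] using h
      refine tendsto_of_tendsto_of_tendsto_of_le_of_le' tendsto_const_nhds hlim
        (Eventually.of_forall fun _ => norm_nonneg _) ?_
      filter_upwards [self_mem_nhdsWithin] with t ht
      rcases eq_or_lt_of_le (show 0 ≤ t from ht) with h | h
      · rw [← h, hS0]; simp [Real.zero_rpow]
      · exact hSn t h
    exact ContinuousWithinAt.mul (by fun_prop) this
  · rw [tendsto_zero_iff_norm_tendsto_zero]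
    have hlim : Tendsto (fun t : ℝ => 2 * (((min 1 (r / (2 * ((1 : ℕ) + 1))))⁻¹) ^ 1 *
        (t ^ (1 / 2 : ℝ) * exp (-(r / 2) * t)))) atTop (𝓝 0) := by
      have := tendsto_rpow_mul_exp_neg_mul_atTop_nhds_zero (1 / 2) (r / 2) (half_pos hr)
      simpa only [mul_zero] using
        (this.const_mul (((min 1 (r / (2 * ((1 : ℕ) + 1))))⁻¹) ^ 1)).const_mul 2
    refine tendsto_of_tendsto_of_tendsto_of_le_of_le' tendsto_const_nhds hlim
        (Eventually.of_forall fun _ => norm_nonneg _) ?_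
    filter_upwards [eventually_gt_atTop 0] with t ht
    rw [norm_mul, Complex.norm_exp]
    have h2 : ((r : ℂ) * (Complex.I - t)).re = -(r * t) := by simp
    rw [h2]
    have h3 := one_add_pow_mul_exp_le (n := 1) hr ht
    have h4 := mul_le_mul_of_nonneg_right h3 (rpow_nonneg ht.le (1 / 2))
    have h5 := mul_le_mul_of_nonneg_left (hSn t ht) (Real.exp_pos (-(r * t))).le
    have h6 : -(r / 2) * t = -(r / 2 * t) := by ring
    rw [h6]
    simp only [pow_one] at h4 ⊢
    linarith

theorem continuousAt_hankel (n : ℕ) {r : ℝ} (hr : 0 < r) : ContinuousAt (hankel n) r :=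
  (hasDerivAt_hankel n hr).continuousAt

theorem integral_rpow_mul_exp {s r : ℝ} (hs : 0 < s) (hr : 0 < r) :
    ∫ t in Set.Ioi (0 : ℝ), t ^ (s - 1) * exp (-(r * t)) = (1 / r) ^ s * Real.Gamma s :=
  Real.integral_rpow_mul_exp_neg_mul_Ioi hs hr

theorem norm_hankel_zero_le {r : ℝ} (hr : 0 < r) :
    ‖hankel 0 r‖ ≤ Real.Gamma (1 / 2) * (1 / r) ^ (1 / 2 : ℝ) := by
  have hi := integrableOn_rpow_mul_exp (s := -(1 / 2)) (by norm_num) hr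
  have h := integral_rpow_mul_exp (s := 1 / 2) (by norm_num) hr
  rw [mul_comm, ← h]
  have e : (1 / 2 - 1 : ℝ) = -(1 / 2) := by norm_num
  rw [e]
  refine norm_integral_le_of_norm_le hi ?_
  refine (ae_restrict_iff' measurableSet_Ioi).2 (Eventually.of_forall fun t ht => ?_)
  refine (norm_hankelIntegrand_le ht).trans (le_of_eq ?_)
  rw [pow_zero, one_mul, mul_comm]

/-- The combination h' - ih puts an extra factor t in the integrand; this factor is what improves
the decay from r^(-1/2) to r^(-3/2), which is the radiation condition for h. -/
theorem hankel_one_sub {r : ℝ} (hr : 0 < r) :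
    hankel 1 r - Complex.I * hankel 0 r = -∫ t in Set.Ioi (0 : ℝ),
      Complex.exp (r * (Complex.I - t)) * (t * hankelDensity t) := by
  rw [hankel, hankel, ← integral_const_mul, ← integral_sub, ← integral_neg]
  · congr 1
    ext t
    ring
  · exact integrableOn_hankelIntegrand 1 hr
  · exact (integrableOn_hankelIntegrand 0 hr).const_mul _

theorem norm_cexp_mul_I_sub (r t : ℝ) :
    ‖Complex.exp (r * (Complex.I - t))‖ = exp (-(r * t)) := by
  rw [Complex.norm_exp]; simp

theorem norm_hankel_one_sub_le {r : ℝ} (hr : 0 < r) :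
    ‖hankel 1 r - Complex.I * hankel 0 r‖ ≤ Real.Gamma (3 / 2) * (1 / r) ^ (3 / 2 : ℝ) := by
  have hi := integrableOn_rpow_mul_exp (s := 1 / 2) (by norm_num) hr
  have h := integral_rpow_mul_exp (s := 3 / 2) (by norm_num) hr
  rw [mul_comm (Real.Gamma _), ← h, hankel_one_sub hr, norm_neg]
  have e : (3 / 2 - 1 : ℝ) = 1 / 2 := by norm_num
  rw [e]
  refine norm_integral_le_of_norm_le hi ?_
  refine (ae_restrict_iff' measurableSet_Ioi).2 (Eventually.of_forall fun t ht => ?_)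
  have ht : 0 < t := ht
  rw [norm_mul, norm_mul, norm_cexp_mul_I_sub, mul_comm, Complex.norm_of_nonneg ht.le]
  gcongr
  calc t * ‖hankelDensity t‖ ≤ t ^ (1 : ℝ) * t ^ (-(1 / 2) : ℝ) := by
        rw [rpow_one]; gcongr; exact norm_hankelDensity_le ht
    _ = _ := by rw [← rpow_add ht]; norm_num

/-- `r H₀'(r)` tends to a constant at the origin, with rate. -/
theorem norm_mul_hankel_one_add_one_le {r : ℝ} (hr : 0 < r) :
    ‖r * hankel 1 r + 1‖ ≤ 2 * Real.Gamma (1 / 2) * √r + r := by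
  have hi := integrableOn_rpow_mul_exp (s := -(1 / 2)) (by norm_num) hr
  have hG := integral_rpow_mul_exp (s := 1 / 2) (by norm_num) hr
  have e : (1 / 2 - 1 : ℝ) = -(1 / 2) := by norm_num
  rw [e] at hG
  have hsq : r * (1 / r) ^ (1 / 2 : ℝ) = √r := by
    rw [← sqrt_eq_rpow, sqrt_div zero_le_one, sqrt_one]
    nth_rw 1 [← Real.mul_self_sqrt hr.le]
    have := Real.sqrt_pos.2 hr
    field_simp
  -- Replacing t times the density by 1 isolates exp(ir)/r, which carries the 1/r singularity of h'.
  have hexp : ∫ t in Set.Ioi (0 : ℝ), Complex.exp (r * (Complex.I - t)) =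
      Complex.exp (r * Complex.I) / r := by
    have h1 : ∀ t : ℝ, Complex.exp (r * (Complex.I - t)) =
        Complex.exp (r * Complex.I) * Complex.exp ((-r : ℂ) * t) := by
      intro t; rw [← Complex.exp_add]; congr 1; ring
    simp_rw [h1]
    rw [integral_const_mul, integral_exp_mul_complex_Ioi (by simpa using hr)]
    simp [div_eq_mul_inv]
  have hexpi : IntegrableOn (fun t : ℝ => Complex.exp (r * (Complex.I - t))) (Set.Ioi 0) := by
    have h1 := (integrableOn_exp_mul_complex_Ioi (a := (-r : ℂ)) (by simpa using hr) 0).const_mul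
      (Complex.exp (r * Complex.I))
    refine h1.congr (Eventually.of_forall fun t => ?_)
    simp only
    rw [← Complex.exp_add]; congr 1; ring
  have hd : ‖∫ t in Set.Ioi (0 : ℝ),
      Complex.exp (r * (Complex.I - t)) * (t * hankelDensity t - 1)‖ ≤
      (1 / r) ^ (1 / 2 : ℝ) * Real.Gamma (1 / 2) := by
    rw [← hG]
    refine norm_integral_le_of_norm_le hi ?_
    refine (ae_restrict_iff' measurableSet_Ioi).2 (Eventually.of_forall fun t ht => ?_)
    rw [norm_mul, norm_cexp_mul_I_sub, mul_comm]
    gcongr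
    exact norm_mul_hankelDensity_sub_one_le ht
  have hint : IntegrableOn (fun t : ℝ => Complex.exp (r * (Complex.I - t)) *
      (t * hankelDensity t)) (Set.Ioi 0) := by
    refine ((integrableOn_hankelIntegrand 1 hr).sub
      ((integrableOn_hankelIntegrand 0 hr).const_mul Complex.I)).neg.congr
      (Eventually.of_forall fun t => ?_)
    simp only [Pi.neg_apply, Pi.sub_apply]
    ring
  have hsplit : ∫ t in Set.Ioi (0 : ℝ), Complex.exp (r * (Complex.I - t)) * (t * hankelDensity t)
      = (∫ t in Set.Ioi (0 : ℝ),
      Complex.exp (r * (Complex.I - t)) * (t * hankelDensity t - 1)) +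
      Complex.exp (r * Complex.I) / r := by
    rw [← hexp, ← integral_add _ hexpi]
    · congr 1; ext t; ring
    · refine (hint.sub hexpi).congr (Eventually.of_forall fun t => ?_)
      simp only [Pi.sub_apply]; ring
  have hr' : (r : ℂ) ≠ 0 := by exact_mod_cast hr.ne'
  -- The three errors are O(√r), O(√r) and O(r).
  have hfinal : r * hankel 1 r + 1 = Complex.I * (r * hankel 0 r) -
      r * (∫ t in Set.Ioi (0 : ℝ),
        Complex.exp (r * (Complex.I - t)) * (t * hankelDensity t - 1)) -
      (Complex.exp (r * Complex.I) - 1) := by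
    have h1 := hankel_one_sub hr
    rw [hsplit] at h1
    have h2 : hankel 1 r = Complex.I * hankel 0 r - ((∫ t in Set.Ioi (0 : ℝ),
      Complex.exp (r * (Complex.I - t)) * (t * hankelDensity t - 1)) +
      Complex.exp (r * Complex.I) / r) := by linear_combination h1
    rw [h2]
    field_simp
    ring
  have hexp1 : ‖Complex.exp (r * Complex.I) - 1‖ ≤ r := by
    have := Real.norm_exp_I_mul_ofReal_sub_one_le (x := r)
    rw [mul_comm]
    simpa [abs_of_pos hr] using this
  rw [hfinal]
  refine (norm_sub_le _ _).trans (add_le_add ((norm_sub_le _ _).trans ?_) hexp1)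
  rw [norm_mul, norm_mul, norm_mul, Complex.norm_I, one_mul, Complex.norm_of_nonneg hr.le]
  have h1 := mul_le_mul_of_nonneg_left (norm_hankel_zero_le hr) hr.le
  have h2 := mul_le_mul_of_nonneg_left hd hr.le
  have h3 : r * (Real.Gamma (1 / 2) * (1 / r) ^ (1 / 2 : ℝ)) = Real.Gamma (1 / 2) * √r := by
    rw [← hsq]; ring
  have h4 : r * ((1 / r) ^ (1 / 2 : ℝ) * Real.Gamma (1 / 2)) = Real.Gamma (1 / 2) * √r := by
    rw [← hsq]; ring
  linarith

/-- For r ≤ π/4, sin r ≤ cos r; as the density has |im| ≤ re, rotating it by exp(ir) leaves the real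
part nonnegative. -/
theorem hankel_zero_re_nonneg {r : ℝ} (hr : 0 < r) (hr' : r ≤ π / 4) :
    0 ≤ (hankel 0 r).re := by
  have h := integrableOn_hankelIntegrand 0 hr
  have e : (hankel 0 r).re = ∫ t in Set.Ioi (0 : ℝ), ((Complex.I - t) ^ 0 *
      Complex.exp (r * (Complex.I - t)) * hankelDensity t).re :=
    (integral_re h).symm
  rw [e]
  refine setIntegral_nonneg measurableSet_Ioi fun t ht => ?_
  have ht : 0 < t := ht
  have h1 : (r : ℂ) * (Complex.I - t) = ((-(r * t) : ℝ) : ℂ) + (r : ℝ) * Complex.I := by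
    push_cast; ring
  rw [pow_zero, one_mul, h1, Complex.exp_add, ← Complex.ofReal_exp, mul_assoc,
    Complex.re_ofReal_mul, Complex.mul_re, Complex.exp_ofReal_mul_I_re,
    Complex.exp_ofReal_mul_I_im]
  refine mul_nonneg (Real.exp_pos _).le ?_
  have hs : 0 ≤ sin r := sin_nonneg_of_nonneg_of_le_pi hr.le (by linarith [pi_pos])
  have hsc : sin r ≤ cos r := by
    rw [← cos_pi_div_two_sub]
    apply cos_le_cos_of_nonneg_of_le_pi <;> linarith [pi_pos]
  have hre := hankelDensity_re_nonneg t
  have him := (abs_le.1 (abs_hankelDensity_im_le ht)).2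
  nlinarith [mul_le_mul_of_nonneg_left him hs, mul_le_mul_of_nonneg_right hsc hre]

/-- The singularity at the origin is at most logarithmic. -/
theorem exists_norm_hankel_zero_le_log :
    ∃ C : ℝ, 0 ≤ C ∧ ∀ r : ℝ, 0 < r → r ≤ 1 → ‖hankel 0 r‖ ≤ C + Real.log (1 / r) := by
  set A : ℝ := 2 * Real.Gamma (1 / 2) with hA
  have hA0 : 0 ≤ A := by positivity
  refine ⟨‖hankel 0 1‖ + 2 * A + 1, by positivity, fun r hr hr1 => ?_⟩
  have hpos : ∀ s ∈ Set.uIcc r 1, 0 < s := fun s hs => by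
    rw [Set.uIcc_of_le hr1] at hs; exact hr.trans_le hs.1
  have hc : ContinuousOn (hankel 1) (Set.uIcc r 1) := fun s hs =>
    (continuousAt_hankel 1 (hpos s hs)).continuousWithinAt
  have h1 : ∫ s in r..1, hankel 1 s = hankel 0 1 - hankel 0 r :=
    intervalIntegral.integral_eq_sub_of_hasDerivAt (fun s hs => hasDerivAt_hankel 0 (hpos s hs))
      hc.intervalIntegrable
  -- An explicit primitive of the bound 1/s + A/√s + 1 on |h'|, which comes from
  -- `norm_mul_hankel_one_add_one_le`.
  have hd : ∀ s ∈ Set.uIcc r 1, HasDerivAt (fun s => Real.log s + 2 * A * √s + s)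
      (1 / s + A / √s + 1) s := by
    intro s hs
    have hs0 := hpos s hs
    have := (((Real.hasDerivAt_log hs0.ne').add
      ((Real.hasDerivAt_sqrt hs0.ne').const_mul (2 * A))).add (hasDerivAt_id s))
    refine this.congr_deriv ?_
    have := Real.sqrt_pos.2 hs0
    field_simp
  have hci : ContinuousOn (fun s : ℝ => 1 / s + A / √s + 1) (Set.uIcc r 1) := by
    intro s hs
    have hs0 := hpos s hs
    have := (Real.sqrt_pos.2 hs0).ne'
    apply ContinuousAt.continuousWithinAt
    fun_prop (disch := first | exact hs0.ne' | exact this)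
  have h2 := intervalIntegral.integral_eq_sub_of_hasDerivAt hd hci.intervalIntegrable
  have h3 : ‖∫ s in r..1, hankel 1 s‖ ≤ ∫ s in r..1, (1 / s + A / √s + 1) := by
    refine intervalIntegral.norm_integral_le_of_norm_le hr1 (Eventually.of_forall ?_)
      hci.intervalIntegrable
    intro s hs
    have hs0 : 0 < s := hr.trans hs.1
    have h4 := norm_mul_hankel_one_add_one_le hs0
    have h5 : ‖s * hankel 1 s‖ ≤ 1 + A * √s + s := by
      have := norm_sub_le (s * hankel 1 s + 1) 1
      simp only [add_sub_cancel_right, norm_one] at this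
      linarith
    rw [norm_mul, Complex.norm_of_nonneg hs0.le] at h5
    have h6 : 0 < √s := Real.sqrt_pos.2 hs0
    have h7 : s * (1 / s + A / √s + 1) = 1 + A * √s + s := by
      nth_rw 2 [← Real.mul_self_sqrt hs0.le]
      nth_rw 1 [← Real.mul_self_sqrt hs0.le]
      rw [Real.mul_self_sqrt hs0.le]
      have : s / √s = √s := by rw [div_eq_iff h6.ne', Real.mul_self_sqrt hs0.le]
      have e1 : s * (1 / s) = 1 := by field_simp
      calc s * (1 / s + A / √s + 1) = s * (1 / s) + A * (s / √s) + s := by ring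
        _ = _ := by rw [this, e1]
    rw [← h7] at h5
    exact le_of_mul_le_mul_left h5 hs0
  rw [h1, h2] at h3
  have h4 : ‖hankel 0 r‖ ≤ ‖hankel 0 1‖ + ‖hankel 0 1 - hankel 0 r‖ := by
    have := norm_sub_le (hankel 0 1) (hankel 0 1 - hankel 0 r)
    simpa using this
  simp only [Real.log_one, Real.sqrt_one] at h3
  rw [one_div, Real.log_inv]
  have : 0 ≤ 2 * A * √r := by positivity
  linarith

/-! ### Plane geometry and the stream function -/

theorem plane_eta (x : Plane) : !₂[x 0, x 1] = x := by
  ext i; fin_cases i <;> simp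

theorem plane_eq_smul (a b : ℝ) :
    (!₂[a, b] : Plane) = a • (!₂[1, 0] : Plane) + b • (!₂[0, 1] : Plane) := by
  ext i; fin_cases i <;> simp

theorem plane_norm (a b : ℝ) : ‖(!₂[a, b] : Plane)‖ = √(a ^ 2 + b ^ 2) := by
  simp [EuclideanSpace.norm_eq]

theorem hasDerivAt_plane {f g : ℝ → ℝ} {f' g' t : ℝ} (hf : HasDerivAt f f' t)
    (hg : HasDerivAt g g' t) : HasDerivAt (fun t => (!₂[f t, g t] : Plane)) !₂[f', g'] t := by
  have := (hf.smul_const (!₂[1, 0] : Plane)).add (hg.smul_const (!₂[0, 1] : Plane))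
  rw [← plane_eq_smul] at this
  refine this.congr_of_eventuallyEq (Eventually.of_forall fun s => ?_)
  exact plane_eq_smul _ _

theorem isOpen_upperHalf : IsOpen upperHalf :=
  isOpen_lt continuous_const (by fun_prop)

theorem isClosed_closedUpperHalf : IsClosed closedUpperHalf :=
  isClosed_le continuous_const (by fun_prop)

theorem upperHalf_subset : upperHalf ⊆ closedUpperHalf := fun x hx => (show 0 < x 1 from hx).le

theorem convex_upperHalf : Convex ℝ upperHalf := by
  intro x hx y hy a b ha hb hab
  simp only [upperHalf, Set.mem_ofPred_eq, PiLp.add_apply, PiLp.smul_apply, smul_eq_mul] at *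
  rcases ha.eq_or_lt with h | h
  · have : b = 1 := by linarith
    subst h; subst this; simpa using hy
  · have := mul_pos h hx
    have := mul_nonneg hb hy.le
    linarith

theorem laplacian_plane (f : Plane → ℂ) (x : Plane) :
    Δ f x = fderiv ℝ (fderiv ℝ f) x !₂[1, 0] !₂[1, 0] +
      fderiv ℝ (fderiv ℝ f) x !₂[0, 1] !₂[0, 1] := by
  rw [InnerProductSpace.laplacian_eq_iteratedFDeriv_orthonormalBasis f
    (EuclideanSpace.basisFun (Fin 2) ℝ)]
  have h0 : EuclideanSpace.single (0 : Fin 2) (1 : ℝ) = !₂[1, 0] := by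
    ext i; fin_cases i <;> simp
  have h1 : EuclideanSpace.single (1 : Fin 2) (1 : ℝ) = !₂[0, 1] := by
    ext i; fin_cases i <;> simp
  simp [iteratedFDeriv_two_apply, Fin.sum_univ_two, h0, h1]

/-- The clockwise rotation by a right angle. -/
def rotation : Plane →L[ℝ] Plane :=
  LinearMap.toContinuousLinearMap
    { toFun := fun x => !₂[x 1, -x 0]
      map_add' := fun x y => by ext i; fin_cases i <;> simp; ring
      map_smul' := fun a x => by ext i; fin_cases i <;> simp }

theorem rotation_apply (x : Plane) : rotation x = !₂[x 1, -x 0] := rfl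

/-- The Green vector field `g ∇u - u ∇g`, as a linear form. -/
def greenForm (u g : Plane → ℂ) (x : Plane) : Plane →L[ℝ] ℂ :=
  g x • fderiv ℝ u x - u x • fderiv ℝ g x

theorem greenForm_apply (u g : Plane → ℂ) (x e : Plane) :
    greenForm u g x e = g x * fderiv ℝ u x e - u x * fderiv ℝ g x e := rfl

theorem contDiffAt_fderiv {u : Plane → ℂ} {x : Plane} (hu : ContDiffAt ℝ 2 u x) :
    ContDiffAt ℝ 1 (fderiv ℝ u) x :=
  hu.fderiv_right (m := 1) (by norm_num)

/-- The Green field of two solutions of the Helmholtz equation has a stream function. -/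
theorem exists_streamFunction {u g : Plane → ℂ} {k : ℂ}
    (hu : ∀ x ∈ upperHalf, ContDiffAt ℝ 2 u x) (hg : ∀ x ∈ upperHalf, ContDiffAt ℝ 2 g x)
    (hu' : ∀ x ∈ upperHalf, Δ u x + k * u x = 0) (hg' : ∀ x ∈ upperHalf, Δ g x + k * g x = 0) :
    ∃ Ψ : Plane → ℂ, ∀ x ∈ upperHalf, HasFDerivAt Ψ ((greenForm u g x).comp rotation) x := by
  have hform : ∀ x ∈ upperHalf, HasFDerivAt (greenForm u g)
      (g x • fderiv ℝ (fderiv ℝ u) x + (fderiv ℝ g x).smulRight (fderiv ℝ u x) -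
        (u x • fderiv ℝ (fderiv ℝ g) x + (fderiv ℝ u x).smulRight (fderiv ℝ g x))) x := by
    intro x hx
    have h1 := ((hu x hx).differentiableAt (by norm_num)).hasFDerivAt
    have h2 := ((hg x hx).differentiableAt (by norm_num)).hasFDerivAt
    have h3 := ((contDiffAt_fderiv (hu x hx)).differentiableAt (by norm_num)).hasFDerivAt
    have h4 := ((contDiffAt_fderiv (hg x hx)).differentiableAt (by norm_num)).hasFDerivAt
    exact (h2.smul h3).sub (h1.smul h4)
  have hcomp : ∀ x ∈ upperHalf, HasFDerivAt (fun x => (greenForm u g x).comp rotation)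
      (((ContinuousLinearMap.compL ℝ Plane Plane ℂ).flip rotation).comp
      (g x • fderiv ℝ (fderiv ℝ u) x + (fderiv ℝ g x).smulRight (fderiv ℝ u x) -
        (u x • fderiv ℝ (fderiv ℝ g) x + (fderiv ℝ u x).smulRight (fderiv ℝ g x)))) x := by
    intro x hx
    exact ((ContinuousLinearMap.compL ℝ Plane Plane ℂ).flip rotation).hasFDerivAt.comp x
      (hform x hx)
  refine convex_upperHalf.exists_forall_hasFDerivAt_of_fderiv_symmetric isOpen_upperHalf
    (fun x hx => (hcomp x hx).differentiableAt.differentiableWithinAt) ?_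
  intro x hx v w
  rw [(hcomp x hx).fderiv]
  have e1 := hu' x hx
  have e2 := hg' x hx
  rw [laplacian_plane] at e1 e2
  simp only [ContinuousLinearMap.comp_apply, ContinuousLinearMap.flip_apply,
    ContinuousLinearMap.compL_apply, sub_apply,
    add_apply, smul_apply, smul_eq_mul,
    ContinuousLinearMap.smulRight_apply, rotation_apply]
  have hv := (plane_eta v).symm.trans (plane_eq_smul _ _)
  have hw := (plane_eta w).symm.trans (plane_eq_smul _ _)
  rw [plane_eq_smul (w 1), plane_eq_smul (v 1)]
  set v0 := v 0
  set v1 := v 1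
  set w0 := w 0
  set w1 := w 1
  rw [hv, hw]
  simp only [map_add, map_smul, add_apply, smul_apply,
    Complex.real_smul]
  push_cast
  -- The antisymmetric part of the derivative is the divergence gΔu - uΔg times the determinant of v
  -- and w; the zero-order terms of the two Helmholtz equations cancel.
  linear_combination (v0 * w1 - w0 * v1 : ℂ) * (g x * e1 - u x * e2)

/-- Along a path, Ψ grows by the flux through the clockwise normal. Differences of Ψ are thus fluxes
independent of the path, which takes the place of the divergence theorem. -/
theorem hasDerivAt_stream {u g Ψ : Plane → ℂ}
    (hΨ : ∀ x ∈ upperHalf, HasFDerivAt Ψ ((greenForm u g x).comp rotation) x)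
    {γ : ℝ → Plane} {γ' : Plane} {t : ℝ} (hγ : HasDerivAt γ γ' t) (ht : γ t ∈ upperHalf) :
    HasDerivAt (fun t => Ψ (γ t)) (greenForm u g (γ t) !₂[γ' 1, -γ' 0]) t :=
  (hΨ _ ht).comp_hasDerivAt t hγ

theorem continuousAt_greenForm {u g : Plane → ℂ} {x : Plane} (hu : ContDiffAt ℝ 2 u x)
    (hg : ContDiffAt ℝ 2 g x) : ContinuousAt (greenForm u g) x := by
  have h3 := (contDiffAt_fderiv hu).continuousAt
  have h4 := (contDiffAt_fderiv hg).continuousAt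
  exact (hg.continuousAt.smul h3).sub (hu.continuousAt.smul h4)

/-- Flux of the Green field through a horizontal segment. -/
theorem stream_sub_horizontal {u g Ψ : Plane → ℂ}
    (hu : ∀ x ∈ upperHalf, ContDiffAt ℝ 2 u x) (hg : ∀ x ∈ upperHalf, ContDiffAt ℝ 2 g x)
    (hΨ : ∀ x ∈ upperHalf, HasFDerivAt Ψ ((greenForm u g x).comp rotation) x)
    {η : ℝ} (hη : 0 < η) (s s' : ℝ) :
    Ψ !₂[s', η] - Ψ !₂[s, η] = -∫ t in s..s', greenForm u g !₂[t, η] !₂[0, 1] := by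
  have hmem : ∀ t : ℝ, (!₂[t, η] : Plane) ∈ upperHalf := fun t => by simpa [upperHalf] using hη
  have hd : ∀ t : ℝ, HasDerivAt (fun t => Ψ !₂[t, η])
      (-greenForm u g !₂[t, η] !₂[0, 1]) t := by
    intro t
    have h1 := hasDerivAt_stream hΨ (hasDerivAt_plane (hasDerivAt_id t) (hasDerivAt_const t η))
      (hmem t)
    refine h1.congr_deriv ?_
    rw [← map_neg]
    congr 1
    ext i; fin_cases i <;> simp
  have hc : Continuous (fun t : ℝ => greenForm u g !₂[t, η] !₂[0, 1]) := by
    rw [continuous_iff_continuousAt]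
    intro t
    have h1 : ContinuousAt (fun t : ℝ => greenForm u g !₂[t, η]) t :=
      ContinuousAt.comp (f := fun t : ℝ => (!₂[t, η] : Plane)) (g := greenForm u g)
      (continuousAt_greenForm (hu _ (hmem t)) (hg _ (hmem t))) (by fun_prop)
    exact h1.clm_apply continuousAt_const
  rw [← intervalIntegral.integral_neg]
  exact (intervalIntegral.integral_eq_sub_of_hasDerivAt (fun t _ => hd t)
    (hc.neg.intervalIntegrable _ _)).symm

/-- Flux of the Green field through a circular arc. -/
theorem stream_sub_arc {u g Ψ : Plane → ℂ}
    (hu : ∀ x ∈ upperHalf, ContDiffAt ℝ 2 u x) (hg : ∀ x ∈ upperHalf, ContDiffAt ℝ 2 g x)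
    (hΨ : ∀ x ∈ upperHalf, HasFDerivAt Ψ ((greenForm u g x).comp rotation) x)
    {p η ρ α β : ℝ} (h : ∀ φ ∈ Set.uIcc α β, 0 < η + ρ * sin φ) :
    Ψ !₂[p + ρ * cos β, η + ρ * sin β] - Ψ !₂[p + ρ * cos α, η + ρ * sin α] =
      ∫ φ in α..β, ρ * greenForm u g !₂[p + ρ * cos φ, η + ρ * sin φ] !₂[cos φ, sin φ] := by
  have hmem : ∀ φ ∈ Set.uIcc α β, (!₂[p + ρ * cos φ, η + ρ * sin φ] : Plane) ∈ upperHalf :=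
    fun φ hφ => by simpa [upperHalf] using h φ hφ
  have hd : ∀ φ ∈ Set.uIcc α β, HasDerivAt (fun φ => Ψ !₂[p + ρ * cos φ, η + ρ * sin φ])
      (ρ * greenForm u g !₂[p + ρ * cos φ, η + ρ * sin φ] !₂[cos φ, sin φ]) φ := by
    intro φ hφ
    have h1 := hasDerivAt_stream hΨ (hasDerivAt_plane
      (((hasDerivAt_cos φ).const_mul ρ).const_add p) (((hasDerivAt_sin φ).const_mul ρ).const_add η))
      (hmem φ hφ)
    refine h1.congr_deriv ?_
    rw [← Complex.real_smul, ← map_smul]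
    congr 1
    ext i; fin_cases i <;> simp
  have hc : ContinuousOn (fun φ : ℝ => ρ * greenForm u g !₂[p + ρ * cos φ, η + ρ * sin φ]
      !₂[cos φ, sin φ]) (Set.uIcc α β) := by
    intro φ hφ
    apply ContinuousAt.continuousWithinAt
    have h1 : ContinuousAt (fun φ : ℝ => greenForm u g !₂[p + ρ * cos φ, η + ρ * sin φ]) φ :=
      ContinuousAt.comp (f := fun φ : ℝ => (!₂[p + ρ * cos φ, η + ρ * sin φ] : Plane))
        (g := greenForm u g)
        (continuousAt_greenForm (hu _ (hmem φ hφ)) (hg _ (hmem φ hφ))) (by fun_prop)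
    exact continuousAt_const.mul (h1.clm_apply (by fun_prop))
  exact (intervalIntegral.integral_eq_sub_of_hasDerivAt hd hc.intervalIntegrable).symm

section

/-! ### Green's identity on a half-disc -/

/-- The Neumann datum equal to `c` on the aperture `(0, ε)` and to `0` elsewhere. -/
def apertureData (ε : ℝ) (c : ℂ) (a : ℝ) : ℂ := if 0 < a ∧ a < ε then c else 0

/-- A solution of the Helmholtz equation in the upper half-plane, continuous up to the boundary,
with Neumann datum `c` on the aperture and `0` elsewhere. -/
structure NeumannField (κ ε : ℝ) (c : ℂ) (u : Plane → ℂ) : Prop where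
  contDiffAt : ∀ x ∈ upperHalf, ContDiffAt ℝ 2 u x
  continuousOn : ContinuousOn u closedUpperHalf
  helmholtz : ∀ x ∈ upperHalf, Δ u x + (κ : ℂ) ^ 2 * u x = 0
  neumann : ∀ a : ℝ, a ≠ 0 → a ≠ ε →
    Tendsto (fun x : Plane => fderiv ℝ u x !₂[0, 1]) (𝓝[upperHalf] !₂[a, 0])
      (𝓝 (apertureData ε c a))

/-- A solution of the Helmholtz equation that is smooth up to the boundary. -/
structure TestField (κ : ℝ) (g : Plane → ℂ) : Prop where
  contDiffAt : ∀ x ∈ closedUpperHalf, ContDiffAt ℝ 2 g x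
  helmholtz : ∀ x ∈ upperHalf, Δ g x + (κ : ℂ) ^ 2 * g x = 0

/-- The normal component of the Green field, extended to the boundary. -/
def greenNormal (ε : ℝ) (c : ℂ) (u g : Plane → ℂ) (x : Plane) : ℂ :=
  g x * (if 0 < x 1 then fderiv ℝ u x !₂[0, 1] else apertureData ε c (x 0)) -
    u x * fderiv ℝ g x !₂[0, 1]

theorem apertureData_eventually {ε a : ℝ} (c : ℂ) (h0 : a ≠ 0) (hε : a ≠ ε) :
    ∀ᶠ b in 𝓝 a, apertureData ε c b = apertureData ε c a := by
  rcases lt_or_gt_of_ne h0 with h | h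
  · filter_upwards [gt_mem_nhds h] with b hb
    rw [apertureData, apertureData, if_neg (by rintro ⟨h1, _⟩; linarith),
      if_neg (by rintro ⟨h1, _⟩; linarith)]
  rcases lt_or_gt_of_ne hε with h' | h'
  · filter_upwards [lt_mem_nhds h, gt_mem_nhds h'] with b hb hb'
    rw [apertureData, apertureData, if_pos ⟨hb, hb'⟩, if_pos ⟨h, h'⟩]
  · filter_upwards [lt_mem_nhds h'] with b hb
    rw [apertureData, apertureData, if_neg (by rintro ⟨_, h1⟩; linarith),
      if_neg (by rintro ⟨_, h1⟩; linarith)]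

theorem norm_apertureData_le (ε : ℝ) (c : ℂ) (a : ℝ) : ‖apertureData ε c a‖ ≤ ‖c‖ := by
  unfold apertureData; split_ifs <;> simp

variable {κ ε : ℝ} {c : ℂ} {u g : Plane → ℂ}

theorem TestField.contDiffAt' (hg : TestField κ g) : ∀ x ∈ upperHalf, ContDiffAt ℝ 2 g x :=
  fun x hx => hg.contDiffAt x (upperHalf_subset hx)

theorem TestField.continuousAt_fderiv (hg : TestField κ g) {x : Plane} (hx : x ∈ closedUpperHalf) :
    ContinuousAt (fderiv ℝ g) x :=
  (contDiffAt_fderiv (hg.contDiffAt x hx)).continuousAt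

theorem greenNormal_eq {x : Plane} (hx : 0 < x 1) :
    greenNormal ε c u g x = greenForm u g x !₂[0, 1] := by
  rw [greenNormal, if_pos hx, greenForm_apply]

/-- Off the two ends the datum is locally constant, so the limit of the normal derivative from
inside matches the values glued on along the boundary. -/
theorem continuousOn_greenNormal (hu : NeumannField κ ε c u) (hg : TestField κ g) :
    ContinuousOn (greenNormal ε c u g) {x | 0 ≤ x 1 ∧ x 0 ≠ 0 ∧ x 0 ≠ ε} := by
  set S : Set Plane := {x | 0 ≤ x 1 ∧ x 0 ≠ 0 ∧ x 0 ≠ ε} with hS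
  have hsub : S ⊆ closedUpperHalf := fun x hx => (show 0 ≤ x 1 from hx.1)
  have h1 : ContinuousOn
      (fun x : Plane => if 0 < x 1 then fderiv ℝ u x !₂[0, 1] else apertureData ε c (x 0)) S := by
    intro x hx
    rcases hx.1.eq_or_lt with h | h
    · have hx0 : x = !₂[x 0, 0] := by rw [h]; exact (plane_eta x).symm
      have hval : (if 0 < x 1 then fderiv ℝ u x !₂[0, 1] else apertureData ε c (x 0)) =
          apertureData ε c (x 0) := if_neg (by rw [← h]; exact lt_irrefl _)
      rw [ContinuousWithinAt, hval]
      have hT := hu.neumann (x 0) hx.2.1 hx.2.2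
      rw [← hx0] at hT
      have hc0 : ContinuousAt (fun y : Plane => y 0) x := by fun_prop
      have hev := hc0.eventually (apertureData_eventually c hx.2.1 hx.2.2)
      intro U hU
      have h2 := hT hU
      rw [Filter.mem_map, mem_nhdsWithin_iff_eventually] at h2
      have h3 : ∀ᶠ y in 𝓝 x, y ∈ S →
          (if 0 < y 1 then fderiv ℝ u y !₂[0, 1] else apertureData ε c (y 0)) ∈ U := by
        filter_upwards [h2, hev] with y hy hy' _
        split_ifs with h4
        · exact hy h4
        · rw [hy']; exact mem_of_mem_nhds hU
      exact mem_nhdsWithin_iff_eventually.2 h3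
    · have hxu : x ∈ upperHalf := h
      have h2 : ContinuousAt (fun x : Plane => fderiv ℝ u x !₂[0, 1]) x :=
        (contDiffAt_fderiv (hu.contDiffAt x hxu)).continuousAt.clm_apply continuousAt_const
      refine (h2.congr ?_).continuousWithinAt
      filter_upwards [isOpen_upperHalf.mem_nhds hxu] with y hy
      exact (if_pos hy).symm
  have h2 : ContinuousOn g S := fun x hx => (hg.contDiffAt x (hsub hx)).continuousAt.continuousWithinAt
  have h3 : ContinuousOn (fun x => fderiv ℝ g x !₂[0, 1]) S := fun x hx =>
    ((hg.continuousAt_fderiv (hsub hx)).clm_apply continuousAt_const).continuousWithinAt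
  exact (h2.mul h1).sub ((hu.continuousOn.mono hsub).mul h3)

/-- The normal component clamped to a strip over `[s, s']`. -/
theorem continuous_greenNormal_clamp (hu : NeumannField κ ε c u) (hg : TestField κ g) {s s' : ℝ}
    (h : s ≤ s') (hs : ∀ t ∈ Set.Icc s s', t ≠ 0 ∧ t ≠ ε) :
    Continuous (fun z : ℝ × ℝ => greenNormal ε c u g !₂[max s (min z.2 s'), max z.1 0]) := by
  have h1 := continuousOn_greenNormal hu hg
  refine h1.comp_continuous (f := fun z : ℝ × ℝ => (!₂[max s (min z.2 s'), max z.1 0] : Plane))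
    (by fun_prop) ?_
  intro z
  have h2 := hs (max s (min z.2 s')) ⟨le_max_left _ _, max_le h (min_le_right _ _)⟩
  simpa using h2

/-- The upper limit of integration moves with the height because a chord of the circle of radius R
at height η ends at √(R²-η²). -/
theorem tendsto_integral_greenForm (hu : NeumannField κ ε c u) (hg : TestField κ g) {s s' : ℝ}
    (h : s ≤ s') (hs : ∀ t ∈ Set.Icc s s', t ≠ 0 ∧ t ≠ ε) {a : ℝ} (ha : a ∈ Set.Icc s s')
    {b : ℝ → ℝ} (hb : Continuous b) (hbm : ∀ η, b η ∈ Set.Icc s s') :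
    Tendsto (fun η : ℝ => ∫ t in a..b η, greenForm u g !₂[t, η] !₂[0, 1]) (𝓝[>] 0)
      (𝓝 (∫ t in a..b 0, greenNormal ε c u g !₂[t, 0])) := by
  have h1 := continuous_greenNormal_clamp hu hg h hs
  have h2 : Continuous (fun η : ℝ => ∫ t in a..b η,
      greenNormal ε c u g !₂[max s (min t s'), max η 0]) :=
    intervalIntegral.continuous_parametric_intervalIntegral_of_continuous
      (f := fun η t => greenNormal ε c u g !₂[max s (min t s'), max η 0]) h1 hb
  have hclamp : ∀ η, ∀ t ∈ Set.uIcc a (b η), max s (min t s') = t := by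
    intro η t ht
    have h3 := (Set.uIcc_subset_Icc ha (hbm η)) ht
    rw [min_eq_left h3.2, max_eq_right h3.1]
  have h0 : ∫ t in a..b 0, greenNormal ε c u g !₂[t, 0] =
      ∫ t in a..b 0, greenNormal ε c u g !₂[max s (min t s'), max 0 0] := by
    refine intervalIntegral.integral_congr fun t ht => ?_
    simp only [hclamp 0 t ht, max_self]
  rw [h0]
  refine ((h2.tendsto 0).mono_left nhdsWithin_le_nhds).congr' ?_
  filter_upwards [self_mem_nhdsWithin] with η hη
  have hη : 0 < η := hη
  refine intervalIntegral.integral_congr fun t ht => ?_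
  simp only [hclamp η t ht, max_eq_left hη.le]
  rw [greenNormal_eq (by simpa using hη)]

/-- Near a segment of the boundary away from the ends of the aperture, the normal component
stays close to its boundary values. -/
theorem eventually_norm_greenForm_le (hu : NeumannField κ ε c u) (hg : TestField κ g) {s s' : ℝ}
    (h : s ≤ s') (hs : ∀ t ∈ Set.Icc s s', t ≠ 0 ∧ t ≠ ε) {B : ℝ}
    (hB : ∀ t ∈ Set.Icc s s', ‖greenNormal ε c u g !₂[t, 0]‖ < B) :
    ∀ᶠ η in 𝓝[>] (0 : ℝ), ∀ t ∈ Set.Icc s s', ‖greenForm u g !₂[t, η] !₂[0, 1]‖ < B := by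
  have h1 := continuous_greenNormal_clamp hu hg h hs
  have h2 : ∀ᶠ η in 𝓝 (0 : ℝ), ∀ t ∈ Set.Icc s s',
      ‖greenNormal ε c u g !₂[max s (min t s'), max η 0]‖ < B := by
    refine isCompact_Icc.eventually_forall_of_forall_eventually fun t ht => ?_
    have h3 := h1.norm.continuousAt (x := (0, t))
    apply h3.eventually (p := fun y => y < B)
    apply gt_mem_nhds
    simp only [max_self, min_eq_left ht.2, max_eq_right ht.1]
    exact hB t ht
  filter_upwards [self_mem_nhdsWithin, nhdsWithin_le_nhds h2] with η hη hη2 t ht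
  have hη : 0 < η := hη
  have := hη2 t ht
  rw [min_eq_left ht.2, max_eq_right ht.1, max_eq_left hη.le,
    greenNormal_eq (by simpa using hη)] at this
  exact this

end

/-! ### Flux through small arcs, averaged over the radius -/

section

variable {κ ε : ℝ} {c : ℂ} {u g : Plane → ℂ}

theorem norm_plane_cos_sin (φ : ℝ) : ‖(!₂[cos φ, sin φ] : Plane)‖ = 1 := by
  rw [plane_norm, cos_sq_add_sin_sq, sqrt_one]

theorem norm_polar_sub_le {p η ρ φ : ℝ} (hη : 0 ≤ η) (hρ : 0 ≤ ρ) :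
    ‖(!₂[p + ρ * cos φ, η + ρ * sin φ] : Plane) - !₂[p, 0]‖ ≤ ρ + η := by
  have e : (!₂[p + ρ * cos φ, η + ρ * sin φ] : Plane) - !₂[p, 0] =
      ρ • !₂[cos φ, sin φ] + η • !₂[0, 1] := by
    ext i; fin_cases i <;> simp; ring
  rw [e]
  refine (norm_add_le _ _).trans ?_
  rw [norm_smul, norm_smul, norm_plane_cos_sin, plane_norm]
  simp [abs_of_nonneg hη, abs_of_nonneg hρ]

/-- Integrating by parts in the radius, the flux of the Green field through small arcs is bounded
on average by the oscillation of `u`. -/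
theorem norm_integral_flux_le
    (hu : ∀ x ∈ upperHalf, ContDiffAt ℝ 2 u x) (hg : ∀ x ∈ upperHalf, ContDiffAt ℝ 2 g x)
    {p η ρ₀ C M τ : ℝ} {u₀ : ℂ} (hη : 0 < η) (hρ₀ : 0 < ρ₀) (hηρ : η ≤ ρ₀)
    (hgC : ∀ x ∈ upperHalf, ‖x - !₂[p, 0]‖ ≤ 3 * ρ₀ → ‖g x‖ ≤ C)
    (hgC' : ∀ x ∈ upperHalf, ‖x - !₂[p, 0]‖ ≤ 3 * ρ₀ → ‖fderiv ℝ g x‖ ≤ C)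
    (huM : ∀ x ∈ upperHalf, ‖x - !₂[p, 0]‖ ≤ 3 * ρ₀ → ‖u x‖ ≤ M)
    (huτ : ∀ x ∈ upperHalf, ‖x - !₂[p, 0]‖ ≤ 3 * ρ₀ → ‖u x - u₀‖ ≤ τ) :
    ‖∫ ρ in ρ₀..2 * ρ₀, ∫ φ in (0 : ℝ)..π,
      ρ * greenForm u g !₂[p + ρ * cos φ, η + ρ * sin φ] !₂[cos φ, sin φ]‖ ≤
      π * (ρ₀ * (4 * C * τ + 2 * ρ₀ * C * τ + 2 * ρ₀ * M * C)) := by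
  have hle : ρ₀ ≤ 2 * ρ₀ := by linarith
  have hpt : ∀ ρ ∈ Set.Icc ρ₀ (2 * ρ₀), ∀ φ ∈ Set.Icc 0 π,
      (!₂[p + ρ * cos φ, η + ρ * sin φ] : Plane) ∈ upperHalf ∧
      ‖(!₂[p + ρ * cos φ, η + ρ * sin φ] : Plane) - !₂[p, 0]‖ ≤ 3 * ρ₀ := by
    intro ρ hρ φ hφ
    have hs := sin_nonneg_of_nonneg_of_le_pi hφ.1 hφ.2
    have hρ0 : 0 ≤ ρ := hρ₀.le.trans hρ.1
    refine ⟨?_, (norm_polar_sub_le hη.le hρ0).trans (by linarith [hρ.2])⟩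
    have : 0 < η + ρ * sin φ := by positivity
    simpa [upperHalf] using this
  have hC0 : 0 ≤ C := by
    have := hpt ρ₀ ⟨le_rfl, hle⟩ 0 ⟨le_rfl, pi_pos.le⟩
    exact (norm_nonneg _).trans (hgC _ this.1 this.2)
  have hM0 : 0 ≤ M := by
    have := hpt ρ₀ ⟨le_rfl, hle⟩ 0 ⟨le_rfl, pi_pos.le⟩
    exact (norm_nonneg _).trans (huM _ this.1 this.2)
  have hτ0 : 0 ≤ τ := by
    have := hpt ρ₀ ⟨le_rfl, hle⟩ 0 ⟨le_rfl, pi_pos.le⟩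
    exact (norm_nonneg _).trans (huτ _ this.1 this.2)
  have hcont : ContinuousOn (Function.uncurry fun ρ φ : ℝ =>
      ρ * greenForm u g !₂[p + ρ * cos φ, η + ρ * sin φ] !₂[cos φ, sin φ])
      (Set.Icc ρ₀ (2 * ρ₀) ×ˢ Set.Icc 0 π) := by
    rintro ⟨ρ, φ⟩ ⟨hρ, hφ⟩
    apply ContinuousAt.continuousWithinAt
    have hm := (hpt ρ hρ φ hφ).1
    have h1 : ContinuousAt (fun z : ℝ × ℝ =>
        greenForm u g !₂[p + z.1 * cos z.2, η + z.1 * sin z.2]) (ρ, φ) :=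
      ContinuousAt.comp (f := fun z : ℝ × ℝ =>
        (!₂[p + z.1 * cos z.2, η + z.1 * sin z.2] : Plane)) (g := greenForm u g)
        (continuousAt_greenForm (hu _ hm) (hg _ hm)) (by fun_prop)
    have h2 : ContinuousAt (fun z : ℝ × ℝ => (z.1 : ℂ)) (ρ, φ) := by fun_prop
    exact h2.mul (h1.clm_apply (by fun_prop))
  -- After exchanging the order of integration, each ray can be treated separately.
  rw [intervalIntegral_intervalIntegral_swap]
  swap
  · rw [Set.uIoc_of_le hle, Set.uIoc_of_le pi_pos.le]
    refine (hcont.integrableOn_compact (isCompact_Icc.prod isCompact_Icc)).mono_set ?_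
    exact Set.prod_mono Set.Ioc_subset_Icc_self Set.Ioc_subset_Icc_self
  have key : ∀ φ ∈ Set.uIoc 0 π, ‖∫ ρ in ρ₀..2 * ρ₀,
      ρ * greenForm u g !₂[p + ρ * cos φ, η + ρ * sin φ] !₂[cos φ, sin φ]‖ ≤
      ρ₀ * (4 * C * τ + 2 * ρ₀ * C * τ + 2 * ρ₀ * M * C) := by
    intro φ hφ
    rw [Set.uIoc_of_le pi_pos.le] at hφ
    have hφ : φ ∈ Set.Icc 0 π := Set.Ioc_subset_Icc_self hφ
    set e : Plane := !₂[cos φ, sin φ] with he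
    have hen : ‖e‖ = 1 := norm_plane_cos_sin φ
    set γ : ℝ → Plane := fun ρ => !₂[p + ρ * cos φ, η + ρ * sin φ] with hγ
    have hγd : ∀ ρ, HasDerivAt γ e ρ := by
      intro ρ
      have h1 : HasDerivAt (fun ρ => p + ρ * cos φ) (cos φ) ρ := by
        simpa using ((hasDerivAt_id ρ).mul_const (cos φ)).const_add p
      have h2 : HasDerivAt (fun ρ => η + ρ * sin φ) (sin φ) ρ := by
        simpa using ((hasDerivAt_id ρ).mul_const (sin φ)).const_add η
      exact hasDerivAt_plane h1 h2
    have hγc : Continuous γ := continuous_iff_continuousAt.2 fun ρ => (hγd ρ).continuousAt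
    -- The radial derivative of ρ g (u - u₀) contains the flux density; the remaining terms,
    -- collected in `rest`, involve no derivative of u.
    set y : ℝ → ℂ := fun ρ => ρ * (g (γ ρ) * (u (γ ρ) - u₀)) with hy
    set rest : ℝ → ℂ := fun ρ => g (γ ρ) * (u (γ ρ) - u₀) +
      ρ * (fderiv ℝ g (γ ρ) e * (u (γ ρ) - u₀)) + ρ * (u (γ ρ) * fderiv ℝ g (γ ρ) e) with hrest
    have hIcc : ∀ ρ ∈ Set.uIcc ρ₀ (2 * ρ₀), ρ ∈ Set.Icc ρ₀ (2 * ρ₀) := fun ρ hρ => by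
      rwa [Set.uIcc_of_le hle] at hρ
    have hyd : ∀ ρ ∈ Set.uIcc ρ₀ (2 * ρ₀),
        HasDerivAt y (ρ * greenForm u g (γ ρ) e + rest ρ) ρ := by
      intro ρ hρ
      have hm := (hpt ρ (hIcc ρ hρ) φ hφ).1
      have h1 := ((hu _ hm).differentiableAt (by norm_num)).hasFDerivAt.comp_hasDerivAt ρ (hγd ρ)
      have h2 := ((hg _ hm).differentiableAt (by norm_num)).hasFDerivAt.comp_hasDerivAt ρ (hγd ρ)
      have h3 := (Complex.ofRealCLM.hasDerivAt (x := ρ)).mul (h2.mul (h1.sub_const u₀))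
      refine h3.congr_deriv ?_
      simp only [hrest, greenForm_apply, Complex.ofRealCLM_apply, Function.comp_apply,
        Complex.ofReal_one, Pi.mul_apply, he, hγ]
      ring
    have hrc : ContinuousOn rest (Set.uIcc ρ₀ (2 * ρ₀)) := by
      intro ρ hρ
      apply ContinuousAt.continuousWithinAt
      have hm := (hpt ρ (hIcc ρ hρ) φ hφ).1
      have h1 : ContinuousAt (fun ρ => u (γ ρ)) ρ :=
        ContinuousAt.comp (f := γ) (hu _ hm).continuousAt hγc.continuousAt
      have h2 : ContinuousAt (fun ρ => g (γ ρ)) ρ :=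
        ContinuousAt.comp (f := γ) (hg _ hm).continuousAt hγc.continuousAt
      have h3 : ContinuousAt (fun ρ => fderiv ℝ g (γ ρ) e) ρ :=
        (ContinuousAt.comp (f := γ) (g := fderiv ℝ g) (contDiffAt_fderiv (hg _ hm)).continuousAt
          hγc.continuousAt).clm_apply continuousAt_const
      have h4 : ContinuousAt (fun ρ : ℝ => (ρ : ℂ)) ρ := by fun_prop
      exact ((h2.mul (h1.sub continuousAt_const)).add
        (h4.mul (h3.mul (h1.sub continuousAt_const)))).add (h4.mul (h1.mul h3))
    have hfc : ContinuousOn (fun ρ : ℝ => ρ * greenForm u g (γ ρ) e) (Set.uIcc ρ₀ (2 * ρ₀)) := by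
      rw [Set.uIcc_of_le hle]
      exact ContinuousOn.comp (f := fun ρ : ℝ => (ρ, φ)) hcont (by fun_prop)
        fun ρ hρ => ⟨hρ, hφ⟩
    have hFTC := intervalIntegral.integral_eq_sub_of_hasDerivAt hyd
      (hfc.add hrc).intervalIntegrable
    rw [intervalIntegral.integral_add hfc.intervalIntegrable hrc.intervalIntegrable] at hFTC
    have hyb : ∀ ρ ∈ Set.Icc ρ₀ (2 * ρ₀), ‖y ρ‖ ≤ ρ * (C * τ) := by
      intro ρ hρ
      have hm := hpt ρ hρ φ hφ
      rw [hy]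
      simp only [norm_mul, Complex.norm_real, Real.norm_eq_abs]
      rw [abs_of_nonneg (hρ₀.le.trans hρ.1)]
      have := hρ₀.le.trans hρ.1
      gcongr
      · exact hgC _ hm.1 hm.2
      · exact huτ _ hm.1 hm.2
    have hrb : ‖∫ ρ in ρ₀..2 * ρ₀, rest ρ‖ ≤
        (C * τ + 2 * ρ₀ * (C * τ) + 2 * ρ₀ * (M * C)) * |2 * ρ₀ - ρ₀| := by
      refine intervalIntegral.norm_integral_le_of_norm_le_const fun ρ hρ => ?_
      rw [Set.uIoc_of_le hle] at hρ
      have hρ := Set.Ioc_subset_Icc_self hρ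
      have hm := hpt ρ hρ φ hφ
      have hρ0 := hρ₀.le.trans hρ.1
      have h1 := hgC _ hm.1 hm.2
      have h2 := huτ _ hm.1 hm.2
      have h3 := huM _ hm.1 hm.2
      have h4 : ‖fderiv ℝ g (γ ρ) e‖ ≤ C :=
        ((fderiv ℝ g (γ ρ)).le_opNorm e).trans (by rw [hen, mul_one]; exact hgC' _ hm.1 hm.2)
      refine (norm_add₃_le).trans ?_
      simp only [norm_mul, Complex.norm_real, Real.norm_eq_abs, abs_of_nonneg hρ0]
      have h5 := hρ.2
      gcongr
    have e1 : ∫ ρ in ρ₀..2 * ρ₀, ρ * greenForm u g (γ ρ) e =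
        y (2 * ρ₀) - y ρ₀ - ∫ ρ in ρ₀..2 * ρ₀, rest ρ := by
      rw [← hFTC]; ring
    rw [e1]
    have h6 := hyb (2 * ρ₀) ⟨hle, le_rfl⟩
    have h7 := hyb ρ₀ ⟨le_rfl, hle⟩
    refine (norm_sub_le _ _).trans ((add_le_add (norm_sub_le _ _) hrb).trans ?_)
    rw [abs_of_nonneg (by linarith)]
    nlinarith
  have := intervalIntegral.norm_integral_le_of_norm_le_const key
  rw [sub_zero, abs_of_pos pi_pos] at this
  linarith

end

/-! ### Vanishing flux at the ends of the aperture -/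

section

variable {κ ε : ℝ} {c : ℂ} {u g Ψ : Plane → ℂ}

theorem isCompact_halfBall (z : Plane) (r : ℝ) :
    IsCompact (Metric.closedBall z r ∩ closedUpperHalf) :=
  (isCompact_closedBall z r).inter_right isClosed_closedUpperHalf

theorem NeumannField.exists_bound (hu : NeumannField κ ε c u) (z : Plane) (r : ℝ) :
    ∃ M : ℝ, 0 ≤ M ∧ ∀ x ∈ closedUpperHalf, ‖x - z‖ ≤ r → ‖u x‖ ≤ M := by
  obtain ⟨M, hM⟩ := (isCompact_halfBall z r).exists_bound_of_continuousOn
    (hu.continuousOn.mono Set.inter_subset_right)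
  exact ⟨|M|, abs_nonneg _, fun x hx hxr =>
    (hM x ⟨by rwa [Metric.mem_closedBall, dist_eq_norm], hx⟩).trans (le_abs_self M)⟩

theorem TestField.exists_bound (hg : TestField κ g) (z : Plane) (r : ℝ) :
    ∃ C : ℝ, 0 ≤ C ∧ ∀ x ∈ closedUpperHalf, ‖x - z‖ ≤ r → ‖g x‖ ≤ C ∧ ‖fderiv ℝ g x‖ ≤ C := by
  obtain ⟨A, hA⟩ := (isCompact_halfBall z r).exists_bound_of_continuousOn (f := g)
    fun x hx => (hg.contDiffAt x hx.2).continuousAt.continuousWithinAt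
  obtain ⟨B, hB⟩ := (isCompact_halfBall z r).exists_bound_of_continuousOn (f := fderiv ℝ g)
    fun x hx => (hg.continuousAt_fderiv hx.2).continuousWithinAt
  refine ⟨max |A| |B|, le_max_of_le_left (abs_nonneg _), fun x hx hxr => ?_⟩
  have hx' : x ∈ Metric.closedBall z r ∩ closedUpperHalf :=
    ⟨by rwa [Metric.mem_closedBall, dist_eq_norm], hx⟩
  exact ⟨(hA x hx').trans ((le_abs_self A).trans (le_max_left _ _)),
    (hB x hx').trans ((le_abs_self B).trans (le_max_right _ _))⟩

theorem norm_greenNormal_boundary_le {C M : ℝ} {t : ℝ} (hC : 0 ≤ C) (hg1 : ‖g !₂[t, 0]‖ ≤ C)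
    (hg2 : ‖fderiv ℝ g !₂[t, 0]‖ ≤ C) (hu1 : ‖u !₂[t, 0]‖ ≤ M) :
    ‖greenNormal ε c u g !₂[t, 0]‖ ≤ C * ‖c‖ + M * C := by
  have h1 : ‖fderiv ℝ g !₂[t, 0] !₂[0, 1]‖ ≤ C := by
    refine ((fderiv ℝ g !₂[t, 0]).le_opNorm _).trans ?_
    rw [plane_norm]
    simpa using hg2
  have h2 := norm_apertureData_le ε c t
  have hM : 0 ≤ M := (norm_nonneg _).trans hu1
  rw [greenNormal, if_neg (by simp)]
  refine (norm_sub_le _ _).trans ?_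
  rw [norm_mul, norm_mul]
  gcongr
  simpa using h2

/-- The flux of the Green field across the ends of the aperture vanishes in the limit. -/
theorem eventually_norm_stream_sub_le (hu : NeumannField κ ε c u) (hg : TestField κ g)
    (hΨ : ∀ x ∈ upperHalf, HasFDerivAt Ψ ((greenForm u g x).comp rotation) x)
    (hε : 0 < ε) {p : ℝ} (hp : p = 0 ∨ p = ε) {δ : ℝ} (hδ : 0 < δ) :
    ∀ᶠ ρ in 𝓝[>] (0 : ℝ), ∀ᶠ η in 𝓝[>] (0 : ℝ),
      ‖Ψ !₂[p + ρ, η] - Ψ !₂[p - ρ, η]‖ ≤ δ := by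
  obtain ⟨M, hM0, hM⟩ := hu.exists_bound !₂[p, 0] 1
  obtain ⟨C, hC0, hC⟩ := hg.exists_bound !₂[p, 0] 1
  set B : ℝ := C * ‖c‖ + M * C + 1 with hB
  have hB0 : 0 < B := by positivity
  -- The tolerance δ is split in two: `τ` makes the oscillation terms 6πCτ at most δ/2, and `ρ₂`
  -- below does the same for the terms proportional to the radius.
  set τ : ℝ := δ / (2 * (6 * π * C + 1)) with hτ
  have hτ0 : 0 < τ := by have := pi_pos; positivity
  have hp0 : (!₂[p, 0] : Plane) ∈ closedUpperHalf := by simp [closedUpperHalf]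
  obtain ⟨ρ₁, hρ₁, hosc⟩ := Metric.continuousWithinAt_iff.1 (hu.continuousOn _ hp0) τ hτ0
  set ρ₂ : ℝ := δ / (2 * (2 * π * M * C + 2 * B + 1)) with hρ₂
  have hρ₂0 : 0 < ρ₂ := by have := pi_pos; positivity
  -- All points used lie within 3ρ₀ of the end: 1/3 keeps them in the unit half-disc, ρ₁/3 where u
  -- oscillates by less than τ, and ε/3 keeps the segments at distances between ρ₀ and 2ρ₀ off the
  -- other end.
  have hsmall : ∀ᶠ ρ in 𝓝[>] (0 : ℝ), ρ < min (min (1 / 3) (ε / 3)) (min (ρ₁ / 3) ρ₂) :=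
    nhdsWithin_le_nhds (gt_mem_nhds (by positivity))
  filter_upwards [self_mem_nhdsWithin, hsmall] with ρ₀ hρ₀ hs
  have hρ₀ : 0 < ρ₀ := hρ₀
  simp only [lt_min_iff] at hs
  obtain ⟨⟨hs1, hs2⟩, hs3, hs4⟩ := hs
  have hbd : ∀ t : ℝ, |t - p| ≤ 1 → ‖greenNormal ε c u g !₂[t, 0]‖ < B := by
    intro t ht
    have hmem : (!₂[t, 0] : Plane) ∈ closedUpperHalf := by simp [closedUpperHalf]
    have hd : ‖(!₂[t, 0] : Plane) - !₂[p, 0]‖ ≤ 1 := by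
      have : (!₂[t, 0] : Plane) - !₂[p, 0] = !₂[t - p, 0] := by
        ext i; fin_cases i <;> simp
      rw [this, plane_norm]
      simpa [Real.sqrt_sq_eq_abs] using ht
    have := norm_greenNormal_boundary_le (ε := ε) (c := c) hC0 (hC _ hmem hd).1 (hC _ hmem hd).2
      (hM _ hmem hd)
    linarith
  have hR := eventually_norm_greenForm_le hu hg (s := p + ρ₀) (s' := p + 2 * ρ₀) (B := B)
    (by linarith)
    (fun t ht => by rcases hp with rfl | rfl <;> constructor <;> intro h <;> linarith [ht.1, ht.2])
    (fun t ht => hbd t (abs_le.2 ⟨by linarith [ht.1], by linarith [ht.2]⟩))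
  have hL := eventually_norm_greenForm_le hu hg (s := p - 2 * ρ₀) (s' := p - ρ₀) (B := B)
    (by linarith)
    (fun t ht => by rcases hp with rfl | rfl <;> constructor <;> intro h <;> linarith [ht.1, ht.2])
    (fun t ht => hbd t (abs_le.2 ⟨by linarith [ht.1], by linarith [ht.2]⟩))
  have hηs : ∀ᶠ η in 𝓝[>] (0 : ℝ), η < ρ₀ := nhdsWithin_le_nhds (gt_mem_nhds hρ₀)
  filter_upwards [self_mem_nhdsWithin, hR, hL, hηs] with η hη hRη hLη hηρ
  have hη : 0 < η := hη
  have hle : ρ₀ ≤ 2 * ρ₀ := by linarith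
  set L : ℝ → ℂ := fun ρ => Ψ !₂[p + ρ, η] - Ψ !₂[p - ρ, η] with hLdef
  -- The upper half-circle runs from p + ρ to p - ρ, hence the sign.
  have hLarc : ∀ ρ ∈ Set.uIcc ρ₀ (2 * ρ₀), L ρ = -∫ φ in (0 : ℝ)..π,
      ρ * greenForm u g !₂[p + ρ * cos φ, η + ρ * sin φ] !₂[cos φ, sin φ] := by
    intro ρ hρ
    rw [Set.uIcc_of_le hle] at hρ
    have h1 := stream_sub_arc hu.contDiffAt hg.contDiffAt' hΨ (p := p) (η := η) (ρ := ρ) (α := 0)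
      (β := π) (fun φ hφ => by
        rw [Set.uIcc_of_le pi_pos.le] at hφ
        have := mul_nonneg (hρ₀.le.trans hρ.1) (sin_nonneg_of_nonneg_of_le_pi hφ.1 hφ.2)
        linarith)
    rw [← h1, hLdef]
    simp [sub_eq_add_neg, add_comm]
  have hint : ‖∫ ρ in ρ₀..2 * ρ₀, L ρ‖ ≤
      π * (ρ₀ * (4 * C * τ + 2 * ρ₀ * C * τ + 2 * ρ₀ * M * C)) := by
    rw [intervalIntegral.integral_congr hLarc, intervalIntegral.integral_neg, norm_neg]
    refine norm_integral_flux_le (u₀ := u !₂[p, 0]) hu.contDiffAt hg.contDiffAt' hη hρ₀ hηρ.le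
      (fun x hx hxr => (hC x (upperHalf_subset hx) (hxr.trans (by linarith))).1)
      (fun x hx hxr => (hC x (upperHalf_subset hx) (hxr.trans (by linarith))).2)
      (fun x hx hxr => (hM x (upperHalf_subset hx) (hxr.trans (by linarith))))
      (fun x hx hxr => ?_)
    have := hosc (upperHalf_subset hx) (by rw [dist_eq_norm]; linarith)
    rw [dist_eq_norm] at this
    exact this.le
  -- Changing the radius adds only fluxes through two horizontal segments away from the ends, where
  -- the normal component is below B. So the average over radii controls the value at ρ₀.
  have hLdiff : ∀ ρ ∈ Set.uIoc ρ₀ (2 * ρ₀), ‖L ρ - L ρ₀‖ ≤ 2 * B * ρ₀ := by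
    intro ρ hρ
    rw [Set.uIoc_of_le hle] at hρ
    have e : L ρ - L ρ₀ = (Ψ !₂[p + ρ, η] - Ψ !₂[p + ρ₀, η]) +
      (Ψ !₂[p - ρ₀, η] - Ψ !₂[p - ρ, η]) := by simp only [hLdef]; ring
    rw [e, stream_sub_horizontal hu.contDiffAt hg.contDiffAt' hΨ hη,
      stream_sub_horizontal hu.contDiffAt hg.contDiffAt' hΨ hη]
    refine (norm_add_le _ _).trans ?_
    rw [norm_neg, norm_neg]
    have h1 : ‖∫ t in (p + ρ₀)..(p + ρ), greenForm u g !₂[t, η] !₂[0, 1]‖ ≤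
        B * |p + ρ - (p + ρ₀)| := by
      refine intervalIntegral.norm_integral_le_of_norm_le_const fun t ht => ?_
      rw [Set.uIoc_of_le (by linarith [hρ.1])] at ht
      exact (hRη t ⟨ht.1.le, by linarith [ht.2, hρ.2]⟩).le
    have h2 : ‖∫ t in (p - ρ)..(p - ρ₀), greenForm u g !₂[t, η] !₂[0, 1]‖ ≤
        B * |p - ρ₀ - (p - ρ)| := by
      refine intervalIntegral.norm_integral_le_of_norm_le_const fun t ht => ?_
      rw [Set.uIoc_of_le (by linarith [hρ.1])] at ht
      exact (hLη t ⟨by linarith [ht.1, hρ.2], ht.2⟩).le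
    rw [abs_of_nonneg (by linarith [hρ.1])] at h1 h2
    have h3 : B * ρ ≤ B * (2 * ρ₀) := mul_le_mul_of_nonneg_left hρ.2 hB0.le
    linarith
  have hLc : Continuous L := by
    have hmem : ∀ t : ℝ, (!₂[t, η] : Plane) ∈ upperHalf := fun t => by simpa [upperHalf] using hη
    have h1 : Continuous fun t : ℝ => Ψ !₂[t, η] := by
      rw [continuous_iff_continuousAt]
      intro t
      exact ContinuousAt.comp (f := fun t : ℝ => (!₂[t, η] : Plane)) (g := Ψ)
        (hΨ _ (hmem t)).continuousAt (by fun_prop)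
    exact (h1.comp (continuous_const.add continuous_id)).sub
      (h1.comp (continuous_const.sub continuous_id))
  have hfin : (ρ₀ : ℂ) * L ρ₀ = (∫ ρ in ρ₀..2 * ρ₀, L ρ) - ∫ ρ in ρ₀..2 * ρ₀, (L ρ - L ρ₀) := by
    rw [intervalIntegral.integral_sub (hLc.intervalIntegrable _ _) intervalIntegrable_const]
    simp only [intervalIntegral.integral_const, Complex.real_smul]
    push_cast; ring
  have h1 := intervalIntegral.norm_integral_le_of_norm_le_const hLdiff
  have e1 : |2 * ρ₀ - ρ₀| = ρ₀ := by rw [abs_of_nonneg (by linarith)]; ring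
  rw [e1] at h1
  have h2 : ρ₀ * ‖L ρ₀‖ ≤ π * (ρ₀ * (4 * C * τ + 2 * ρ₀ * C * τ + 2 * ρ₀ * M * C)) +
      2 * B * ρ₀ * ρ₀ := by
    have := congrArg norm hfin
    rw [norm_mul, Complex.norm_of_nonneg hρ₀.le] at this
    rw [this]
    exact (norm_sub_le _ _).trans (add_le_add hint h1)
  have h3 : ‖L ρ₀‖ ≤ π * (4 * C * τ + 2 * ρ₀ * C * τ + 2 * ρ₀ * M * C) + 2 * B * ρ₀ := by
    refine le_of_mul_le_mul_left ?_ hρ₀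
    linarith
  have h4 : 2 * ρ₀ * C * τ ≤ 2 * 1 * C * τ := by
    gcongr; linarith
  have h5 : (6 * π * C + 1) * τ = δ / 2 := by
    rw [hτ]; have := pi_pos; field_simp
  have h6 : ρ₀ * (2 * π * M * C + 2 * B + 1) ≤ δ / 2 := by
    have e : ρ₂ * (2 * π * M * C + 2 * B + 1) = δ / 2 := by
      rw [hρ₂]; have := pi_pos; field_simp
    rw [← e]
    have := pi_pos
    gcongr
  have h7 := mul_le_mul_of_nonneg_left h4 pi_pos.le
  change ‖L ρ₀‖ ≤ δ
  nlinarith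

end

/-! ### Passing to the boundary in Green's identity -/

section

variable {κ ε : ℝ} {c : ℂ} {u g Ψ : Plane → ℂ}

theorem intervalIntegrable_apertureData (ε : ℝ) (c : ℂ) (a b : ℝ) :
    IntervalIntegrable (apertureData ε c) volume a b := by
  have e : apertureData ε c = Set.indicator (Set.Ioo 0 ε) fun _ => c := by
    ext t
    simp [apertureData, Set.indicator_apply]
  rw [e]
  have h : Integrable (Set.indicator (Set.Ioo 0 ε) fun _ : ℝ => c) volume := by
    rw [integrable_indicator_iff measurableSet_Ioo]
    exact integrableOn_const (by simp)
  exact h.intervalIntegrable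

theorem continuous_trace (hu : NeumannField κ ε c u) : Continuous fun t : ℝ => u !₂[t, 0] :=
  hu.continuousOn.comp_continuous (f := fun t : ℝ => (!₂[t, 0] : Plane)) (by fun_prop)
    fun t => by simp [closedUpperHalf]

theorem TestField.continuous_trace (hg : TestField κ g) : Continuous fun t : ℝ => g !₂[t, 0] := by
  rw [continuous_iff_continuousAt]
  intro t
  exact ContinuousAt.comp (f := fun t : ℝ => (!₂[t, 0] : Plane)) (g := g)
    (hg.contDiffAt _ (by simp [closedUpperHalf])).continuousAt (by fun_prop)

theorem TestField.continuous_trace_fderiv (hg : TestField κ g) :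
    Continuous fun t : ℝ => fderiv ℝ g !₂[t, 0] !₂[0, 1] := by
  rw [continuous_iff_continuousAt]
  intro t
  exact (ContinuousAt.comp (f := fun t : ℝ => (!₂[t, 0] : Plane)) (g := fderiv ℝ g)
    (hg.continuousAt_fderiv (by simp [closedUpperHalf])) (by fun_prop)).clm_apply
    continuousAt_const

theorem greenNormal_boundary (t : ℝ) : greenNormal ε c u g !₂[t, 0] =
    g !₂[t, 0] * apertureData ε c t - u !₂[t, 0] * fderiv ℝ g !₂[t, 0] !₂[0, 1] := by
  rw [greenNormal, if_neg (by simp)]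
  simp

theorem intervalIntegrable_greenNormal (hu : NeumannField κ ε c u) (hg : TestField κ g) (a b : ℝ) :
    IntervalIntegrable (fun t => greenNormal ε c u g !₂[t, 0]) volume a b := by
  simp_rw [greenNormal_boundary]
  exact ((intervalIntegrable_apertureData ε c a b).continuousOn_mul
    hg.continuous_trace.continuousOn).sub
    (((continuous_trace hu).mul hg.continuous_trace_fderiv).intervalIntegrable a b)

theorem norm_plane_polar {R : ℝ} (hR : 0 ≤ R) (φ : ℝ) :
    ‖(!₂[R * cos φ, R * sin φ] : Plane)‖ = R := by
  have e : (!₂[R * cos φ, R * sin φ] : Plane) = R • !₂[cos φ, sin φ] := by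
    ext i; fin_cases i <;> simp
  rw [e, norm_smul, norm_plane_cos_sin, mul_one, Real.norm_of_nonneg hR]

/-- At the feet of the arc the full gradient of u need not have a limit; the bound on the radial
derivative, later supplied by the radiation condition, gives integrability. -/
theorem intervalIntegrable_arc (hu : NeumannField κ ε c u) (hg : TestField κ g) {R : ℝ}
    (hR : 0 < R) {B : ℝ}
    (hB : ∀ φ ∈ Set.Ioo 0 π, ‖fderiv ℝ u !₂[R * cos φ, R * sin φ] !₂[cos φ, sin φ]‖ ≤ B) :
    IntervalIntegrable (fun φ : ℝ => R * greenForm u g !₂[R * cos φ, R * sin φ]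
      !₂[cos φ, sin φ]) volume 0 π := by
  obtain ⟨M, hM0, hM⟩ := hu.exists_bound 0 R
  obtain ⟨C, hC0, hC⟩ := hg.exists_bound 0 R
  have hmem : ∀ φ ∈ Set.Ioo 0 π, (!₂[R * cos φ, R * sin φ] : Plane) ∈ upperHalf := by
    intro φ hφ
    have := mul_pos hR (sin_pos_of_pos_of_lt_pi hφ.1 hφ.2)
    simpa [upperHalf] using this
  have hc : ContinuousOn (fun φ : ℝ => R * greenForm u g !₂[R * cos φ, R * sin φ]
      !₂[cos φ, sin φ]) (Set.Ioo 0 π) := by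
    intro φ hφ
    apply ContinuousAt.continuousWithinAt
    have h1 : ContinuousAt (fun φ : ℝ => greenForm u g !₂[R * cos φ, R * sin φ]) φ :=
      ContinuousAt.comp (f := fun φ : ℝ => (!₂[R * cos φ, R * sin φ] : Plane))
        (g := greenForm u g)
        (continuousAt_greenForm (hu.contDiffAt _ (hmem φ hφ)) (hg.contDiffAt' _ (hmem φ hφ)))
        (by fun_prop)
    exact continuousAt_const.mul (h1.clm_apply (by fun_prop))
  rw [intervalIntegrable_iff_integrableOn_Ioo_of_le pi_pos.le]
  refine Integrable.of_bound (hc.aestronglyMeasurable measurableSet_Ioo)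
    (R * (C * B + M * C)) ?_
  refine (ae_restrict_iff' measurableSet_Ioo).2 (Eventually.of_forall fun φ hφ => ?_)
  have hn : ‖(!₂[R * cos φ, R * sin φ] : Plane) - 0‖ ≤ R := by
    rw [sub_zero, norm_plane_polar hR.le]
  have hm := upperHalf_subset (hmem φ hφ)
  have h1 : ‖fderiv ℝ g !₂[R * cos φ, R * sin φ] !₂[cos φ, sin φ]‖ ≤ C :=
    ((fderiv ℝ g _).le_opNorm _).trans (by
      rw [norm_plane_cos_sin, mul_one]; exact (hC _ hm hn).2)
  rw [norm_mul, Complex.norm_of_nonneg hR.le, greenForm_apply]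
  refine mul_le_mul_of_nonneg_left ((norm_sub_le _ _).trans ?_) hR.le
  rw [norm_mul, norm_mul]
  have h2 := (hC _ hm hn).1
  have h3 := hM _ hm hn
  have h4 := hB φ hφ
  gcongr

/-- Green's second identity on the half-disc of radius `R`. -/
theorem green_halfDisc (hu : NeumannField κ ε c u) (hg : TestField κ g) (hε : 0 < ε) {R : ℝ}
    (hR : ε < R) {B : ℝ}
    (hB : ∀ φ ∈ Set.Ioo 0 π, ‖fderiv ℝ u !₂[R * cos φ, R * sin φ] !₂[cos φ, sin φ]‖ ≤ B) :
    ∫ φ in (0 : ℝ)..π, R * greenForm u g !₂[R * cos φ, R * sin φ] !₂[cos φ, sin φ] =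
      ∫ t in -R..R, greenNormal ε c u g !₂[t, 0] := by
  have hR0 : 0 < R := hε.trans hR
  obtain ⟨Ψ, hΨ⟩ := exists_streamFunction hu.contDiffAt hg.contDiffAt' hu.helmholtz hg.helmholtz
  have hI := intervalIntegrable_arc hu hg hR0 hB
  set F : ℝ → ℂ := fun φ => R * greenForm u g !₂[R * cos φ, R * sin φ] !₂[cos φ, sin φ] with hF
  set N : ℝ → ℂ := fun t => greenNormal ε c u g !₂[t, 0] with hN
  have hNi : ∀ a b, IntervalIntegrable N volume a b := intervalIntegrable_greenNormal hu hg
  obtain ⟨M, hM0, hM⟩ := hu.exists_bound 0 (2 * R)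
  obtain ⟨C, hC0, hC⟩ := hg.exists_bound 0 (2 * R)
  have hNb : ∀ t : ℝ, |t| ≤ 2 * R → ‖N t‖ ≤ C * ‖c‖ + M * C := by
    intro t ht
    have hmem : (!₂[t, 0] : Plane) ∈ closedUpperHalf := by simp [closedUpperHalf]
    have hn : ‖(!₂[t, 0] : Plane) - 0‖ ≤ 2 * R := by
      rw [sub_zero, plane_norm]
      simpa [Real.sqrt_sq_eq_abs] using ht
    exact norm_greenNormal_boundary_le hC0 (hC _ hmem hn).1 (hC _ hmem hn).2 (hM _ hmem hn)
  set K : ℝ := C * ‖c‖ + M * C with hK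
  have hK0 : 0 ≤ K := by positivity
  have hsin : Tendsto (fun α : ℝ => R * sin α) (𝓝[>] 0) (𝓝[>] 0) := by
    refine tendsto_nhdsWithin_iff.2 ⟨?_, ?_⟩
    · have : Continuous fun α : ℝ => R * sin α := by fun_prop
      have h := this.tendsto 0
      simp only [sin_zero, mul_zero] at h
      exact h.mono_left nhdsWithin_le_nhds
    · filter_upwards [self_mem_nhdsWithin, nhdsWithin_le_nhds (gt_mem_nhds pi_pos)] with α h1 h2
      exact mul_pos hR0 (sin_pos_of_pos_of_lt_pi h1 h2)
  -- The contour is cut at height R sin α, so the arc loses the angles below α and above π - α; both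
  -- pieces vanish as α tends to 0.
  have hA : Tendsto (fun α : ℝ => ∫ φ in α..π - α, F φ) (𝓝[>] 0) (𝓝 (∫ φ in (0 : ℝ)..π, F φ)) := by
    have h1 : ContinuousOn (fun x => ∫ φ in (0 : ℝ)..x, F φ) (Set.Icc 0 π) := by
      have := intervalIntegral.continuousOn_primitive_interval' hI Set.left_mem_uIcc
      rwa [Set.uIcc_of_le pi_pos.le] at this
    have h2 : Tendsto (fun α : ℝ => ∫ φ in (0 : ℝ)..α, F φ) (𝓝[>] 0) (𝓝 0) := by
      have h := h1 0 ⟨le_rfl, pi_pos.le⟩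
      rw [ContinuousWithinAt, intervalIntegral.integral_same] at h
      refine h.mono_left (nhdsWithin_le_of_mem ?_)
      filter_upwards [self_mem_nhdsWithin, nhdsWithin_le_nhds (gt_mem_nhds pi_pos)] with α h1 h2
      exact ⟨le_of_lt h1, h2.le⟩
    have h3 : Tendsto (fun α : ℝ => ∫ φ in (0 : ℝ)..(π - α), F φ) (𝓝[>] 0)
        (𝓝 (∫ φ in (0 : ℝ)..π, F φ)) := by
      have h := h1 π ⟨pi_pos.le, le_rfl⟩
      refine Tendsto.comp (g := fun x => ∫ φ in (0 : ℝ)..x, F φ) h ?_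
      refine tendsto_nhdsWithin_iff.2 ⟨?_, ?_⟩
      · have : Continuous fun α : ℝ => π - α := by fun_prop
        have h := this.tendsto 0
        simp only [sub_zero] at h
        exact h.mono_left nhdsWithin_le_nhds
      · filter_upwards [self_mem_nhdsWithin, nhdsWithin_le_nhds (gt_mem_nhds pi_pos)] with α h1 h2
        have h1 : 0 < α := h1
        exact ⟨by linarith, by linarith⟩
    have h4 := h3.sub h2
    rw [sub_zero] at h4
    refine h4.congr' ?_
    filter_upwards [self_mem_nhdsWithin, nhdsWithin_le_nhds (gt_mem_nhds pi_pos)] with α h1 h2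
    have h1 : 0 < α := h1
    have hsub : ∀ x ∈ Set.Icc 0 π, IntervalIntegrable F volume 0 x := fun x hx =>
      hI.mono_set (by
        rw [Set.uIcc_of_le pi_pos.le, Set.uIcc_of_le hx.1]; exact Set.Icc_subset_Icc le_rfl hx.2)
    exact intervalIntegral.integral_interval_sub_left
      (hsub _ ⟨by linarith, by linarith⟩) (hsub _ ⟨h1.le, h2.le⟩)
  refine eq_of_forall_dist_le fun δ hδ => ?_
  have h0 := eventually_norm_stream_sub_le hu hg hΨ hε (Or.inl rfl) (p := 0)
    (δ := δ / 4) (by positivity)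
  have hε' := eventually_norm_stream_sub_le hu hg hΨ hε (Or.inr rfl) (p := ε)
    (δ := δ / 4) (by positivity)
  -- The gaps of half-width ρ around 0 and ε must be disjoint and stay inside the half-disc; the
  -- last bound makes the boundary integral over each gap at most δ/4.
  have hsmall : ∀ᶠ ρ in 𝓝[>] (0 : ℝ), ρ < min (min (R - ε) (ε / 3)) (δ / (8 * (K + 1))) :=
    nhdsWithin_le_nhds (gt_mem_nhds (by
      have : 0 < R - ε := by linarith
      positivity))
  obtain ⟨ρ, ⟨⟨hρ0, hρε⟩, hρs⟩, hρpos⟩ :=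
    (((h0.and hε').and hsmall).and self_mem_nhdsWithin).exists
  have hρpos : 0 < ρ := hρpos
  simp only [lt_min_iff] at hρs
  obtain ⟨⟨hρ1, hρ2⟩, hρ3⟩ := hρs
  -- The clamps by `max` here and `min` below keep the moving end in the allowed segment for every
  -- η; they are inactive at the small heights that matter.
  have hT1 := (tendsto_integral_greenForm hu hg (s := ε + ρ) (s' := R) (a := ε + ρ)
    (b := fun η => max (ε + ρ) √(R ^ 2 - η ^ 2)) (by linarith)
    (fun t ht => ⟨by linarith [ht.1], by linarith [ht.1]⟩) ⟨le_rfl, by linarith⟩ (by fun_prop)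
    (fun η => ⟨le_max_left _ _, max_le (by linarith)
      (Real.sqrt_le_iff.2 ⟨hR0.le, by nlinarith [sq_nonneg η]⟩)⟩)).comp hsin
  have hT2 := (tendsto_integral_greenForm hu hg (s := ρ) (s' := ε - ρ) (a := ρ)
    (b := fun η => ε - ρ) (by linarith)
    (fun t ht => ⟨by linarith [ht.1], by linarith [ht.2]⟩) ⟨le_rfl, by linarith⟩ (by fun_prop)
    (fun η => ⟨by linarith, by linarith⟩)).comp hsin
  have hT3 := (tendsto_integral_greenForm hu hg (s := -R) (s' := -ρ) (a := -ρ)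
    (b := fun η => min (-ρ) (-√(R ^ 2 - η ^ 2))) (by linarith)
    (fun t ht => ⟨by linarith [ht.2], by linarith [ht.2]⟩) ⟨by linarith, le_rfl⟩ (by fun_prop)
    (fun η => ⟨le_min (by linarith) (neg_le_neg
      (Real.sqrt_le_iff.2 ⟨hR0.le, by nlinarith [sq_nonneg η]⟩)), min_le_left _ _⟩)).comp hsin
  have hb1 : max (ε + ρ) √(R ^ 2 - 0 ^ 2) = R := by
    rw [zero_pow two_ne_zero, sub_zero, Real.sqrt_sq hR0.le]; exact max_eq_right (by linarith)
  have hb3 : min (-ρ) (-√(R ^ 2 - 0 ^ 2)) = -R := by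
    rw [zero_pow two_ne_zero, sub_zero, Real.sqrt_sq hR0.le]; exact min_eq_right (by linarith)
  rw [hb1] at hT1
  rw [hb3] at hT3
  have hlim := ((hA.sub hT1).sub hT2).add hT3
  have hbound : ∀ᶠ α in 𝓝[>] (0 : ℝ), ‖(∫ φ in α..π - α, F φ) -
      (∫ t in (ε + ρ)..max (ε + ρ) √(R ^ 2 - (R * sin α) ^ 2),
        greenForm u g !₂[t, R * sin α] !₂[0, 1]) -
      (∫ t in ρ..(ε - ρ), greenForm u g !₂[t, R * sin α] !₂[0, 1]) +
      (∫ t in (-ρ)..min (-ρ) (-√(R ^ 2 - (R * sin α) ^ 2)),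
        greenForm u g !₂[t, R * sin α] !₂[0, 1])‖ ≤ δ / 2 := by
    have hcos : ∀ᶠ α in 𝓝[>] (0 : ℝ), ε + ρ < R * cos α := by
      have : Continuous fun α : ℝ => R * cos α := by fun_prop
      have h := this.tendsto 0
      simp only [cos_zero, mul_one] at h
      exact nhdsWithin_le_nhds (h.eventually (lt_mem_nhds (by linarith)))
    filter_upwards [self_mem_nhdsWithin, nhdsWithin_le_nhds (gt_mem_nhds pi_div_two_pos), hcos,
      hsin.eventually hρ0, hsin.eventually hρε] with α hα hα2 hc hE0 hEε
    have hα : 0 < α := hα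
    have hs : 0 < sin α := sin_pos_of_pos_of_lt_pi hα (by linarith)
    have hη : 0 < R * sin α := mul_pos hR0 hs
    have hsq : √(R ^ 2 - (R * sin α) ^ 2) = R * cos α := by
      have : R ^ 2 - (R * sin α) ^ 2 = (R * cos α) ^ 2 := by
        nlinarith [sin_sq_add_cos_sq α]
      rw [this, Real.sqrt_sq (by linarith)]
    rw [hsq, max_eq_right hc.le, min_eq_right (by linarith)]
    have harc := stream_sub_arc hu.contDiffAt hg.contDiffAt' hΨ (p := 0) (η := 0) (ρ := R) (α := α)
      (β := π - α) (fun φ hφ => by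
        rw [Set.uIcc_of_le (by linarith)] at hφ
        have := mul_pos hR0 (sin_pos_of_pos_of_lt_pi (hα.trans_le hφ.1) (by linarith [hφ.2]))
        linarith)
    simp only [zero_add, cos_pi_sub, sin_pi_sub] at harc
    have hh := fun s s' => stream_sub_horizontal hu.contDiffAt hg.contDiffAt' hΨ hη s s'
    have e1 := hh (ε + ρ) (R * cos α)
    have e2 := hh ρ (ε - ρ)
    have e3 := hh (-ρ) (-(R * cos α))
    have e4 : (R * -cos α) = -(R * cos α) := by ring
    rw [e4] at harc
    simp only [zero_add, zero_sub] at hE0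
    rw [hF, ← harc]
    -- The stream-function differences telescope around the contour, leaving only the jumps across
    -- the two gaps.
    have e5 : Ψ !₂[-(R * cos α), R * sin α] - Ψ !₂[R * cos α, R * sin α] -
        (∫ t in (ε + ρ)..R * cos α, greenForm u g !₂[t, R * sin α] !₂[0, 1]) -
        (∫ t in ρ..(ε - ρ), greenForm u g !₂[t, R * sin α] !₂[0, 1]) +
        (∫ t in (-ρ)..-(R * cos α), greenForm u g !₂[t, R * sin α] !₂[0, 1]) =
        -(Ψ !₂[ε + ρ, R * sin α] - Ψ !₂[ε - ρ, R * sin α]) -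
        (Ψ !₂[ρ, R * sin α] - Ψ !₂[-ρ, R * sin α]) := by
      linear_combination -e1 - e2 + e3
    rw [e5]
    refine (norm_sub_le _ _).trans ?_
    rw [norm_neg]
    linarith
  have hle := le_of_tendsto hlim.norm hbound
  have hsplit : ∫ t in -R..R, N t = (∫ t in (ε + ρ)..R, N t) + (∫ t in ρ..(ε - ρ), N t) -
      (∫ t in (-ρ)..(-R), N t) + (∫ t in (-ρ)..ρ, N t) + ∫ t in (ε - ρ)..(ε + ρ), N t := by
    rw [intervalIntegral.integral_symm (-R) (-ρ)]
    have s1 := intervalIntegral.integral_add_adjacent_intervals (hNi (-R) (-ρ)) (hNi (-ρ) ρ)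
    have s2 := intervalIntegral.integral_add_adjacent_intervals (hNi (-R) ρ) (hNi ρ (ε - ρ))
    have s3 := intervalIntegral.integral_add_adjacent_intervals (hNi (-R) (ε - ρ))
      (hNi (ε - ρ) (ε + ρ))
    have s4 := intervalIntegral.integral_add_adjacent_intervals (hNi (-R) (ε + ρ))
      (hNi (ε + ρ) R)
    rw [← s4, ← s3, ← s2, ← s1]
    ring
  have hK8 : K * (2 * ρ) ≤ δ / 4 := by
    rw [lt_div_iff₀ (by positivity)] at hρ3
    nlinarith
  have hn1 : ‖∫ t in (-ρ)..ρ, N t‖ ≤ δ / 4 := by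
    have := intervalIntegral.norm_integral_le_of_norm_le_const (f := N) (a := -ρ) (b := ρ) (C := K)
      fun t ht => hNb t (by
        rw [Set.uIoc_of_le (by linarith)] at ht
        exact abs_le.2 ⟨by linarith [ht.1], by linarith [ht.2]⟩)
    rw [abs_of_nonneg (by linarith)] at this
    linarith
  have hn2 : ‖∫ t in (ε - ρ)..(ε + ρ), N t‖ ≤ δ / 4 := by
    have := intervalIntegral.norm_integral_le_of_norm_le_const (f := N) (a := ε - ρ) (b := ε + ρ)
      (C := K) fun t ht => hNb t (by
        rw [Set.uIoc_of_le (by linarith)] at ht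
        exact abs_le.2 ⟨by linarith [ht.1], by linarith [ht.2]⟩)
    rw [abs_of_nonneg (by linarith)] at this
    linarith
  rw [dist_eq_norm, hsplit]
  have e : (∫ φ in (0 : ℝ)..π, F φ) - ((∫ t in (ε + ρ)..R, N t) + (∫ t in ρ..(ε - ρ), N t) -
      (∫ t in (-ρ)..(-R), N t) + (∫ t in (-ρ)..ρ, N t) + ∫ t in (ε - ρ)..(ε + ρ), N t) =
      ((∫ φ in (0 : ℝ)..π, F φ) - (∫ t in (ε + ρ)..R, N t) - (∫ t in ρ..(ε - ρ), N t) +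
      (∫ t in (-ρ)..(-R), N t)) - (∫ t in (-ρ)..ρ, N t) - ∫ t in (ε - ρ)..(ε + ρ), N t := by ring
  rw [e]
  refine (norm_sub_le _ _).trans ((add_le_add (norm_sub_le _ _) le_rfl).trans ?_)
  linarith

end

section

/-! ### Point sources -/

theorem contDiffOn_hankel (n k : ℕ) : ContDiffOn ℝ n (hankel k) (Set.Ioi 0) := by
  induction n generalizing k with
  | zero =>
    exact contDiffOn_zero.2 fun r hr => (continuousAt_hankel k hr).continuousWithinAt
  | succ n ih =>
    have : ((n + 1 : ℕ) : WithTop ℕ∞) = (n : WithTop ℕ∞) + 1 := by push_cast; rfl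
    rw [this, contDiffOn_succ_iff_deriv_of_isOpen isOpen_Ioi]
    refine ⟨fun r hr => (hasDerivAt_hankel k hr).differentiableAt.differentiableWithinAt,
      by simp, ?_⟩
    exact (ih (k + 1)).congr fun r hr => (hasDerivAt_hankel k hr).deriv

/-- The outgoing field of a point source at `z`. -/
def pointSource (κ : ℝ) (z x : Plane) : ℂ := hankel 0 (κ * ‖x - z‖)

/-- The real inner product with `x`, as a complex-valued form. -/
def innerForm : Plane →L[ℝ] Plane →L[ℝ] ℂ :=
  (ContinuousLinearMap.compL ℝ Plane ℝ ℂ Complex.ofRealCLM).comp (innerSL ℝ)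

theorem innerForm_apply (x e : Plane) : innerForm x e = ((x 0 * e 0 + x 1 * e 1 : ℝ) : ℂ) := by
  have : innerForm x e = ((inner ℝ x e : ℝ) : ℂ) := rfl
  rw [this, PiLp.inner_apply, Fin.sum_univ_two]
  simp [mul_comm]

variable {κ : ℝ} {z x : Plane}

theorem hasFDerivAt_norm_sub (hx : x ≠ z) :
    HasFDerivAt (fun x : Plane => ‖x - z‖) (‖x - z‖⁻¹ • innerSL ℝ (x - z)) x := by
  have hne : ‖x - z‖ ^ 2 ≠ 0 := pow_ne_zero 2 (norm_ne_zero_iff.2 (sub_ne_zero.2 hx))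
  have h1 : HasFDerivAt (fun x : Plane => ‖x - z‖ ^ 2) (2 • innerSL ℝ (x - z)) x := by
    have := ((hasFDerivAt_id x).sub_const z).norm_sq
    simpa using this
  have h2 := h1.sqrt hne
  simp only [Real.sqrt_sq (norm_nonneg _)] at h2
  refine h2.congr_fderiv ?_
  ext e
  simp
  ring

theorem hasFDerivAt_radial {f : ℝ → ℂ} {f' : ℂ} (hx : x ≠ z) (hf : HasDerivAt f f' ‖x - z‖) :
    HasFDerivAt (fun x : Plane => f ‖x - z‖) ((f' / ‖x - z‖) • innerForm (x - z)) x := by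
  have h := hf.hasFDerivAt.comp x (hasFDerivAt_norm_sub hx)
  refine h.congr_fderiv ?_
  ext e
  have e1 : innerForm (x - z) e = ((inner ℝ (x - z) e : ℝ) : ℂ) := rfl
  simp only [ContinuousLinearMap.comp_apply, smul_apply, innerSL_apply_apply, smul_eq_mul, e1,
    ContinuousLinearMap.toSpanSingleton_apply, Complex.real_smul]
  push_cast
  ring

theorem hasDerivAt_hankel_mul (n : ℕ) (hκ : 0 < κ) {r : ℝ} (hr : 0 < r) :
    HasDerivAt (fun r => hankel n (κ * r)) (κ * hankel (n + 1) (κ * r)) r := by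
  have h := (hasDerivAt_hankel n (mul_pos hκ hr)).scomp r ((hasDerivAt_id r).const_mul κ)
  refine h.congr_deriv ?_
  simp

theorem hasFDerivAt_pointSource (hκ : 0 < κ) (hx : x ≠ z) :
    HasFDerivAt (pointSource κ z)
      ((κ * hankel 1 (κ * ‖x - z‖) / ‖x - z‖) • innerForm (x - z)) x :=
  hasFDerivAt_radial hx
    (hasDerivAt_hankel_mul 0 hκ (norm_pos_iff.2 (sub_ne_zero.2 hx)))

theorem fderiv_pointSource (hκ : 0 < κ) (hx : x ≠ z) (e : Plane) :
    fderiv ℝ (pointSource κ z) x e =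
      κ * hankel 1 (κ * ‖x - z‖) / ‖x - z‖ *
        (((x 0 - z 0) * e 0 + (x 1 - z 1) * e 1 : ℝ) : ℂ) := by
  rw [(hasFDerivAt_pointSource hκ hx).fderiv, smul_apply, innerForm_apply]
  simp

theorem contDiffAt_pointSource (hκ : 0 < κ) (hx : x ≠ z) :
    ContDiffAt ℝ 2 (pointSource κ z) x := by
  have hr : 0 < ‖x - z‖ := norm_pos_iff.2 (sub_ne_zero.2 hx)
  have h1 : ContDiffAt ℝ 2 (hankel 0) (κ * ‖x - z‖) :=
    (contDiffOn_hankel 2 0).contDiffAt (Ioi_mem_nhds (mul_pos hκ hr))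
  have h2 : ContDiffAt ℝ 2 (fun x : Plane => κ * ‖x - z‖) x :=
    contDiffAt_const.mul ((contDiffAt_id.sub contDiffAt_const).norm ℝ (sub_ne_zero.2 hx))
  exact h1.comp x h2

/-- The Laplacian of a radial function f(r) is f'' + f'/r, so for f = h(κ·) this is `hankel_bessel`
rescaled. -/
theorem helmholtz_pointSource (hκ : 0 < κ) (hx : x ≠ z) :
    Δ (pointSource κ z) x + (κ : ℂ) ^ 2 * pointSource κ z x = 0 := by
  have hr : 0 < ‖x - z‖ := norm_pos_iff.2 (sub_ne_zero.2 hx)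
  have hr' : (‖x - z‖ : ℂ) ≠ 0 := by exact_mod_cast hr.ne'
  have hκ' : (κ : ℂ) ≠ 0 := by exact_mod_cast hκ.ne'
  set m : ℝ → ℂ := fun r => κ * hankel 1 (κ * r) / r with hm
  set m' : ℂ := (κ * (κ * hankel 2 (κ * ‖x - z‖)) * ‖x - z‖ - κ * hankel 1 (κ * ‖x - z‖)) /
    (‖x - z‖ : ℂ) ^ 2 with hm'
  have hmd : HasDerivAt m m' ‖x - z‖ := by
    have := ((hasDerivAt_hankel_mul 1 hκ hr).const_mul (κ : ℂ)).div
      (Complex.ofRealCLM.hasDerivAt (x := ‖x - z‖)) hr'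
    refine this.congr_deriv ?_
    simp [hm']
  have hev : fderiv ℝ (pointSource κ z) =ᶠ[𝓝 x] fun x => m ‖x - z‖ • innerForm (x - z) := by
    filter_upwards [isOpen_ne.mem_nhds hx] with w hw
    exact (hasFDerivAt_pointSource hκ hw).fderiv
  have hI : HasFDerivAt (fun x : Plane => innerForm (x - z)) innerForm x := by
    have := innerForm.hasFDerivAt.comp x ((hasFDerivAt_id x).sub_const z)
    exact this
  have h2 : HasFDerivAt (fderiv ℝ (pointSource κ z))
      (m ‖x - z‖ • innerForm +
        ((m' / ‖x - z‖) • innerForm (x - z)).smulRight (innerForm (x - z))) x :=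
    ((hasFDerivAt_radial hx hmd).smul hI).congr_of_eventuallyEq hev
  rw [laplacian_plane, h2.fderiv]
  simp only [add_apply, smul_apply, ContinuousLinearMap.smulRight_apply, innerForm_apply,
    smul_eq_mul]
  have hsq : ((x 0 - z 0 : ℝ) : ℂ) ^ 2 + ((x 1 - z 1 : ℝ) : ℂ) ^ 2 = (‖x - z‖ : ℂ) ^ 2 := by
    have : (x 0 - z 0) ^ 2 + (x 1 - z 1) ^ 2 = ‖x - z‖ ^ 2 := by
      rw [EuclideanSpace.norm_sq_eq]; simp
    exact_mod_cast this
  have hB := hankel_bessel (mul_pos hκ hr)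
  have hps : pointSource κ z x = hankel 0 (κ * ‖x - z‖) := rfl
  rw [hps]
  push_cast at hB hsq ⊢
  simp only [hm, hm']
  simp only [PiLp.sub_apply, mul_one, mul_zero, add_zero, zero_add]
  push_cast
  have e1 : ∀ A B : ℂ, κ * A / (‖x - z‖ : ℂ) + B * ((x 0 : ℂ) - z 0) * ((x 0 : ℂ) - z 0) +
      (κ * A / (‖x - z‖ : ℂ) + B * ((x 1 : ℂ) - z 1) * ((x 1 : ℂ) - z 1)) =
      2 * (κ * A / (‖x - z‖ : ℂ)) + B * (‖x - z‖ : ℂ) ^ 2 := by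
    intro A B; rw [← hsq]; ring
  rw [e1]
  field_simp
  linear_combination (κ : ℂ) * hB

end

/-! ### Sources approaching the boundary -/

section

variable {κ ε : ℝ} {c : ℂ} {u : Plane → ℂ} {y : ℝ}

theorem norm_innerForm_le (x e : Plane) : ‖innerForm x e‖ ≤ ‖x‖ * ‖e‖ := by
  have : innerForm x e = ((inner ℝ x e : ℝ) : ℂ) := rfl
  rw [this, Complex.norm_real]
  exact norm_inner_le_norm x e

theorem norm_fderiv_pointSource_le (hκ : 0 < κ) {x z : Plane} (hx : x ≠ z) (e : Plane) :
    ‖fderiv ℝ (pointSource κ z) x e‖ ≤ κ * ‖hankel 1 (κ * ‖x - z‖)‖ * ‖e‖ := by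
  have hr : 0 < ‖x - z‖ := norm_pos_iff.2 (sub_ne_zero.2 hx)
  rw [(hasFDerivAt_pointSource hκ hx).fderiv, smul_apply, smul_eq_mul, norm_mul, norm_div, norm_mul,
    Complex.norm_of_nonneg hκ.le, Complex.norm_of_nonneg hr.le]
  calc κ * ‖hankel 1 (κ * ‖x - z‖)‖ / ‖x - z‖ * ‖innerForm (x - z) e‖
      ≤ κ * ‖hankel 1 (κ * ‖x - z‖)‖ / ‖x - z‖ * (‖x - z‖ * ‖e‖) := by
        gcongr; exact norm_innerForm_le _ _
    _ = _ := by field_simp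

theorem ne_source {τ : ℝ} (hτ : 0 < τ) {x : Plane} (hx : x ∈ closedUpperHalf) :
    x ≠ !₂[y, -τ] := by
  rintro rfl
  have : 0 ≤ -τ := by simpa [closedUpperHalf] using hx
  linarith

/-- A source at depth τ > 0 has no singularity in the closed half-plane, so Green's identity
applies; the limit τ → 0 is taken afterwards. -/
theorem testField_pointSource (hκ : 0 < κ) {τ : ℝ} (hτ : 0 < τ) :
    TestField κ (pointSource κ !₂[y, -τ]) where
  contDiffAt _ hx := contDiffAt_pointSource hκ (ne_source hτ hx)
  helmholtz _ hx := helmholtz_pointSource hκ (ne_source hτ (upperHalf_subset hx))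

theorem norm_sub_source (a b y τ : ℝ) :
    ‖(!₂[a, b] : Plane) - !₂[y, -τ]‖ = √((a - y) ^ 2 + (b + τ) ^ 2) := by
  have : (!₂[a, b] : Plane) - !₂[y, -τ] = !₂[a - y, b + τ] := by
    ext i; fin_cases i <;> simp
  rw [this, plane_norm]

theorem pointSource_trace (t τ : ℝ) :
    pointSource κ !₂[y, -τ] !₂[t, 0] = hankel 0 (κ * √((t - y) ^ 2 + τ ^ 2)) := by
  rw [pointSource, norm_sub_source, zero_add]

theorem fderiv_pointSource_trace (hκ : 0 < κ) {τ : ℝ} (hτ : 0 < τ) (t : ℝ) :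
    fderiv ℝ (pointSource κ !₂[y, -τ]) !₂[t, 0] !₂[0, 1] =
      κ * hankel 1 (κ * √((t - y) ^ 2 + τ ^ 2)) / √((t - y) ^ 2 + τ ^ 2) * τ := by
  rw [fderiv_pointSource hκ (ne_source hτ (by simp [closedUpperHalf])), norm_sub_source, zero_add]
  simp

/-- The source potential over the aperture, in the limit of a source on the boundary. -/
theorem tendsto_integral_source (hκ : 0 < κ) (R : ℝ) :
    Tendsto (fun τ : ℝ => ∫ t in -R..R, pointSource κ !₂[y, -τ] !₂[t, 0] * apertureData ε c t)
      (𝓝[>] 0) (𝓝 (∫ t in -R..R, hankel 0 (κ * |t - y|) * apertureData ε c t)) := by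
  have hG : 0 ≤ Real.Gamma (1 / 2) := (Real.Gamma_pos_of_pos (by norm_num)).le
  refine intervalIntegral.tendsto_integral_filter_of_dominated_convergence
    -- The bound |h(r)| ≤ Γ(1/2) r^(-1/2) holds for all r > 0 and is integrable at t = y; moving the
    -- source down only increases the distance.
    (fun t => Real.Gamma (1 / 2) * (1 / κ) ^ (1 / 2 : ℝ) * |t - y| ^ (-(1 / 2) : ℝ) * ‖c‖) ?_ ?_ ?_ ?_
  · filter_upwards [self_mem_nhdsWithin] with τ hτ
    exact ((intervalIntegrable_apertureData ε c (-R) R).continuousOn_mul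
      (testField_pointSource hκ hτ).continuous_trace.continuousOn).def'.aestronglyMeasurable
  · filter_upwards [self_mem_nhdsWithin] with τ hτ
    have hne : ∀ᵐ t : ℝ, t ≠ y := by simp [ae_iff, measure_singleton]
    filter_upwards [hne] with t ht _
    have habs : 0 < |t - y| := abs_pos.2 (sub_ne_zero.2 ht)
    have hle : |t - y| ≤ √((t - y) ^ 2 + τ ^ 2) := by
      rw [← Real.sqrt_sq_eq_abs]; exact Real.sqrt_le_sqrt (by nlinarith [sq_nonneg τ])
    have hr : 0 < √((t - y) ^ 2 + τ ^ 2) := habs.trans_le hle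
    rw [norm_mul, pointSource_trace]
    refine mul_le_mul ?_ (norm_apertureData_le ε c t) (norm_nonneg _) (by positivity)
    refine (norm_hankel_zero_le (mul_pos hκ hr)).trans ?_
    rw [mul_assoc]
    refine mul_le_mul_of_nonneg_left ?_ hG
    have e : (1 / κ) ^ (1 / 2 : ℝ) * |t - y| ^ (-(1 / 2) : ℝ) = (1 / (κ * |t - y|)) ^ (1 / 2 : ℝ) := by
      rw [rpow_neg habs.le, ← inv_rpow habs.le, ← mul_rpow (by positivity) (by positivity)]
      congr 1
      field_simp
    rw [e]
    gcongr
  · have h1 : IntervalIntegrable (fun t : ℝ => |t| ^ (-(1 / 2) : ℝ)) volume (-R - y) (R - y) := by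
      have h2 : ∀ a : ℝ, IntervalIntegrable (fun t : ℝ => |t| ^ (-(1 / 2) : ℝ)) volume 0 a := by
        have h3 : ∀ a : ℝ, 0 ≤ a → IntervalIntegrable (fun t : ℝ => |t| ^ (-(1 / 2) : ℝ)) volume 0 a := by
          intro a ha
          refine (intervalIntegral.intervalIntegrable_rpow' (a := 0) (b := a)
            (r := -(1 / 2)) (by norm_num)).congr ?_
          intro t ht
          rw [Set.uIoc_of_le ha] at ht
          simp only [abs_of_pos ht.1]
        intro a
        rcases le_total 0 a with ha | ha
        · exact h3 a ha
        · have := (h3 (-a) (by linarith)).comp_sub_left 0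
          simp only [zero_sub, abs_neg, neg_zero, neg_neg] at this
          exact this
      exact (h2 _).symm.trans (h2 _)
    have h2 := h1.comp_sub_right y
    simp only [sub_add_cancel] at h2
    exact (h2.const_mul _).mul_const _
  · have hne : ∀ᵐ t : ℝ, t ≠ y := by simp [ae_iff, measure_singleton]
    filter_upwards [hne] with t ht _
    have habs : 0 < |t - y| := abs_pos.2 (sub_ne_zero.2 ht)
    refine Tendsto.mul_const _ ?_
    simp_rw [pointSource_trace]
    have h1 : Continuous fun τ : ℝ => κ * √((t - y) ^ 2 + τ ^ 2) := by fun_prop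
    have h2 := h1.tendsto 0
    have e : κ * √((t - y) ^ 2 + 0 ^ 2) = κ * |t - y| := by
      rw [zero_pow two_ne_zero, add_zero, Real.sqrt_sq_eq_abs]
    rw [e] at h2
    exact ((continuousAt_hankel 0 (mul_pos hκ habs)).tendsto.comp h2).mono_left nhdsWithin_le_nhds

/-- The normal derivative of a source approaching the boundary acts as a multiple of a Dirac
mass. -/
theorem tendsto_integral_poisson (hκ : 0 < κ) {f : ℝ → ℂ} (hf : Continuous f) {R : ℝ}
    (hy : -R < y) (hy' : y < R) :
    Tendsto (fun τ : ℝ => ∫ t in -R..R,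
      f t * fderiv ℝ (pointSource κ !₂[y, -τ]) !₂[t, 0] !₂[0, 1]) (𝓝[>] 0) (𝓝 (-π * f y)) := by
  have hRR : -R ≤ R := by linarith
  have hG : 0 < Real.Gamma (1 / 2) := Real.Gamma_pos_of_pos (by norm_num)
  -- With t = τs + y and r = κτ√(1+s²), the normal derivative becomes r h'(r)/(1+s²), which tends to
  -- -1/(1+s²).
  set H : ℝ → ℝ → ℂ := fun τ s => Set.indicator (Set.Ioc (-R) R)
    (fun t => f t * fderiv ℝ (pointSource κ !₂[y, -τ]) !₂[t, 0] !₂[0, 1]) (τ * s + y) * τ with hH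
  have hHval : ∀ τ : ℝ, 0 < τ → ∀ s : ℝ, H τ s = Set.indicator (Set.Ioc (-R) R)
      (fun t => f t) (τ * s + y) * ((κ * (τ * √(1 + s ^ 2)) : ℝ) *
        hankel 1 (κ * (τ * √(1 + s ^ 2)))) * ((1 + s ^ 2)⁻¹ : ℝ) := by
    intro τ hτ s
    have hs : 0 < √(1 + s ^ 2) := Real.sqrt_pos.2 (by positivity)
    have e1 : √((τ * s + y - y) ^ 2 + τ ^ 2) = τ * √(1 + s ^ 2) := by
      have : (τ * s + y - y) ^ 2 + τ ^ 2 = τ ^ 2 * (1 + s ^ 2) := by ring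
      rw [this, Real.sqrt_mul (by positivity), Real.sqrt_sq hτ.le]
    have e2 : ((1 + s ^ 2 : ℝ) : ℂ) = (√(1 + s ^ 2) : ℂ) ^ 2 := by
      rw [← Complex.ofReal_pow, Real.sq_sqrt (by positivity)]
    have hτ' : (τ : ℂ) ≠ 0 := by exact_mod_cast hτ.ne'
    have hs' : (√(1 + s ^ 2) : ℂ) ≠ 0 := by exact_mod_cast hs.ne'
    simp only [hH]
    by_cases hm : τ * s + y ∈ Set.Ioc (-R) R
    · rw [Set.indicator_of_mem hm, Set.indicator_of_mem hm, fderiv_pointSource_trace hκ hτ, e1,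
        Complex.ofReal_inv, e2]
      push_cast
      field_simp
    · rw [Set.indicator_of_notMem hm, Set.indicator_of_notMem hm]; ring
  have hchange : ∀ τ : ℝ, 0 < τ → ∫ t in -R..R,
      f t * fderiv ℝ (pointSource κ !₂[y, -τ]) !₂[t, 0] !₂[0, 1] = ∫ s, H τ s := by
    intro τ hτ
    rw [intervalIntegral.integral_of_le hRR, ← integral_indicator measurableSet_Ioc]
    set Φ := Set.indicator (Set.Ioc (-R) R)
      (fun t => f t * fderiv ℝ (pointSource κ !₂[y, -τ]) !₂[t, 0] !₂[0, 1])
    have h1 := Measure.integral_comp_mul_left (fun t => Φ (t + y)) τ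
    rw [integral_add_right_eq_self] at h1
    simp only [hH]
    rw [integral_mul_const, h1, abs_of_pos (inv_pos.2 hτ), Complex.real_smul]
    have hτ' : (τ : ℂ) ≠ 0 := by exact_mod_cast hτ.ne'
    push_cast
    field_simp
  obtain ⟨M, hM⟩ := isCompact_Icc.exists_bound_of_continuousOn (s := Set.Icc (-R) R)
    hf.continuousOn
  -- A bound for |r h'(r)| over r ≤ κ(2R+1), the range reached when τ < 1 and t lies in the interval
  -- of integration.
  set K : ℝ := 2 * Real.Gamma (1 / 2) * √(κ * (2 * R + 1)) + κ * (2 * R + 1) + 1 with hK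
  have hR0 : 0 < R := by linarith
  have hM0 : 0 ≤ M := (norm_nonneg _).trans (hM y ⟨hy.le, hy'.le⟩)
  have hlim : Tendsto (fun τ => ∫ s, H τ s) (𝓝[>] 0)
      (𝓝 (∫ s : ℝ, f y * (-1) * ((1 + s ^ 2)⁻¹ : ℝ))) := by
    refine tendsto_integral_filter_of_dominated_convergence
      (fun s : ℝ => M * K * (1 + s ^ 2)⁻¹) ?_ ?_ ?_ ?_
    · filter_upwards [self_mem_nhdsWithin] with τ hτ
      have hm : Measurable (Set.indicator (Set.Ioc (-R) R)
          (fun t => f t * fderiv ℝ (pointSource κ !₂[y, -τ]) !₂[t, 0] !₂[0, 1])) :=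
        (hf.mul (testField_pointSource hκ hτ).continuous_trace_fderiv).measurable.indicator
          measurableSet_Ioc
      exact ((hm.comp (by fun_prop : Measurable fun s : ℝ => τ * s + y)).mul_const
        (τ : ℂ)).aestronglyMeasurable
    · filter_upwards [self_mem_nhdsWithin, nhdsWithin_le_nhds (gt_mem_nhds one_pos)] with τ hτ hτ1
      have hτ : 0 < τ := hτ
      refine Eventually.of_forall fun s => ?_
      rw [hHval τ hτ s]
      have hs : 0 < √(1 + s ^ 2) := Real.sqrt_pos.2 (by positivity)
      by_cases hm : τ * s + y ∈ Set.Ioc (-R) R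
      · rw [Set.indicator_of_mem hm, norm_mul, norm_mul, Complex.norm_of_nonneg (by positivity)]
        have h1 := hM _ (Set.Ioc_subset_Icc_self hm)
        have hts : |τ * s| ≤ 2 * R := abs_le.2 ⟨by linarith [hm.1], by linarith [hm.2]⟩
        have hr : τ * √(1 + s ^ 2) ≤ 2 * R + 1 := by
          have h2 : √(1 + s ^ 2) ≤ 1 + |s| :=
            Real.sqrt_le_iff.2 ⟨by positivity, by nlinarith [abs_nonneg s, sq_abs s]⟩
          rw [abs_mul, abs_of_pos hτ] at hts
          nlinarith
        have hr0 : 0 < κ * (τ * √(1 + s ^ 2)) := by positivity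
        have h2 := norm_mul_hankel_one_add_one_le hr0
        have h3 : κ * (τ * √(1 + s ^ 2)) ≤ κ * (2 * R + 1) := by gcongr
        have h4 := Real.sqrt_le_sqrt h3
        have h5 : ‖((κ * (τ * √(1 + s ^ 2)) : ℝ) : ℂ) * hankel 1 (κ * (τ * √(1 + s ^ 2)))‖ ≤ K := by
          have h6 := norm_sub_le (((κ * (τ * √(1 + s ^ 2)) : ℝ) : ℂ) *
            hankel 1 (κ * (τ * √(1 + s ^ 2))) + 1) 1
          rw [add_sub_cancel_right, norm_one] at h6
          have h7 := mul_le_mul_of_nonneg_left h4 (by positivity : 0 ≤ 2 * Real.Gamma (1 / 2))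
          linarith
        gcongr
      · rw [Set.indicator_of_notMem hm, zero_mul, zero_mul, norm_zero]
        positivity
    · exact integrable_inv_one_add_sq.const_mul _
    · refine Eventually.of_forall fun s => ?_
      have hs : 0 < √(1 + s ^ 2) := Real.sqrt_pos.2 (by positivity)
      have hev : ∀ᶠ τ in 𝓝[>] (0 : ℝ), f (τ * s + y) * ((κ * (τ * √(1 + s ^ 2)) : ℝ) *
        hankel 1 (κ * (τ * √(1 + s ^ 2)))) * ((1 + s ^ 2)⁻¹ : ℝ) = H τ s := by
        have hc : Continuous fun τ : ℝ => τ * s + y := by fun_prop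
        have h1 := hc.tendsto 0
        rw [zero_mul, zero_add] at h1
        filter_upwards [self_mem_nhdsWithin,
          nhdsWithin_le_nhds (h1.eventually (Ioo_mem_nhds hy hy'))] with τ hτ hm
        rw [hHval τ hτ s, Set.indicator_of_mem (Set.Ioo_subset_Ioc_self hm)]
      refine Tendsto.congr' hev ?_
      refine Tendsto.mul_const _ (Tendsto.mul ?_ ?_)
      · have hc : Continuous fun τ : ℝ => f (τ * s + y) := by fun_prop
        have h1 := hc.tendsto 0
        simp only [zero_mul, zero_add] at h1
        exact h1.mono_left nhdsWithin_le_nhds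
      · rw [tendsto_iff_norm_sub_tendsto_zero]
        have hc : Continuous fun τ : ℝ => 2 * Real.Gamma (1 / 2) * √(κ * (τ * √(1 + s ^ 2))) +
          κ * (τ * √(1 + s ^ 2)) := by fun_prop
        have h1 := hc.tendsto 0
        simp only [zero_mul, mul_zero, Real.sqrt_zero, add_zero] at h1
        refine tendsto_of_tendsto_of_tendsto_of_le_of_le' tendsto_const_nhds
          (h1.mono_left nhdsWithin_le_nhds) (Eventually.of_forall fun _ => norm_nonneg _) ?_
        filter_upwards [self_mem_nhdsWithin] with τ hτ
        have hτ : 0 < τ := hτ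
        have := norm_mul_hankel_one_add_one_le (r := κ * (τ * √(1 + s ^ 2))) (by positivity)
        rwa [sub_neg_eq_add]
  have hval : ∫ s : ℝ, f y * (-1) * ((1 + s ^ 2)⁻¹ : ℝ) = -π * f y := by
    rw [integral_const_mul, integral_complex_ofReal, integral_univ_inv_one_add_sq]
    ring
  rw [hval] at hlim
  refine hlim.congr' ?_
  filter_upwards [self_mem_nhdsWithin] with τ hτ
  exact (hchange τ hτ).symm

end

section

variable {κ ε : ℝ} {c : ℂ} {u : Plane → ℂ} {y : ℝ}

/-! ### The radiation condition and the representation of the trace -/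

theorem le_norm_sub_source {R φ τ : ℝ} (hR : 0 < R) (hφ : φ ∈ Set.Icc 0 π) (hy : 0 < y)
    (hτ : 0 ≤ τ) : R - y ≤ ‖(!₂[R * cos φ, R * sin φ] : Plane) - !₂[y, -τ]‖ := by
  have hs := mul_nonneg hR.le (sin_nonneg_of_nonneg_of_le_pi hφ.1 hφ.2)
  have h1 : ‖(!₂[R * cos φ, R * sin φ] : Plane) - !₂[y, -0]‖ ≤
      ‖(!₂[R * cos φ, R * sin φ] : Plane) - !₂[y, -τ]‖ := by
    rw [norm_sub_source, norm_sub_source]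
    apply Real.sqrt_le_sqrt
    nlinarith
  refine le_trans ?_ h1
  have h2 := norm_sub_norm_le (!₂[R * cos φ, R * sin φ] : Plane) !₂[y, -0]
  rw [norm_plane_polar hR.le, plane_norm] at h2
  have h3 : √(y ^ 2 + (-0) ^ 2) = y := by
    rw [neg_zero, zero_pow two_ne_zero, add_zero, Real.sqrt_sq hy.le]
  linarith

theorem norm_sub_source_le {R φ τ : ℝ} (hR : 0 < R) (hy : 0 < y) (hτ : 0 ≤ τ) :
    ‖(!₂[R * cos φ, R * sin φ] : Plane) - !₂[y, -τ]‖ ≤ R + y + τ := by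
  refine (norm_sub_le _ _).trans ?_
  rw [norm_plane_polar hR.le, plane_norm]
  have : √(y ^ 2 + (-τ) ^ 2) ≤ y + τ := Real.sqrt_le_iff.2 ⟨by positivity, by nlinarith⟩
  linarith

/-- For τ < 1 the distance from the arc to the source stays between R - y > 0 and R + y + 1, so
dominated convergence applies. The limit is written with `-0` to be the member τ = 0 of the same
family. -/
theorem tendsto_integral_arc (hκ : 0 < κ) (hu : NeumannField κ ε c u) (hy : 0 < y) (hy' : y < ε)
    {R : ℝ} (hR : ε < R) {B : ℝ}
    (hB : ∀ φ ∈ Set.Ioo 0 π, ‖fderiv ℝ u !₂[R * cos φ, R * sin φ] !₂[cos φ, sin φ]‖ ≤ B) :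
    Tendsto (fun τ : ℝ => ∫ φ in (0 : ℝ)..π,
      R * greenForm u (pointSource κ !₂[y, -τ]) !₂[R * cos φ, R * sin φ] !₂[cos φ, sin φ])
      (𝓝[>] 0) (𝓝 (∫ φ in (0 : ℝ)..π,
      R * greenForm u (pointSource κ !₂[y, -0]) !₂[R * cos φ, R * sin φ] !₂[cos φ, sin φ])) := by
  have hR0 : 0 < R := by linarith
  have hsub : Set.Icc (κ * (R - y)) (κ * (R + y + 1)) ⊆ Set.Ioi 0 := fun s hs =>
    (mul_pos hκ (by linarith : 0 < R - y)).trans_le hs.1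
  obtain ⟨H₀, hH₀⟩ := isCompact_Icc.exists_bound_of_continuousOn (f := hankel 0)
    (s := Set.Icc (κ * (R - y)) (κ * (R + y + 1)))
    fun s hs => (continuousAt_hankel 0 (hsub hs)).continuousWithinAt
  obtain ⟨H₁, hH₁⟩ := isCompact_Icc.exists_bound_of_continuousOn (f := hankel 1)
    (s := Set.Icc (κ * (R - y)) (κ * (R + y + 1)))
    fun s hs => (continuousAt_hankel 1 (hsub hs)).continuousWithinAt
  obtain ⟨M, hM0, hM⟩ := hu.exists_bound 0 R
  refine intervalIntegral.tendsto_integral_filter_of_dominated_convergence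
    (fun _ => R * (H₀ * B + M * (κ * H₁))) ?_ ?_ intervalIntegrable_const ?_
  · filter_upwards [self_mem_nhdsWithin] with τ hτ
    exact (intervalIntegrable_arc hu (testField_pointSource hκ hτ) hR0
      hB).def'.aestronglyMeasurable
  · filter_upwards [self_mem_nhdsWithin, nhdsWithin_le_nhds (gt_mem_nhds one_pos)] with τ hτ hτ1
    have hτ : 0 < τ := hτ
    have hne : ∀ᵐ φ : ℝ, φ ≠ π := by simp [ae_iff, measure_singleton]
    filter_upwards [hne] with φ hφπ hφ
    rw [Set.uIoc_of_le pi_pos.le] at hφ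
    have hφ' : φ ∈ Set.Ioo 0 π := ⟨hφ.1, lt_of_le_of_ne hφ.2 hφπ⟩
    have hmem : (!₂[R * cos φ, R * sin φ] : Plane) ∈ closedUpperHalf := by
      have := mul_nonneg hR0.le (sin_nonneg_of_nonneg_of_le_pi hφ.1.le hφ.2)
      simpa [closedUpperHalf] using this
    have hr1 := le_norm_sub_source hR0 ⟨hφ.1.le, hφ.2⟩ hy hτ.le
    have hr2 := norm_sub_source_le (φ := φ) hR0 hy hτ.le
    have hin : κ * ‖(!₂[R * cos φ, R * sin φ] : Plane) - !₂[y, -τ]‖ ∈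
        Set.Icc (κ * (R - y)) (κ * (R + y + 1)) :=
      ⟨by gcongr, by gcongr; linarith⟩
    have h1 : ‖pointSource κ !₂[y, -τ] !₂[R * cos φ, R * sin φ]‖ ≤ H₀ := hH₀ _ hin
    have h2 := norm_fderiv_pointSource_le hκ (ne_source (y := y) hτ hmem) !₂[cos φ, sin φ]
    rw [norm_plane_cos_sin, mul_one] at h2
    have h3 := h2.trans (mul_le_mul_of_nonneg_left (hH₁ _ hin) hκ.le)
    have h4 := hM _ hmem (by rw [sub_zero, norm_plane_polar hR0.le])
    have h5 := hB φ hφ'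
    rw [norm_mul, Complex.norm_of_nonneg hR0.le, greenForm_apply]
    refine mul_le_mul_of_nonneg_left ((norm_sub_le _ _).trans ?_) hR0.le
    rw [norm_mul, norm_mul]
    have : 0 ≤ H₀ := (norm_nonneg _).trans h1
    gcongr
  · refine Eventually.of_forall fun φ hφ => ?_
    rw [Set.uIoc_of_le pi_pos.le] at hφ
    have hφ' : φ ∈ Set.Icc 0 π := ⟨hφ.1.le, hφ.2⟩
    have hpos : ∀ τ : ℝ, 0 ≤ τ → 0 < ‖(!₂[R * cos φ, R * sin φ] : Plane) - !₂[y, -τ]‖ :=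
      fun τ hτ => (by linarith : 0 < R - y).trans_le (le_norm_sub_source hR0 hφ' hy hτ)
    have hne : ∀ τ : ℝ, 0 ≤ τ → (!₂[R * cos φ, R * sin φ] : Plane) ≠ !₂[y, -τ] :=
      fun τ hτ => sub_ne_zero.1 (norm_pos_iff.1 (hpos τ hτ))
    have hrc : Continuous fun τ : ℝ => ‖(!₂[R * cos φ, R * sin φ] : Plane) - !₂[y, -τ]‖ := by
      simp_rw [norm_sub_source]; fun_prop
    have hr0 := hrc.tendsto 0
    have hh : ∀ n, Tendsto (fun τ : ℝ =>
        hankel n (κ * ‖(!₂[R * cos φ, R * sin φ] : Plane) - !₂[y, -τ]‖)) (𝓝 0)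
        (𝓝 (hankel n (κ * ‖(!₂[R * cos φ, R * sin φ] : Plane) - !₂[y, -0]‖))) := fun n =>
      (continuousAt_hankel n (mul_pos hκ (hpos 0 le_rfl))).tendsto.comp (hr0.const_mul κ)
    have hder : Tendsto (fun τ : ℝ => fderiv ℝ (pointSource κ !₂[y, -τ]) !₂[R * cos φ, R * sin φ]
        !₂[cos φ, sin φ]) (𝓝[>] 0) (𝓝 (fderiv ℝ (pointSource κ !₂[y, -0])
        !₂[R * cos φ, R * sin φ] !₂[cos φ, sin φ])) := by
      rw [fderiv_pointSource hκ (hne 0 le_rfl)]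
      have hlast : Tendsto (fun τ : ℝ => ((((!₂[R * cos φ, R * sin φ] : Plane) 0 -
          (!₂[y, -τ] : Plane) 0) * (!₂[cos φ, sin φ] : Plane) 0 +
          ((!₂[R * cos φ, R * sin φ] : Plane) 1 - (!₂[y, -τ] : Plane) 1) *
          (!₂[cos φ, sin φ] : Plane) 1 : ℝ) : ℂ)) (𝓝 0) (𝓝 _) :=
        Continuous.tendsto (by simp; fun_prop) 0
      have hmain := (((hh 1).const_mul (κ : ℂ)).div
        ((Complex.continuous_ofReal.tendsto _).comp hr0)
        (by simpa using (hpos 0 le_rfl).ne')).mul hlast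
      refine (hmain.mono_left nhdsWithin_le_nhds).congr' ?_
      filter_upwards [self_mem_nhdsWithin] with τ hτ
      rw [fderiv_pointSource hκ (hne τ (le_of_lt hτ))]
      rfl
    exact ((((hh 0).mono_left nhdsWithin_le_nhds).mul_const _).sub (hder.const_mul _)).const_mul _

/-- The trace representation at finite radius. -/
theorem trace_representation_arc (hκ : 0 < κ) (hu : NeumannField κ ε c u) (hy : 0 < y)
    (hy' : y < ε) {R : ℝ} (hR : ε < R) {B : ℝ}
    (hB : ∀ φ ∈ Set.Ioo 0 π, ‖fderiv ℝ u !₂[R * cos φ, R * sin φ] !₂[cos φ, sin φ]‖ ≤ B) :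
    π * u !₂[y, 0] + c * ∫ t in (0 : ℝ)..ε, hankel 0 (κ * |t - y|) = ∫ φ in (0 : ℝ)..π,
      R * greenForm u (pointSource κ !₂[y, -0]) !₂[R * cos φ, R * sin φ] !₂[cos φ, sin φ] := by
  have hε : 0 < ε := hy.trans hy'
  have h1 := tendsto_integral_arc hκ hu hy hy' hR hB
  have h2 := (tendsto_integral_source (ε := ε) (c := c) (y := y) hκ R).sub
    (tendsto_integral_poisson (y := y) (R := R) hκ (continuous_trace hu) (by linarith) (by linarith))
  have h3 : ∫ t in -R..R, hankel 0 (κ * |t - y|) * apertureData ε c t =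
      c * ∫ t in (0 : ℝ)..ε, hankel 0 (κ * |t - y|) := by
    rw [← intervalIntegral.integral_const_mul, intervalIntegral.integral_of_le (by linarith),
      intervalIntegral.integral_of_le hε.le, integral_Ioc_eq_integral_Ioo (x := 0),
      ← integral_indicator measurableSet_Ioc, ← integral_indicator measurableSet_Ioo]
    congr 1
    ext t
    by_cases ht : t ∈ Set.Ioo 0 ε
    · have ht' : t ∈ Set.Ioc (-R) R := ⟨by linarith [ht.1], by linarith [ht.2]⟩
      rw [Set.indicator_of_mem ht, Set.indicator_of_mem ht', apertureData, if_pos ⟨ht.1, ht.2⟩,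
        mul_comm]
    · rw [Set.indicator_of_notMem ht]
      refine Set.indicator_apply_eq_zero.2 fun _ => ?_
      rw [apertureData, if_neg (by simpa using ht), mul_zero]
  rw [h3] at h2
  refine tendsto_nhds_unique (f := fun τ : ℝ => ∫ φ in (0 : ℝ)..π,
      R * greenForm u (pointSource κ !₂[y, -τ]) !₂[R * cos φ, R * sin φ] !₂[cos φ, sin φ])
      (l := 𝓝[>] 0) ?_ h1
  have e : π * u !₂[y, 0] + c * ∫ t in (0 : ℝ)..ε, hankel 0 (κ * |t - y|) =
    c * (∫ t in (0 : ℝ)..ε, hankel 0 (κ * |t - y|)) - -π * u !₂[y, 0] := by ring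
  rw [e]
  refine h2.congr' ?_
  filter_upwards [self_mem_nhdsWithin] with τ hτ
  have hτ : 0 < τ := hτ
  have hg := testField_pointSource (y := y) hκ hτ
  rw [green_halfDisc hu hg hε hR hB]
  simp_rw [greenNormal_boundary]
  rw [intervalIntegral.integral_sub]
  · exact (intervalIntegrable_apertureData ε c (-R) R).continuousOn_mul
      hg.continuous_trace.continuousOn
  · exact ((continuous_trace hu).mul hg.continuous_trace_fderiv).intervalIntegrable _ _

end

/-! ### Growth at infinity and removal of the large arc -/

section

variable {κ ε : ℝ} {c : ℂ} {u : Plane → ℂ} {y : ℝ}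

theorem Radiating.eventually_le (h : Radiating κ u) {δ : ℝ} (hδ : 0 < δ) :
    ∃ R₀ : ℝ, 0 < R₀ ∧ ∀ R φ : ℝ, R₀ ≤ R → φ ∈ Set.Ioo 0 π →
      ‖fderiv ℝ u !₂[R * cos φ, R * sin φ] !₂[cos φ, sin φ] -
        Complex.I * κ * u !₂[R * cos φ, R * sin φ]‖ ≤ δ / √R := by
  have h1 := Metric.tendsto_nhds.1 h δ hδ
  rw [eventually_inf_principal] at h1
  obtain ⟨r, hr⟩ := (Filter.hasBasis_cobounded_norm.eventually_iff).1 h1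
  refine ⟨max r 1, by positivity, fun R φ hR hφ => ?_⟩
  have hR0 : 0 < R := by linarith [le_max_right r 1]
  have hmem : (!₂[R * cos φ, R * sin φ] : Plane) ∈ upperHalf := by
    have := mul_pos hR0 (sin_pos_of_pos_of_lt_pi hφ.1 hφ.2)
    simpa [upperHalf] using this
  have h2 := hr.2 (x := !₂[R * cos φ, R * sin φ])
    (by simp only [Set.mem_ofPred_eq, norm_plane_polar hR0.le]; exact (le_max_left r 1).trans hR) hmem
  have e : R⁻¹ • (!₂[R * cos φ, R * sin φ] : Plane) = !₂[cos φ, sin φ] := by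
    ext i; fin_cases i <;> simp [hR0.ne']
  rw [dist_zero_right, norm_mul, norm_plane_polar hR0.le, e, Complex.norm_real,
    Real.norm_of_nonneg (Real.sqrt_nonneg _)] at h2
  have hs : 0 < √R := Real.sqrt_pos.2 hR0
  rw [le_div_iff₀ hs, mul_comm]
  exact h2.le

/-- A radiating field is `o(√r)`. -/
theorem NeumannField.growth (hu : NeumannField κ ε c u) (h : Radiating κ u) {δ : ℝ} (hδ : 0 < δ) :
    ∃ R₀ M : ℝ, 0 < R₀ ∧ 0 ≤ M ∧ ∀ R φ : ℝ, R₀ ≤ R → φ ∈ Set.Ioo 0 π →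
      ‖u !₂[R * cos φ, R * sin φ]‖ ≤ M + 2 * δ * √R := by
  obtain ⟨R₀, hR₀, hrad⟩ := h.eventually_le hδ
  obtain ⟨M, hM0, hM⟩ := hu.exists_bound 0 R₀
  refine ⟨R₀, M, hR₀, hM0, fun R φ hR hφ => ?_⟩
  have hmem : ∀ s, 0 < s → (!₂[s * cos φ, s * sin φ] : Plane) ∈ upperHalf := by
    intro s hs
    have := mul_pos hs (sin_pos_of_pos_of_lt_pi hφ.1 hφ.2)
    simpa [upperHalf] using this
  -- The factor exp(-iκs) makes the Sommerfeld expression an exact derivative along the ray; its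
  -- modulus is at most δ/√s, whose primitive is 2δ√s.
  set w : ℝ → ℂ := fun s => Complex.exp (-(Complex.I * κ) * s) * u !₂[s * cos φ, s * sin φ]
    with hw
  set w' : ℝ → ℂ := fun s => Complex.exp (-(Complex.I * κ) * s) *
    (fderiv ℝ u !₂[s * cos φ, s * sin φ] !₂[cos φ, sin φ] -
        Complex.I * κ * u !₂[s * cos φ, s * sin φ]) with hw'
  have hnorm : ∀ s : ℝ, ‖Complex.exp (-(Complex.I * κ) * s)‖ = 1 := by
    intro s; rw [Complex.norm_exp]; simp
  have hpos : ∀ s ∈ Set.uIcc R₀ R, 0 < s := fun s hs => by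
    rw [Set.uIcc_of_le hR] at hs; exact hR₀.trans_le hs.1
  have hpath : ∀ s, HasDerivAt (fun s => (!₂[s * cos φ, s * sin φ] : Plane)) !₂[cos φ, sin φ] s := by
    intro s
    have h1 : HasDerivAt (fun s => s * cos φ) (cos φ) s := by
      simpa using (hasDerivAt_id s).mul_const (cos φ)
    have h2 : HasDerivAt (fun s => s * sin φ) (sin φ) s := by
      simpa using (hasDerivAt_id s).mul_const (sin φ)
    exact hasDerivAt_plane h1 h2
  have hd : ∀ s ∈ Set.uIcc R₀ R, HasDerivAt w (w' s) s := by
    intro s hs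
    have h1 := ((hu.contDiffAt _ (hmem s (hpos s hs))).differentiableAt
      (by norm_num)).hasFDerivAt.comp_hasDerivAt s (hpath s)
    have h2 : HasDerivAt (fun s : ℝ => Complex.exp (-(Complex.I * κ) * s))
        (Complex.exp (-(Complex.I * κ) * s) * (-(Complex.I * κ))) s := by
      have := ((Complex.ofRealCLM.hasDerivAt (x := s)).const_mul (-(Complex.I * κ))).cexp
      simpa using this
    refine (h2.mul h1).congr_deriv ?_
    simp only [hw', Function.comp_apply]
    ring
  have hc : ContinuousOn w' (Set.uIcc R₀ R) := by
    intro s hs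
    apply ContinuousAt.continuousWithinAt
    have hm := hu.contDiffAt _ (hmem s (hpos s hs))
    have h1 : ContinuousAt (fun s : ℝ => fderiv ℝ u !₂[s * cos φ, s * sin φ]) s :=
      ContinuousAt.comp (f := fun s : ℝ => (!₂[s * cos φ, s * sin φ] : Plane))
        (contDiffAt_fderiv hm).continuousAt (hpath s).continuousAt
    have h2 : ContinuousAt (fun s : ℝ => u !₂[s * cos φ, s * sin φ]) s :=
      ContinuousAt.comp (f := fun s : ℝ => (!₂[s * cos φ, s * sin φ] : Plane))
        hm.continuousAt (hpath s).continuousAt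
    exact ContinuousAt.mul (by fun_prop)
      ((h1.clm_apply continuousAt_const).sub (continuousAt_const.mul h2))
  have hFTC := intervalIntegral.integral_eq_sub_of_hasDerivAt hd hc.intervalIntegrable
  have hd2 : ∀ s ∈ Set.uIcc R₀ R, HasDerivAt (fun s => 2 * δ * √s) (δ / √s) s := by
    intro s hs
    have h1 := (Real.hasDerivAt_sqrt (hpos s hs).ne').const_mul (2 * δ)
    refine h1.congr_deriv ?_
    have := Real.sqrt_pos.2 (hpos s hs)
    field_simp
  have hc2 : ContinuousOn (fun s : ℝ => δ / √s) (Set.uIcc R₀ R) := by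
    intro s hs
    have := (Real.sqrt_pos.2 (hpos s hs)).ne'
    apply ContinuousAt.continuousWithinAt
    fun_prop (disch := exact this)
  have hFTC2 := intervalIntegral.integral_eq_sub_of_hasDerivAt hd2 hc2.intervalIntegrable
  have hle : ‖∫ s in R₀..R, w' s‖ ≤ ∫ s in R₀..R, δ / √s := by
    refine intervalIntegral.norm_integral_le_of_norm_le hR (Eventually.of_forall fun s hs => ?_)
      hc2.intervalIntegrable
    simp only [hw', norm_mul, hnorm, one_mul]
    exact hrad s φ hs.1.le hφ
  rw [hFTC, hFTC2] at hle
  have h1 : ‖w R‖ ≤ ‖w R₀‖ + ‖w R - w R₀‖ := by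
    have := norm_add_le (w R₀) (w R - w R₀)
    simpa using this
  have h2 : ‖w R₀‖ ≤ M := by
    simp only [hw, norm_mul, hnorm, one_mul]
    exact hM _ (upperHalf_subset (hmem R₀ hR₀)) (by rw [sub_zero, norm_plane_polar hR₀.le])
  have h3 : ‖w R‖ = ‖u !₂[R * cos φ, R * sin φ]‖ := by
    simp only [hw, norm_mul, hnorm, one_mul]
  rw [← h3]
  have : 0 ≤ 2 * δ * √R₀ := by positivity
  linarith

/-- Far-field bounds for a point source, uniform in direction. -/
theorem exists_pointSource_far (hκ : 0 < κ) (hy : 0 < y) :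
    ∃ C : ℝ, 0 ≤ C ∧ ∀ R φ : ℝ, 2 * y ≤ R → φ ∈ Set.Icc 0 π →
      ‖pointSource κ !₂[y, -0] !₂[R * cos φ, R * sin φ]‖ ≤ C / √R ∧
      ‖fderiv ℝ (pointSource κ !₂[y, -0]) !₂[R * cos φ, R * sin φ] !₂[cos φ, sin φ] -
        Complex.I * κ * pointSource κ !₂[y, -0] !₂[R * cos φ, R * sin φ]‖ ≤ C / (R * √R) := by
  have hG1 : 0 < Real.Gamma (1 / 2) := Real.Gamma_pos_of_pos (by norm_num)
  have hG3 : 0 < Real.Gamma (3 / 2) := Real.Gamma_pos_of_pos (by norm_num)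
  set q : ℝ := √(2 / κ) with hq
  have hq0 : 0 ≤ q := Real.sqrt_nonneg _
  set C₁ : ℝ := Real.Gamma (1 / 2) * q with hC₁
  set C₂ : ℝ := κ * (Real.Gamma (3 / 2) * (2 / κ * q)) + κ * C₁ * (4 * y) with hC₂
  have hC₁0 : 0 ≤ C₁ := by positivity
  have hC₂0 : 0 ≤ C₂ := by positivity
  refine ⟨C₁ + C₂, by positivity, fun R φ hR hφ => ?_⟩
  have hR0 : 0 < R := by linarith
  have hsR : 0 < √R := Real.sqrt_pos.2 hR0
  set x : Plane := !₂[R * cos φ, R * sin φ] with hx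
  set z : Plane := !₂[y, -0] with hz
  set r : ℝ := ‖x - z‖ with hr
  have hr1 : R - y ≤ r := le_norm_sub_source hR0 hφ hy le_rfl
  have hr2 : r ≤ R + y + 0 := norm_sub_source_le hR0 hy le_rfl
  have hrR : R / 2 ≤ r := by linarith
  have hr0 : 0 < r := by linarith
  have hne : x ≠ z := sub_ne_zero.1 (norm_pos_iff.1 hr0)
  have hinv : 1 / (κ * r) ≤ 2 / κ / R := by
    rw [div_div, div_le_div_iff₀ (by positivity) (by positivity)]
    nlinarith
  have hhalf : (1 / (κ * r)) ^ (1 / 2 : ℝ) ≤ q / √R := by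
    rw [← Real.sqrt_eq_rpow, hq, ← Real.sqrt_div (by positivity)]
    exact Real.sqrt_le_sqrt hinv
  have hthree : (1 / (κ * r)) ^ (3 / 2 : ℝ) ≤ 2 / κ * q / (R * √R) := by
    have e : (1 / (κ * r)) ^ (3 / 2 : ℝ) = (1 / (κ * r)) * (1 / (κ * r)) ^ (1 / 2 : ℝ) := by
      have : (3 / 2 : ℝ) = 1 + 1 / 2 := by norm_num
      rw [this, rpow_add (by positivity), rpow_one]
    rw [e]
    calc (1 / (κ * r)) * (1 / (κ * r)) ^ (1 / 2 : ℝ) ≤ (2 / κ / R) * (q / √R) := by gcongr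
      _ = _ := by field_simp
  have h0 : ‖hankel 0 (κ * r)‖ ≤ C₁ / √R := by
    refine (norm_hankel_zero_le (mul_pos hκ hr0)).trans ?_
    rw [hC₁, mul_div_assoc]
    gcongr
  have h1 : ‖hankel 1 (κ * r) - Complex.I * hankel 0 (κ * r)‖ ≤
      Real.Gamma (3 / 2) * (2 / κ * q) / (R * √R) := by
    refine (norm_hankel_one_sub_le (mul_pos hκ hr0)).trans ?_
    rw [mul_div_assoc]
    gcongr
  refine ⟨h0.trans (by gcongr; linarith), ?_⟩
  have hin : (x 0 - z 0) * cos φ + (x 1 - z 1) * sin φ = R - y * cos φ := by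
    simp only [hx, hz, PiLp.toLp_apply, Matrix.cons_val_zero, Matrix.cons_val_one, neg_zero,
      sub_zero]
    linear_combination R * sin_sq_add_cos_sq φ
  -- The cosine of the angle between the ray and the direction from the source. It differs from 1 by
  -- O(y/R), so changing the centre from the source to the origin costs only O(R^(-3/2)).
  set β : ℝ := (R - y * cos φ) / r with hβ
  have hcos := abs_le.1 (abs_cos_le_one φ)
  have hβ1 : |β - 1| ≤ 4 * y / R := by
    have e : β - 1 = (R - y * cos φ - r) / r := by rw [hβ]; field_simp
    rw [e, abs_div, abs_of_pos hr0, div_le_div_iff₀ hr0 hR0]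
    have : |R - y * cos φ - r| ≤ 2 * y := abs_le.2 ⟨by nlinarith, by nlinarith⟩
    nlinarith
  have hβ0 : |β| ≤ 1 := by
    have h2 := norm_innerForm_le (x - z) !₂[cos φ, sin φ]
    rw [innerForm_apply, norm_plane_cos_sin, mul_one, Complex.norm_real, Real.norm_eq_abs] at h2
    have h3 : |R - y * cos φ| ≤ r := by
      rw [← hin]; exact h2
    rw [hβ, abs_div, abs_of_pos hr0]
    exact (div_le_one hr0).2 h3
  have hr' : (r : ℂ) ≠ 0 := by exact_mod_cast hr0.ne'
  have e : fderiv ℝ (pointSource κ z) x !₂[cos φ, sin φ] -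
      Complex.I * κ * pointSource κ z x =
      κ * (hankel 1 (κ * r) - Complex.I * hankel 0 (κ * r)) * (β : ℂ) +
      Complex.I * κ * hankel 0 (κ * r) * ((β - 1 : ℝ) : ℂ) := by
    rw [fderiv_pointSource hκ hne]
    have e2 : (((x 0 - z 0) * (!₂[cos φ, sin φ] : Plane) 0 +
        (x 1 - z 1) * (!₂[cos φ, sin φ] : Plane) 1 : ℝ) : ℂ) = (β : ℂ) * r := by
      rw [← Complex.ofReal_mul]
      congr 1
      rw [hβ, div_mul_cancel₀ _ hr0.ne', ← hin]
      simp
    have e3 : pointSource κ z x = hankel 0 (κ * r) := rfl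
    rw [e2, e3, ← hr]
    push_cast
    field_simp
    ring
  rw [e]
  refine (norm_add_le _ _).trans ?_
  simp only [norm_mul, Complex.norm_I, one_mul, Complex.norm_real, Real.norm_eq_abs,
    abs_of_pos hκ]
  have hA : κ * ‖hankel 1 (κ * r) - Complex.I * hankel 0 (κ * r)‖ * |β| ≤
      κ * (Real.Gamma (3 / 2) * (2 / κ * q) / (R * √R)) * 1 := by gcongr
  have hBd : κ * ‖hankel 0 (κ * r)‖ * |β - 1| ≤ κ * (C₁ / √R) * (4 * y / R) := by gcongr
  have hsum : κ * (Real.Gamma (3 / 2) * (2 / κ * q) / (R * √R)) * 1 +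
      κ * (C₁ / √R) * (4 * y / R) = C₂ / (R * √R) := by
    rw [hC₂]; field_simp
  have hfin : C₂ / (R * √R) ≤ (C₁ + C₂) / (R * √R) := by gcongr; linarith
  linarith

/-- The trace of a radiating field on the aperture is the potential of its Neumann datum. -/
theorem trace_representation (hκ : 0 < κ) (hu : NeumannField κ ε c u) (h : Radiating κ u)
    (hy : 0 < y) (hy' : y < ε) :
    π * u !₂[y, 0] + c * ∫ t in (0 : ℝ)..ε, hankel 0 (κ * |t - y|) = 0 := by
  obtain ⟨C, hC0, hC⟩ := exists_pointSource_far hκ hy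
  rw [← norm_le_zero_iff]
  refine le_of_forall_pos_le_add fun δ' hδ' => ?_
  rw [zero_add]
  -- The arc will contribute at most 4πCδ; the added 1 avoids a zero denominator.
  set δ : ℝ := δ' / (π * (4 * C + 1)) with hδ
  have hδ0 : 0 < δ := by have := pi_pos; positivity
  obtain ⟨R₁, hR₁, hrad⟩ := h.eventually_le hδ0
  obtain ⟨R₂, M, hR₂, hM0, hgrow⟩ := hu.growth h hδ0
  -- The radius exceeds the thresholds for radiation and growth, is at least 2ε so that the
  -- far-field bounds hold, and at least (M/δ)² so that M ≤ δ√R.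
  set R : ℝ := max (max R₁ R₂) (max (2 * ε) ((M / δ) ^ 2)) with hR
  have hRR₁ : R₁ ≤ R := (le_max_left _ _).trans (le_max_left _ _)
  have hRR₂ : R₂ ≤ R := (le_max_right _ _).trans (le_max_left _ _)
  have hRε : 2 * ε ≤ R := (le_max_left _ _).trans (le_max_right _ _)
  have hRM : (M / δ) ^ 2 ≤ R := (le_max_right _ _).trans (le_max_right _ _)
  have hR0 : 0 < R := by linarith
  have hs : 0 < √R := Real.sqrt_pos.2 hR0
  have hss : √R * √R = R := Real.mul_self_sqrt hR0.le
  have hMs : M ≤ δ * √R := by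
    have : M / δ ≤ √R := Real.le_sqrt_of_sq_le hRM
    rwa [div_le_iff₀ hδ0, mul_comm] at this
  have hub : ∀ φ ∈ Set.Ioo 0 π, ‖u !₂[R * cos φ, R * sin φ]‖ ≤ 3 * δ * √R := fun φ hφ => by
    have := hgrow R φ hRR₂ hφ
    linarith
  have hB : ∀ φ ∈ Set.Ioo 0 π, ‖fderiv ℝ u !₂[R * cos φ, R * sin φ] !₂[cos φ, sin φ]‖ ≤
      δ / √R + κ * (3 * δ * √R) := by
    intro φ hφ
    have h1 := hrad R φ hRR₁ hφ
    have h2 := norm_add_le (fderiv ℝ u !₂[R * cos φ, R * sin φ] !₂[cos φ, sin φ] -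
        Complex.I * κ * u !₂[R * cos φ, R * sin φ]) (Complex.I * κ * u !₂[R * cos φ, R * sin φ])
    rw [sub_add_cancel, norm_mul, norm_mul, Complex.norm_I, one_mul,
      Complex.norm_of_nonneg hκ.le] at h2
    have h3 := mul_le_mul_of_nonneg_left (hub φ hφ) hκ.le
    linarith
  rw [trace_representation_arc hκ hu hy hy' (by linarith : ε < R) hB]
  have hne : ∀ᵐ φ : ℝ, φ ≠ π := by simp [ae_iff, measure_singleton]
  have hbound : ‖∫ φ in (0 : ℝ)..π, R * greenForm u (pointSource κ !₂[y, -0])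
      !₂[R * cos φ, R * sin φ] !₂[cos φ, sin φ]‖ ≤ ∫ φ in (0 : ℝ)..π, 4 * C * δ := by
    refine intervalIntegral.norm_integral_le_of_norm_le pi_pos.le ?_ intervalIntegrable_const
    filter_upwards [hne] with φ hφπ hφ
    have hφ' : φ ∈ Set.Ioo 0 π := ⟨hφ.1, lt_of_le_of_ne hφ.2 hφπ⟩
    obtain ⟨hg1, hg2⟩ := hC R φ (by linarith) ⟨hφ.1.le, hφ.2⟩
    have h1 := hrad R φ hRR₁ hφ'
    have h2 := hub φ hφ'
    -- Subtracting iκUG from both products leaves only Sommerfeld defects: C/√R · δ/√R and 3δ√R ·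
    -- C/(R√R), which multiplied by R add up to 4Cδ.
    have e : ∀ G Ur U Gr : ℂ, R * (G * Ur - U * Gr) =
        R * (G * (Ur - Complex.I * κ * U) - U * (Gr - Complex.I * κ * G)) := by
      intros; ring
    rw [greenForm_apply, e, norm_mul, Complex.norm_of_nonneg hR0.le]
    have h3 := norm_sub_le (pointSource κ !₂[y, -0] !₂[R * cos φ, R * sin φ] *
      (fderiv ℝ u !₂[R * cos φ, R * sin φ] !₂[cos φ, sin φ] -
        Complex.I * κ * u !₂[R * cos φ, R * sin φ])) (u !₂[R * cos φ, R * sin φ] *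
      (fderiv ℝ (pointSource κ !₂[y, -0]) !₂[R * cos φ, R * sin φ] !₂[cos φ, sin φ] -
        Complex.I * κ * pointSource κ !₂[y, -0] !₂[R * cos φ, R * sin φ]))
    rw [norm_mul, norm_mul] at h3
    have h4 := h3.trans (add_le_add (mul_le_mul hg1 h1 (norm_nonneg _) (by positivity))
      (mul_le_mul h2 hg2 (norm_nonneg _) (by positivity)))
    refine (mul_le_mul_of_nonneg_left h4 hR0.le).trans (le_of_eq ?_)
    have e1 : C / √R * (δ / √R) = C * δ / R := by rw [div_mul_div_comm, hss]
    rw [e1]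
    field_simp
    ring
  refine hbound.trans ?_
  rw [intervalIntegral.integral_const, sub_zero, smul_eq_mul]
  have e : π * (4 * C + 1) * δ = δ' := by
    rw [hδ]; have := pi_pos; field_simp
  have := mul_pos pi_pos hδ0
  linarith

end

/-! ### The scattered field -/

/-- The plane wave with wave vector `p`. -/
def planeWave (p x : Plane) : ℂ := Complex.exp (Complex.I * innerForm p x)

theorem hasFDerivAt_planeWave (p x : Plane) :
    HasFDerivAt (planeWave p) ((planeWave p x * Complex.I) • innerForm p) x := by
  have h := (((innerForm p).hasFDerivAt (x := x)).const_mul Complex.I).cexp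
  refine h.congr_fderiv ?_
  ext e
  simp [planeWave, mul_assoc]

theorem contDiff_planeWave (p : Plane) : ContDiff ℝ 2 (planeWave p) :=
  (contDiff_const.mul (innerForm p).contDiff).cexp

theorem helmholtz_planeWave (p x : Plane) :
    Δ (planeWave p) x + ((p 0 ^ 2 + p 1 ^ 2 : ℝ) : ℂ) * planeWave p x = 0 := by
  have h1 : fderiv ℝ (planeWave p) = fun x => (planeWave p x * Complex.I) • innerForm p :=
    funext fun x => (hasFDerivAt_planeWave p x).fderiv
  have h2 := ((hasFDerivAt_planeWave p x).mul_const Complex.I).smul_const (innerForm p)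
  rw [laplacian_plane, h1, h2.fderiv]
  simp only [ContinuousLinearMap.smulRight_apply, smul_apply, innerForm_apply, smul_eq_mul]
  simp
  linear_combination (((p 0 : ℂ)) ^ 2 + (p 1 : ℂ) ^ 2) * planeWave p x * Complex.I_sq

theorem uInc_eq (κ θ : ℝ) : uInc κ θ = planeWave !₂[κ * sin θ, -(κ * cos θ)] := by
  ext x
  rw [uInc, planeWave, innerForm_apply]
  congr 3
  simp
  ring

theorem uRef_eq (κ θ : ℝ) : uRef κ θ = planeWave !₂[κ * sin θ, κ * cos θ] := by
  ext x
  rw [uRef, planeWave, innerForm_apply]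
  congr 3
  simp
  ring

theorem contDiff_background (κ θ : ℝ) : ContDiff ℝ 2 (uInc κ θ + uRef κ θ) := by
  rw [uInc_eq, uRef_eq]
  exact (contDiff_planeWave _).add (contDiff_planeWave _)

theorem helmholtz_background (κ θ : ℝ) (x : Plane) :
    Δ (uInc κ θ + uRef κ θ) x + (κ : ℂ) ^ 2 * (uInc κ θ + uRef κ θ) x = 0 := by
  have h1 : ∀ s : ℝ, s = κ * cos θ ∨ s = -(κ * cos θ) →
      Δ (planeWave !₂[κ * sin θ, s]) x + (κ : ℂ) ^ 2 * planeWave !₂[κ * sin θ, s] x = 0 := by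
    intro s hs
    have h := helmholtz_planeWave !₂[κ * sin θ, s] x
    have e : (!₂[κ * sin θ, s] : Plane) 0 ^ 2 + (!₂[κ * sin θ, s] : Plane) 1 ^ 2 = κ ^ 2 := by
      have : (κ * sin θ) ^ 2 + s ^ 2 = κ ^ 2 := by
        rcases hs with rfl | rfl <;> linear_combination κ ^ 2 * sin_sq_add_cos_sq θ
      simpa using this
    rw [e] at h
    push_cast at h
    exact h
  rw [uInc_eq, uRef_eq, (contDiff_planeWave _).contDiffAt.laplacian_add
    (contDiff_planeWave _).contDiffAt, Pi.add_apply]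
  linear_combination h1 _ (Or.inr rfl) + h1 _ (Or.inl rfl)

theorem fderiv_background (κ θ : ℝ) (x : Plane) :
    fderiv ℝ (uInc κ θ + uRef κ θ) x !₂[0, 1] =
      Complex.I * (κ * cos θ) * (uRef κ θ x - uInc κ θ x) := by
  rw [uInc_eq, uRef_eq, ((hasFDerivAt_planeWave _ x).add (hasFDerivAt_planeWave _ x)).fderiv]
  simp only [add_apply, smul_apply, innerForm_apply, smul_eq_mul]
  simp
  ring

theorem background_trace (κ θ t : ℝ) :
    uInc κ θ !₂[t, 0] + uRef κ θ !₂[t, 0] = 2 * Complex.exp (Complex.I * (κ * (t * sin θ) : ℝ)) := by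
  simp only [uInc, uRef]
  simp
  ring

theorem tendsto_fderiv_background (κ θ a : ℝ) :
    Tendsto (fun x : Plane => fderiv ℝ (uInc κ θ + uRef κ θ) x !₂[0, 1])
      (𝓝[upperHalf] !₂[a, 0]) (𝓝 0) := by
  simp_rw [fderiv_background]
  have hi : Continuous (uInc κ θ) := by rw [uInc_eq]; exact (contDiff_planeWave _).continuous
  have hr : Continuous (uRef κ θ) := by rw [uRef_eq]; exact (contDiff_planeWave _).continuous
  have hc : Continuous fun x : Plane => Complex.I * (κ * cos θ) * (uRef κ θ x - uInc κ θ x) := by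
    fun_prop
  have h := hc.tendsto !₂[a, 0]
  have e : Complex.I * (κ * cos θ) * (uRef κ θ !₂[a, 0] - uInc κ θ !₂[a, 0]) = 0 := by
    simp [uInc, uRef]
  rw [e] at h
  exact h.mono_left nhdsWithin_le_nhds

/-- The incident and reflected waves have opposite normal derivatives on the plane, so subtracting
them leaves the Neumann data unchanged. The datum is constant on the aperture and is evaluated at 0.
-/
theorem IsApproxSolution.neumannField {κ θ ε d : ℝ} {v : Plane → ℂ}
    (hv : IsApproxSolution κ θ ε d v) :
    NeumannField κ ε (dtn0 κ ε d v 0) (scattered κ θ v) := by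
  have hs : scattered κ θ v = v - (uInc κ θ + uRef κ θ) := rfl
  have hvc : ∀ x ∈ upperHalf, ContDiffAt ℝ 2 v x := fun x hx =>
    hv.contDiffOn.contDiffAt (isOpen_upperHalf.mem_nhds hx)
  have hbc := contDiff_background κ θ
  refine ⟨fun x hx => ?_, ?_, fun x hx => ?_, fun a h0 hε => ?_⟩
  · rw [hs]; exact (hvc x hx).sub hbc.contDiffAt
  · rw [hs]; exact hv.continuousOn.sub hbc.continuous.continuousOn
  · rw [hs, (hvc x hx).laplacian_sub hbc.contDiffAt, Pi.sub_apply]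
    linear_combination hv.helmholtz x hx - helmholtz_background κ θ x
  · have hT : Tendsto (fun x : Plane => fderiv ℝ v x !₂[0, 1]) (𝓝[upperHalf] !₂[a, 0])
        (𝓝 (apertureData ε (dtn0 κ ε d v 0) a)) := by
      by_cases ha : 0 < a ∧ a < ε
      · rw [apertureData, if_pos ha]
        exact hv.aperture a ha.1 ha.2
      · rw [apertureData, if_neg ha]
        refine hv.neumann a ?_
        rcases lt_or_gt_of_ne h0 with h | h
        · exact Or.inl h
        · exact Or.inr (lt_of_le_of_ne (not_lt.1 fun h' => ha ⟨h, h'⟩) hε.symm)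
    have h2 := hT.sub (tendsto_fderiv_background κ θ a)
    rw [sub_zero] at h2
    refine h2.congr' ?_
    filter_upwards [self_mem_nhdsWithin] with x hx
    rw [hs, fderiv_sub ((hvc x hx).differentiableAt (by norm_num))
      (hbc.contDiffAt.differentiableAt (by norm_num))]
    rfl

/-! ### The field in the cavity -/

theorem cexp_two_mul_add_one (x : ℝ) :
    Complex.exp (2 * Complex.I * x) + 1 = 2 * (cos x : ℝ) * Complex.exp (Complex.I * x) := by
  have e : (2 * Complex.I * x : ℂ) = Complex.I * x + Complex.I * x := by ring
  have e' : Complex.exp (Complex.I * x) = (cos x : ℝ) + (sin x : ℝ) * Complex.I := by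
    rw [mul_comm, Complex.exp_mul_I]; push_cast; rfl
  have h : ((sin x : ℝ) : ℂ) ^ 2 + ((cos x : ℝ) : ℂ) ^ 2 = 1 := by
    exact_mod_cast sin_sq_add_cos_sq x
  rw [e, Complex.exp_add, e']
  linear_combination ((sin x : ℝ) : ℂ) ^ 2 * Complex.I_sq - h

theorem cexp_two_mul_sub_one (x : ℝ) :
    Complex.exp (2 * Complex.I * x) - 1 =
      2 * Complex.I * (sin x : ℝ) * Complex.exp (Complex.I * x) := by
  have e : (2 * Complex.I * x : ℂ) = Complex.I * x + Complex.I * x := by ring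
  have e' : Complex.exp (Complex.I * x) = (cos x : ℝ) + (sin x : ℝ) * Complex.I := by
    rw [mul_comm, Complex.exp_mul_I]; push_cast; rfl
  have h : ((sin x : ℝ) : ℂ) ^ 2 + ((cos x : ℝ) : ℂ) ^ 2 = 1 := by
    exact_mod_cast sin_sq_add_cos_sq x
  rw [e, Complex.exp_add, e']
  linear_combination -((sin x : ℝ) : ℂ) ^ 2 * Complex.I_sq + h

theorem modeCoeff_eq (ε : ℝ) (v : Plane → ℂ) (h : ℝ) :
    modeCoeff ε v h = (∫ t in (0 : ℝ)..ε, v !₂[t, h]) * ((1 / √ε : ℝ) : ℂ) := by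
  simp only [modeCoeff, phi0]
  rw [intervalIntegral.integral_mul_const]

theorem inv_sqrt_mul_self {ε : ℝ} (hε : 0 < ε) :
    (((1 / √ε : ℝ) : ℂ)) * ((1 / √ε : ℝ) : ℂ) = ((1 / ε : ℝ) : ℂ) := by
  rw [← Complex.ofReal_mul, div_mul_div_comm, Real.mul_self_sqrt hε.le, one_mul]

/-- Factoring exp(iκd) out of numerator and denominator turns i(e^(2iκd)+1)/(e^(2iκd)-1) into the
real number cot(κd); the two modes contribute 1/ε. -/
theorem dtn0_eq {κ ε d : ℝ} (hε : 0 < ε) (hs : 0 < sin (κ * d)) (v : Plane → ℂ) (a : ℝ) :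
    dtn0 κ ε d v a = ((κ * cos (κ * d) / sin (κ * d) / ε : ℝ) : ℂ) *
      ∫ t in (0 : ℝ)..ε, v !₂[t, 0] := by
  have e : (2 * Complex.I * κ * d : ℂ) = 2 * Complex.I * ((κ * d : ℝ) : ℂ) := by push_cast; ring
  have hs' : ((sin (κ * d) : ℝ) : ℂ) ≠ 0 := by exact_mod_cast hs.ne'
  have hI := Complex.I_ne_zero
  have hε' : (ε : ℂ) ≠ 0 := by exact_mod_cast hε.ne'
  have hE := Complex.exp_ne_zero (Complex.I * ((κ * d : ℝ) : ℂ))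
  rw [dtn0, e, cexp_two_mul_add_one, cexp_two_mul_sub_one, modeCoeff_eq, phi0, mul_assoc,
    mul_assoc (∫ t in (0 : ℝ)..ε, v !₂[t, 0]), inv_sqrt_mul_self hε]
  generalize (∫ t in (0 : ℝ)..ε, v !₂[t, 0]) = S
  generalize Complex.exp (Complex.I * ((κ * d : ℝ) : ℂ)) = w at *
  simp only [Complex.ofReal_div, Complex.ofReal_mul, Complex.ofReal_one]
  field_simp

theorem IsApproxSolution.modeCoeff_bottom {κ θ ε d : ℝ} {v : Plane → ℂ} (hε : 0 < ε)
    (hv : IsApproxSolution κ θ ε d v) : modeCoeff ε v (-d) = 0 := by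
  have h : ∫ t in (0 : ℝ)..ε, v !₂[t, -d] = 0 := by
    rw [intervalIntegral.integral_of_le hε.le, integral_Ioc_eq_integral_Ioo]
    refine setIntegral_eq_zero_of_forall_eq_zero fun t ht => ?_
    exact hv.bottom_eq_zero _ (by simpa [bottom] using ht)
  rw [modeCoeff_eq, h, zero_mul]

/-- With vanishing bottom coefficient, the two exponentials form the sine that is zero at x₂ = -d,
normalized by its value at the aperture. -/
theorem IsApproxSolution.norm_cavity {κ θ ε d : ℝ} {v : Plane → ℂ} (hε : 0 < ε)
    (hs : 0 < sin (κ * d)) (hv : IsApproxSolution κ θ ε d v) {x : Plane} (hx : x ∈ cavity ε d) :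
    ‖v x‖ = ‖∫ t in (0 : ℝ)..ε, v !₂[t, 0]‖ / ε * |sin (κ * (x 1 + d)) / sin (κ * d)| := by
  have key : v x = (∫ t in (0 : ℝ)..ε, v !₂[t, 0]) * ((1 / ε : ℝ) : ℂ) *
      ((sin (κ * (x 1 + d)) / sin (κ * d) : ℝ) : ℂ) := by
    have e : (2 * Complex.I * κ * d : ℂ) = 2 * Complex.I * ((κ * d : ℝ) : ℂ) := by push_cast; ring
    have e2 : (Complex.I * κ * d : ℂ) = Complex.I * ((κ * d : ℝ) : ℂ) := by push_cast; ring
    have hs' : ((sin (κ * d) : ℝ) : ℂ) ≠ 0 := by exact_mod_cast hs.ne'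
    have hI := Complex.I_ne_zero
    have hE := Complex.exp_ne_zero (Complex.I * ((κ * d : ℝ) : ℂ))
    have e3 : Complex.exp (Complex.I * κ * (x 1 + d)) * Complex.exp (Complex.I * ((κ * d : ℝ) : ℂ)) -
        Complex.exp (-Complex.I * κ * x 1) = 2 * Complex.I * (sin (κ * (x 1 + d)) : ℝ) *
        Complex.exp (Complex.I * ((κ * d : ℝ) : ℂ)) := by
      have h1 := cexp_two_mul_sub_one (κ * (x 1 + d))
      have h2 : Complex.exp (-Complex.I * κ * x 1) =
          Complex.exp (-(Complex.I * ((κ * (x 1 + d) : ℝ) : ℂ))) *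
          Complex.exp (Complex.I * ((κ * d : ℝ) : ℂ)) := by
        rw [← Complex.exp_add]; congr 1; push_cast; ring
      have h3 : Complex.exp (Complex.I * κ * (x 1 + d)) =
          Complex.exp (2 * Complex.I * ((κ * (x 1 + d) : ℝ) : ℂ)) *
          Complex.exp (-(Complex.I * ((κ * (x 1 + d) : ℝ) : ℂ))) := by
        rw [← Complex.exp_add]; congr 1; push_cast; ring
      have h4 : Complex.exp (Complex.I * ((κ * (x 1 + d) : ℝ) : ℂ)) *
          Complex.exp (-(Complex.I * ((κ * (x 1 + d) : ℝ) : ℂ))) = 1 := by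
        rw [← Complex.exp_add, add_neg_cancel, Complex.exp_zero]
      rw [h3, h2]
      linear_combination Complex.exp (-(Complex.I * ((κ * (x 1 + d) : ℝ) : ℂ))) *
        Complex.exp (Complex.I * ((κ * d : ℝ) : ℂ)) * h1 +
        2 * Complex.I * (sin (κ * (x 1 + d)) : ℝ) *
        Complex.exp (Complex.I * ((κ * d : ℝ) : ℂ)) * h4
    rw [hv.cavity_eq x hx, hv.modeCoeff_bottom hε, alphaPlus, alphaMinus, e, e2,
      cexp_two_mul_sub_one, modeCoeff_eq, phi0, ← inv_sqrt_mul_self hε]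
    generalize (∫ t in (0 : ℝ)..ε, v !₂[t, 0]) = S at *
    generalize Complex.exp (Complex.I * ((κ * d : ℝ) : ℂ)) = w at *
    generalize ((1 / √ε : ℝ) : ℂ) = f at *
    generalize Complex.exp (Complex.I * κ * (x 1 + d)) = A at *
    generalize Complex.exp (-Complex.I * κ * x 1) = B at *
    rw [Complex.ofReal_div]
    have h5 : ((sin (κ * (x 1 + d)) : ℝ) : ℂ) = (A * w - B) / (2 * Complex.I * w) := by
      rw [e3]; field_simp
    rw [h5]
    field_simp
    ring
  rw [key, norm_mul, norm_mul, Complex.norm_real, Complex.norm_real, Real.norm_eq_abs,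
    Real.norm_eq_abs, abs_of_pos (by positivity : 0 < 1 / ε)]
  ring

/-! ### From pointwise bounds to L² norms on the cavity -/

theorem volume_cavity {ε d : ℝ} (hε : 0 ≤ ε) :
    volume (cavity ε d) = ENNReal.ofReal (ε * d) := by
  have h := EuclideanSpace.volume_preserving_symm_measurableEquiv_toLp (Fin 2)
  have e : cavity ε d = (MeasurableEquiv.toLp 2 (Fin 2 → ℝ)).symm ⁻¹'
      (Set.pi Set.univ ![Set.Ioo 0 ε, Set.Ioo (-d) 0]) := by
    ext x
    simp [cavity, Fin.forall_fin_two, and_assoc]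
  rw [e, h.measure_preimage_equiv, volume_pi_pi, Fin.prod_univ_two]
  simp only [Matrix.cons_val_zero, Matrix.cons_val_one, Real.volume_Ioo]
  rw [← ENNReal.ofReal_mul (by linarith)]
  congr 1
  ring

theorem measurableSet_cavity (ε d : ℝ) : MeasurableSet (cavity ε d) := by
  have : IsOpen (cavity ε d) := by
    have h0 : Continuous fun x : Plane => x 0 := by fun_prop
    have h1 : Continuous fun x : Plane => x 1 := by fun_prop
    exact (isOpen_lt continuous_const h0).inter ((isOpen_lt h0 continuous_const).inter
      ((isOpen_lt continuous_const h1).inter (isOpen_lt h1 continuous_const)))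
  exact this.measurableSet

theorem eLpNorm_le_of_norm_le {ε d C : ℝ} (hε : 0 ≤ ε) (hd : 0 ≤ d) {v : Plane → ℂ}
    (h : ∀ x ∈ cavity ε d, ‖v x‖ ≤ C) :
    eLpNorm v 2 (volume.restrict (cavity ε d)) ≤ ENNReal.ofReal (C * √(ε * d)) := by
  have h1 := eLpNorm_le_of_ae_bound (p := 2) (μ := volume.restrict (cavity ε d)) (f := v) (C := C)
    ((ae_restrict_iff' (measurableSet_cavity ε d)).2 (Eventually.of_forall h))
  refine h1.trans (le_of_eq ?_)
  rw [Measure.restrict_apply_univ, volume_cavity hε, mul_comm C,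
    ENNReal.ofReal_mul (p := √(ε * d)) (by positivity),
    Real.sqrt_eq_rpow, ← ENNReal.ofReal_rpow_of_nonneg (by positivity) (by norm_num)]
  norm_num

theorem le_eLpNorm_of_le_norm {ε d C : ℝ} (hε : 0 ≤ ε) (hd : 0 ≤ d) (hC : 0 ≤ C)
    {v : Plane → ℂ} (h : ∀ x ∈ cavity ε d, C ≤ ‖v x‖) :
    ENNReal.ofReal (C * √(ε * d)) ≤ eLpNorm v 2 (volume.restrict (cavity ε d)) := by
  have h1 : eLpNorm (fun _ : Plane => C) 2 (volume.restrict (cavity ε d)) ≤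
      eLpNorm v 2 (volume.restrict (cavity ε d)) := by
    refine eLpNorm_mono_ae ((ae_restrict_iff' (measurableSet_cavity ε d)).2
      (Eventually.of_forall fun x hx => ?_))
    rw [Real.norm_of_nonneg hC]
    exact h x hx
  refine le_trans (le_of_eq ?_) h1
  rw [eLpNorm_const' C (by norm_num) (by norm_num), Measure.restrict_apply_univ, volume_cavity hε,
    ENNReal.ofReal_mul hC, Real.sqrt_eq_rpow,
    ← ENNReal.ofReal_rpow_of_nonneg (by positivity) (by norm_num), Real.enorm_of_nonneg hC]
  norm_num

section

/-! ### The averaged equation on the aperture -/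

/-- The potential at `y` of the unit density on the aperture. -/
def aperturePotential (κ ε y : ℝ) : ℂ := ∫ t in (0 : ℝ)..ε, hankel 0 (κ * |t - y|)

/-- No integrability is required, since the integral of a non-integrable function is 0 by
convention. This allows integrating the potential in y without proving it measurable. -/
theorem re_integral_nonneg {α : Type*} [MeasurableSpace α] {μ : Measure α} {s : Set α}
    (hs : MeasurableSet s) {f : α → ℂ} (hf : ∀ᵐ x ∂μ, x ∈ s → 0 ≤ (f x).re) :
    0 ≤ (∫ x in s, f x ∂μ).re := by
  by_cases hi : IntegrableOn f s μ
  · have e : (∫ x in s, f x ∂μ).re = ∫ x in s, (f x).re ∂μ := (integral_re hi).symm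
    rw [e]
    exact integral_nonneg_of_ae ((ae_restrict_iff' hs).2 hf)
  · rw [integral_undef hi]; simp

theorem aperturePotential_re_nonneg {κ ε y : ℝ} (hκ : 0 < κ) (hκε : κ * ε ≤ π / 4) (hy : 0 < y)
    (hy' : y < ε) : 0 ≤ (aperturePotential κ ε y).re := by
  rw [aperturePotential, intervalIntegral.integral_of_le (by linarith)]
  refine re_integral_nonneg measurableSet_Ioc ?_
  have hne : ∀ᵐ t : ℝ, t ≠ y := by simp [ae_iff, measure_singleton]
  filter_upwards [hne] with t ht htm
  have habs : 0 < |t - y| := abs_pos.2 (sub_ne_zero.2 ht)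
  have hle : |t - y| ≤ ε := abs_le.2 ⟨by linarith [htm.1], by linarith [htm.2]⟩
  exact hankel_zero_re_nonneg (mul_pos hκ habs)
    ((mul_le_mul_of_nonneg_left hle hκ.le).trans hκε)

/-- This is log(ε/s) ≤ ε/s - 1 multiplied by s. Added for s = y and s = ε - y, it removes the
dependence on y. -/
theorem neg_mul_log_le {ε s : ℝ} (hε : 0 < ε) (hs : 0 < s) :
    -(s * Real.log s) ≤ -(s * Real.log ε) + (ε - s) := by
  have h := Real.log_le_sub_one_of_pos (div_pos hε hs)
  rw [Real.log_div hε.ne' hs.ne'] at h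
  have h2 := mul_le_mul_of_nonneg_left h hs.le
  have e : s * (ε / s - 1) = ε - s := by field_simp
  rw [e] at h2
  linarith

/-- The integral of -log|t-y| over the aperture is ε - y log y - (ε-y) log(ε-y), at most 2ε - ε log
ε; hence the constant 2. -/
theorem norm_aperturePotential_le {C : ℝ}
    (hC : ∀ r : ℝ, 0 < r → r ≤ 1 → ‖hankel 0 r‖ ≤ C + Real.log (1 / r)) {κ ε y : ℝ} (hκ : 0 < κ)
    (hκε : κ * ε ≤ 1) (hy : 0 < y) (hy' : y < ε) :
    ‖aperturePotential κ ε y‖ ≤ ε * (C + 2 + Real.log (1 / (κ * ε))) := by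
  have hε : 0 < ε := hy.trans hy'
  have hlog : IntervalIntegrable (fun t => Real.log (t - y)) volume 0 ε := by
    have := (intervalIntegral.intervalIntegrable_log' (a := 0 - y) (b := ε - y)).comp_sub_right y
    simpa using this
  have hle : ‖aperturePotential κ ε y‖ ≤
      ∫ t in (0 : ℝ)..ε, (C - Real.log κ - Real.log (t - y)) := by
    refine intervalIntegral.norm_integral_le_of_norm_le hε.le ?_
      (intervalIntegrable_const.sub hlog)
    have hne : ∀ᵐ t : ℝ, t ≠ y := by simp [ae_iff, measure_singleton]
    filter_upwards [hne] with t ht htm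
    have habs : 0 < |t - y| := abs_pos.2 (sub_ne_zero.2 ht)
    have hle : |t - y| ≤ ε := abs_le.2 ⟨by linarith [htm.1], by linarith [htm.2]⟩
    refine (hC _ (mul_pos hκ habs) ((mul_le_mul_of_nonneg_left hle hκ.le).trans hκε)).trans ?_
    rw [one_div, Real.log_inv, Real.log_mul hκ.ne' habs.ne', Real.log_abs]
    linarith
  refine hle.trans ?_
  rw [intervalIntegral.integral_sub intervalIntegrable_const hlog, intervalIntegral.integral_const,
    intervalIntegral.integral_comp_sub_right (fun s => Real.log s) y, integral_log, one_div,
    Real.log_inv, Real.log_mul hκ.ne' hε.ne', smul_eq_mul, zero_sub, Real.log_neg_eq_log]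
  have h1 := neg_mul_log_le hε hy
  have h2 := neg_mul_log_le hε (sub_pos.2 hy')
  nlinarith

variable {κ θ ε d : ℝ} {v : Plane → ℂ}

/-- The mean value of the field on the aperture satisfies a scalar linear equation. -/
theorem IsApproxSolution.aperture_equation (hκ : 0 < κ) (hε : 0 < ε) (hs : 0 < sin (κ * d))
    (hv : IsApproxSolution κ θ ε d v) :
    (∫ t in (0 : ℝ)..ε, v !₂[t, 0]) * (1 + ((κ * cos (κ * d) / sin (κ * d) / (π * ε) : ℝ) : ℂ) *
      ∫ y in (0 : ℝ)..ε, aperturePotential κ ε y) =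
      ∫ t in (0 : ℝ)..ε, 2 * Complex.exp (Complex.I * (κ * (t * sin θ) : ℝ)) := by
  have hN := hv.neumannField
  set c := dtn0 κ ε d v 0 with hc
  set w : ℝ → ℂ := fun t => 2 * Complex.exp (Complex.I * (κ * (t * sin θ) : ℝ)) with hw
  have hwc : Continuous w := by fun_prop
  have hvc : Continuous fun t : ℝ => v !₂[t, 0] :=
    hv.continuousOn.comp_continuous (f := fun t : ℝ => (!₂[t, 0] : Plane)) (by fun_prop)
      fun t => by simp [closedUpperHalf]
  -- The trace representation for the scattered field v - w, valid at interior points of the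
  -- aperture; integrating it in y gives the scalar equation.
  have hpt : ∀ y ∈ Set.Ioo 0 ε, c * aperturePotential κ ε y = -π * (v !₂[y, 0] - w y) := by
    intro y hy
    have h := trace_representation hκ hN hv.radiating hy.1 hy.2
    rw [scattered, background_trace] at h
    simp only [hw, aperturePotential]
    linear_combination h
  have hint : c * ∫ y in (0 : ℝ)..ε, aperturePotential κ ε y =
      -π * ((∫ t in (0 : ℝ)..ε, v !₂[t, 0]) - ∫ t in (0 : ℝ)..ε, w t) := by
    rw [← intervalIntegral.integral_sub (hvc.intervalIntegrable _ _) (hwc.intervalIntegrable _ _),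
      ← intervalIntegral.integral_const_mul, ← intervalIntegral.integral_const_mul,
      intervalIntegral.integral_of_le hε.le, intervalIntegral.integral_of_le hε.le,
      integral_Ioc_eq_integral_Ioo, integral_Ioc_eq_integral_Ioo]
    exact setIntegral_congr_fun measurableSet_Ioo hpt
  rw [hc, dtn0_eq hε hs] at hint
  have hπ : (π : ℂ) ≠ 0 := by exact_mod_cast pi_ne_zero
  have hε' : (ε : ℂ) ≠ 0 := by exact_mod_cast hε.ne'
  have e : ((κ * cos (κ * d) / sin (κ * d) / (π * ε) : ℝ) : ℂ) =
      ((κ * cos (κ * d) / sin (κ * d) / ε : ℝ) : ℂ) / π := by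
    rw [← Complex.ofReal_div]; congr 1; field_simp
  rw [e]
  generalize ((κ * cos (κ * d) / sin (κ * d) / ε : ℝ) : ℂ) = q at hint ⊢
  field_simp
  linear_combination hint

theorem norm_integral_background_le (hε : 0 < ε) :
    ‖∫ t in (0 : ℝ)..ε, 2 * Complex.exp (Complex.I * (κ * (t * sin θ) : ℝ))‖ ≤ 2 * ε := by
  have h := intervalIntegral.norm_integral_le_of_norm_le_const (a := 0) (b := ε) (C := 2)
    (f := fun t : ℝ => 2 * Complex.exp (Complex.I * (κ * (t * sin θ) : ℝ)))
    fun t _ => by rw [norm_mul, Complex.norm_exp_I_mul_ofReal]; simp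
  rwa [sub_zero, abs_of_pos hε] at h

/-- The phase is at most 1 in modulus, so its cosine is at least 1/2 and the real part of the
integrand at least 1. -/
theorem le_norm_integral_background (hκ : 0 < κ) (hε : 0 < ε) (hκε : κ * ε ≤ 1) :
    ε ≤ ‖∫ t in (0 : ℝ)..ε, 2 * Complex.exp (Complex.I * (κ * (t * sin θ) : ℝ))‖ := by
  refine le_trans ?_ (Complex.re_le_norm _)
  have hc : Continuous fun t : ℝ => 2 * Complex.exp (Complex.I * (κ * (t * sin θ) : ℝ)) := by
    fun_prop
  have e : (∫ t in (0 : ℝ)..ε, 2 * Complex.exp (Complex.I * (κ * (t * sin θ) : ℝ))).re =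
      ∫ t in (0 : ℝ)..ε, 2 * cos (κ * (t * sin θ)) := by
    rw [intervalIntegral.integral_of_le hε.le, intervalIntegral.integral_of_le hε.le]
    have h1 : Integrable (fun t : ℝ => 2 * Complex.exp (Complex.I * (κ * (t * sin θ) : ℝ)))
        (volume.restrict (Set.Ioc 0 ε)) := (hc.intervalIntegrable 0 ε).1
    rw [show (∫ t in Set.Ioc 0 ε, 2 * Complex.exp (Complex.I * (κ * (t * sin θ) : ℝ))).re =
      ∫ t in Set.Ioc 0 ε, (2 * Complex.exp (Complex.I * (κ * (t * sin θ) : ℝ))).re from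
      (integral_re h1).symm]
    refine integral_congr_ae (Eventually.of_forall fun t => ?_)
    simp only
    rw [mul_comm Complex.I, show (2 : ℂ) = ((2 : ℝ) : ℂ) by norm_num, Complex.re_ofReal_mul,
      Complex.exp_ofReal_mul_I_re]
  rw [e]
  have h1 : ∫ _ in (0 : ℝ)..ε, (1 : ℝ) ≤ ∫ t in (0 : ℝ)..ε, 2 * cos (κ * (t * sin θ)) := by
    refine intervalIntegral.integral_mono_on hε.le intervalIntegrable_const
      (Continuous.intervalIntegrable (by fun_prop) _ _) fun t ht => ?_
    have h2 : |κ * (t * sin θ)| ≤ 1 := by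
      rw [abs_mul, abs_mul, abs_of_pos hκ, abs_of_nonneg ht.1]
      calc κ * (t * |sin θ|) ≤ κ * (ε * 1) := by
            have := ht.2
            have := ht.1
            gcongr
            exact abs_sin_le_one θ
        _ ≤ 1 := by linarith
    have h3 := Real.one_sub_sq_div_two_le_cos (x := κ * (t * sin θ))
    have h4 : (κ * (t * sin θ)) ^ 2 ≤ 1 := by rw [← sq_abs]; exact pow_le_one₀ (abs_nonneg _) h2
    linarith
  simpa using h1

/-- Upper bound for the mean value of the field on the aperture. -/
theorem IsApproxSolution.norm_aperture_le (hκ : 0 < κ) (hε : 0 < ε) (hd : 0 < d)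
    (hκd : κ * d ≤ 1) (hκε : κ * ε ≤ π / 4) (hv : IsApproxSolution κ θ ε d v) :
    ‖∫ t in (0 : ℝ)..ε, v !₂[t, 0]‖ ≤ 2 * ε := by
  have hx : 0 < κ * d := mul_pos hκ hd
  have hs : 0 < sin (κ * d) := sin_pos_of_pos_of_lt_pi hx (by linarith [pi_gt_three])
  have hcos : 0 < cos (κ * d) := cos_pos_of_mem_Ioo ⟨by linarith [pi_gt_three], by linarith [pi_gt_three]⟩
  have h := hv.aperture_equation hκ hε hs
  have hJ : 0 ≤ (∫ y in (0 : ℝ)..ε, aperturePotential κ ε y).re := by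
    rw [intervalIntegral.integral_of_le hε.le, integral_Ioc_eq_integral_Ioo]
    exact re_integral_nonneg measurableSet_Ioo (Eventually.of_forall fun y hy =>
      aperturePotential_re_nonneg hκ hκε hy.1 hy.2)
  set m : ℝ := κ * cos (κ * d) / sin (κ * d) / (π * ε) with hm
  have hm0 : 0 ≤ m := by have := pi_pos; positivity
  set J := ∫ y in (0 : ℝ)..ε, aperturePotential κ ε y with hJdef
  -- The coefficient m and Re J are nonnegative, so no cancellation with 1 can occur.
  have h1 : 1 ≤ ‖1 + (m : ℂ) * J‖ := by
    refine le_trans ?_ (Complex.re_le_norm _)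
    rw [Complex.add_re, Complex.one_re, Complex.re_ofReal_mul]
    have := mul_nonneg hm0 hJ
    linarith
  have h2 := congrArg norm h
  rw [norm_mul] at h2
  have h3 := norm_integral_background_le (κ := κ) (θ := θ) hε
  rw [← h2] at h3
  nlinarith [norm_nonneg (∫ t in (0 : ℝ)..ε, v !₂[t, 0])]

/-- Lower bound for the mean value of the field on the aperture. -/
theorem IsApproxSolution.le_norm_aperture {C : ℝ} (hC0 : 0 ≤ C)
    (hC : ∀ r : ℝ, 0 < r → r ≤ 1 → ‖hankel 0 r‖ ≤ C + Real.log (1 / r)) (hκ : 0 < κ)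
    (hε : 0 < ε) (hd : 0 < d) (hεd : ε ≤ d) (hκd : κ * d ≤ 1)
    (hlog : ε * Real.log (wavelength κ / d) ≤ d) (hv : IsApproxSolution κ θ ε d v) :
    ε / (C + 5) ≤ ‖∫ t in (0 : ℝ)..ε, v !₂[t, 0]‖ := by
  have hx : 0 < κ * d := mul_pos hκ hd
  have hs : 0 < sin (κ * d) := sin_pos_of_pos_of_lt_pi hx (by linarith [pi_gt_three])
  have hcos : 0 < cos (κ * d) := cos_pos_of_mem_Ioo ⟨by linarith [pi_gt_three], by linarith [pi_gt_three]⟩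
  have hκε0 : 0 < κ * ε := mul_pos hκ hε
  have hκε : κ * ε ≤ 1 := (mul_le_mul_of_nonneg_left hεd hκ.le).trans hκd
  have h := hv.aperture_equation hκ hε hs
  set Λ : ℝ := Real.log (1 / (κ * ε)) with hΛ
  have hΛ0 : 0 ≤ Λ := Real.log_nonneg (by rw [le_div_iff₀ hκε0]; linarith)
  have hJ : ‖∫ y in (0 : ℝ)..ε, aperturePotential κ ε y‖ ≤ ε * (C + 2 + Λ) * ε := by
    have h1 : ‖∫ y in Set.Ioo 0 ε, aperturePotential κ ε y‖ ≤
        ε * (C + 2 + Λ) * volume.real (Set.Ioo 0 ε) :=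
      norm_setIntegral_le_of_norm_le_const (by simp)
        fun y hy => norm_aperturePotential_le hC hκ hκε hy.1 hy.2
    rw [intervalIntegral.integral_of_le hε.le, integral_Ioc_eq_integral_Ioo]
    simpa [hε.le] using h1
  set m : ℝ := κ * cos (κ * d) / sin (κ * d) / (π * ε) with hm
  have hm0 : 0 ≤ m := by have := pi_pos; positivity
  -- From x cos x ≤ sin x at x = κd, discarding the factor 1/π ≤ 1.
  have hmle : m * ε ≤ 1 / d := by
    have htan : κ * d * cos (κ * d) ≤ sin (κ * d) := by
      have := Real.le_tan hx.le (by linarith [pi_gt_three])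
      rwa [Real.tan_eq_sin_div_cos, le_div_iff₀ hcos] at this
    have e : m * ε = κ * cos (κ * d) / (sin (κ * d) * π) := by
      have := pi_pos
      rw [hm]; field_simp
    rw [e, div_le_div_iff₀ (by have := pi_pos; positivity) hd]
    have : 1 ≤ π := by linarith [pi_gt_three]
    nlinarith
  -- Since 1/(κε) ≤ (λ/d)(d/ε), Λ splits into two logarithms. Multiplied by ε/d, the first is at
  -- most 1 by hypothesis, the second because log x ≤ x.
  have hΛle : ε / d * Λ ≤ 2 := by
    have h1 : Λ ≤ Real.log (wavelength κ / d) + Real.log (d / ε) := by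
      have hw : 0 < wavelength κ := by unfold wavelength; have := pi_pos; positivity
      rw [← Real.log_mul (by positivity) (by positivity), hΛ]
      refine Real.log_le_log (by positivity) ?_
      have e : wavelength κ / d * (d / ε) = 2 * π / (κ * ε) := by
        unfold wavelength; field_simp
      rw [e]
      gcongr
      linarith [pi_gt_three]
    have h2 : Real.log (d / ε) ≤ d / ε := by
      have := Real.log_le_sub_one_of_pos (div_pos hd hε); linarith
    have h3 : ε / d * Real.log (wavelength κ / d) ≤ 1 := by
      rw [div_mul_eq_mul_div]; exact (div_le_one hd).2 hlog
    have h4 : ε / d * (d / ε) = 1 := by field_simp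
    have h5 := mul_le_mul_of_nonneg_left h1 (by positivity : 0 ≤ ε / d)
    have h6 := mul_le_mul_of_nonneg_left h2 (by positivity : 0 ≤ ε / d)
    nlinarith
  set J := ∫ y in (0 : ℝ)..ε, aperturePotential κ ε y with hJdef
  -- The total is 1, plus C + 2 since ε ≤ d, plus 2 from the logarithm.
  have h1 : ‖1 + (m : ℂ) * J‖ ≤ C + 5 := by
    refine (norm_add_le _ _).trans ?_
    rw [norm_one, norm_mul, Complex.norm_of_nonneg hm0]
    have h2 := mul_le_mul_of_nonneg_left hJ hm0
    have h3 : m * (ε * (C + 2 + Λ) * ε) ≤ 1 / d * ((C + 2 + Λ) * ε) := by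
      calc m * (ε * (C + 2 + Λ) * ε) = m * ε * ((C + 2 + Λ) * ε) := by ring
        _ ≤ _ := by gcongr
    have h4 : 1 / d * ((C + 2 + Λ) * ε) = ε / d * (C + 2) + ε / d * Λ := by ring
    have h5 : ε / d ≤ 1 := (div_le_one hd).2 hεd
    nlinarith
  have h2 := congrArg norm h
  rw [norm_mul] at h2
  have h3 := le_norm_integral_background (θ := θ) hκ hε hκε
  rw [← h2] at h3
  rw [div_le_iff₀ (by positivity)]
  exact h3.trans (mul_le_mul_of_nonneg_left h1 (norm_nonneg _))

end

end Cavity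

end

/-! ### Assembling the two-sided estimate -/

theorem theorem2p2 :
    ∃ δ C₃ C₄ : ℝ, 0 < δ ∧ 0 < C₃ ∧ 0 < C₄ ∧
      ∀ (κ θ ε d : ℝ) (v : Cavity.Plane → ℂ),
        0 < κ → -(π / 2) < θ → θ < π / 2 → 0 < ε → 0 < d →
        ε ≤ δ * d → d ≤ δ * Cavity.wavelength κ →
        Cavity.IsApproxSolution κ θ ε d v →
          eLpNorm v 2 (volume.restrict (Cavity.cavity ε d)) ≤ ENNReal.ofReal (C₄ * √(ε * d)) ∧
          (ε * Real.log (Cavity.wavelength κ / d) ≤ d →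
            ENNReal.ofReal (C₃ * √(ε * d)) ≤
              eLpNorm v 2 (volume.restrict (Cavity.cavity ε d))) := by
  obtain ⟨C, hC0, hC⟩ := Cavity.exists_norm_hankel_zero_le_log
  -- With δ = 1/20, κd ≤ π/10 < 1/2. The constant 2 is the bound on |S|/ε. In the lower constant,
  -- 1/(C+5) bounds |S|/ε, one factor 1/2 comes from the sine ratio and another from restricting to
  -- half the cavity.
  refine ⟨1 / 20, 1 / (4 * (C + 5)), 2, by norm_num, by positivity, by norm_num, ?_⟩
  intro κ θ ε d v hκ _ _ hε hd hεd hdw hv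
  have hκd : κ * d ≤ 1 / 2 := by
    rw [Cavity.wavelength] at hdw
    have e : κ * (1 / 20 * (2 * π / κ)) = π / 10 := by field_simp; norm_num
    have := mul_le_mul_of_nonneg_left hdw hκ.le
    rw [e] at this
    linarith [pi_lt_four]
  have hx : 0 < κ * d := mul_pos hκ hd
  have hεd' : ε ≤ d := by linarith
  have hκε : κ * ε ≤ π / 4 :=
    (mul_le_mul_of_nonneg_left hεd' hκ.le).trans (by linarith [pi_gt_three])
  have hs : 0 < sin (κ * d) := sin_pos_of_pos_of_lt_pi hx (by linarith [pi_gt_three])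
  have hnorm := fun x hx => hv.norm_cavity hε hs (x := x) hx
  constructor
  · refine Cavity.eLpNorm_le_of_norm_le hε.le hd.le fun x hxc => ?_
    have h1 := hv.norm_aperture_le hκ hε hd (by linarith) hκε
    rw [hnorm x hxc]
    have hx1 : 0 < κ * (x 1 + d) := mul_pos hκ (by linarith [hxc.2.2.1])
    have hx2 : κ * (x 1 + d) ≤ κ * d := mul_le_mul_of_nonneg_left (by linarith [hxc.2.2.2]) hκ.le
    have h2 : sin (κ * (x 1 + d)) ≤ sin (κ * d) :=
      sin_le_sin_of_le_of_le_pi_div_two (by linarith [pi_gt_three]) (by linarith [pi_gt_three]) hx2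
    have h3 : 0 < sin (κ * (x 1 + d)) := sin_pos_of_pos_of_lt_pi hx1 (by linarith [pi_gt_three])
    have h4 : |sin (κ * (x 1 + d)) / sin (κ * d)| ≤ 1 := by
      rw [abs_of_pos (div_pos h3 hs)]; exact (div_le_one hs).2 h2
    have h5 : ‖∫ t in (0 : ℝ)..ε, v !₂[t, 0]‖ / ε ≤ 2 := (div_le_iff₀ hε).2 h1
    calc _ ≤ 2 * (1 : ℝ) := mul_le_mul h5 h4 (abs_nonneg _) (by norm_num)
      _ = 2 := by norm_num
  · intro hlog
    have h1 := hv.le_norm_aperture hC0 hC hκ hε hd hεd' (by linarith) hlog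
    -- The sine vanishes at the bottom, so the pointwise lower bound is sought only in the upper
    -- half, where monotonicity and sin(2a) ≤ 2 sin a give a ratio of at least 1/2.
    have hsub : Cavity.cavity ε (d / 2) ⊆ Cavity.cavity ε d := fun x hx =>
      ⟨hx.1, hx.2.1, by linarith [hx.2.2.1], hx.2.2.2⟩
    have h2 : ∀ x ∈ Cavity.cavity ε (d / 2), 1 / (2 * (C + 5)) ≤ ‖v x‖ := by
      intro x hxc
      rw [hnorm x (hsub hxc)]
      have hx1 : κ * (d / 2) ≤ κ * (x 1 + d) :=
        mul_le_mul_of_nonneg_left (by linarith [hxc.2.2.1]) hκ.le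
      have hx2 : κ * (x 1 + d) ≤ κ * d :=
        mul_le_mul_of_nonneg_left (by linarith [hxc.2.2.2]) hκ.le
      have hx3 : 0 < κ * (d / 2) := by positivity
      have h3 : sin (κ * (d / 2)) ≤ sin (κ * (x 1 + d)) :=
        sin_le_sin_of_le_of_le_pi_div_two (by linarith [pi_gt_three])
          (by linarith [pi_gt_three]) hx1
      have h4 : sin (κ * d) ≤ 2 * sin (κ * (d / 2)) := by
        have e : κ * d = 2 * (κ * (d / 2)) := by ring
        have hp : 0 < sin (κ * (d / 2)) := sin_pos_of_pos_of_lt_pi hx3 (by linarith [pi_gt_three])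
        rw [e, sin_two_mul]
        nlinarith [cos_le_one (κ * (d / 2))]
      have h5 : 1 / 2 ≤ |sin (κ * (x 1 + d)) / sin (κ * d)| := by
        refine le_trans ?_ (le_abs_self _)
        rw [le_div_iff₀ hs]; linarith
      have h6 : 1 / (C + 5) ≤ ‖∫ t in (0 : ℝ)..ε, v !₂[t, 0]‖ / ε := by
        rw [le_div_iff₀ hε]
        calc 1 / (C + 5) * ε = ε / (C + 5) := by ring
          _ ≤ _ := h1
      calc 1 / (2 * (C + 5)) = 1 / (C + 5) * (1 / 2) := by field_simp
        _ ≤ _ := mul_le_mul h6 h5 (by norm_num) (by positivity)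
    have h3 := Cavity.le_eLpNorm_of_le_norm hε.le (by positivity : 0 ≤ d / 2)
      (by positivity : 0 ≤ 1 / (2 * (C + 5))) h2
    refine le_trans (ENNReal.ofReal_le_ofReal ?_)
      (h3.trans (eLpNorm_mono_measure v (Measure.restrict_mono hsub le_rfl)))
    have h4 : 1 / 2 * √(ε * d) ≤ √(ε * (d / 2)) := by
      apply Real.le_sqrt_of_sq_le
      rw [mul_pow, Real.sq_sqrt (by positivity)]
      nlinarith [mul_pos hε hd]
    calc 1 / (4 * (C + 5)) * √(ε * d) = 1 / (2 * (C + 5)) * (1 / 2 * √(ε * d)) := by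
          field_simp; norm_num
      _ ≤ _ := by gcongr
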